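/- Let $\Bbbk$ be an algebraically closed field of characteristic $0$ and let $n\geq 1$. Let $A_n$ be the quotient of the zigzag algebra of the star graph with center $0$ and leaves $1,\dots,n$ by the span of the $2$-cycles at the leaves: it has the $\Bbbk$-basis $e_0,e_i,a_i,b_i,c$ ($1\le i\le n$), where $e_0,\dots,e_n$ are orthogonal idempotents with sum $1$, $a_i=e_ia_ie_0$, $b_i=e_0b_ie_i$, $c=e_0ce_0$, $b_ia_i=c$, and all other products of two elements among the $a_i,b_i,c$ are $0$. Write $A=A_n$. Let $\mathscr B$ be the bicategory with one object $\mathtt i$ given by the monoidal category $(\mathrm{add}\{{}_AA_A,\ Ae_k\otimes_\Bbbk e_0A \mid 0\le k\le n\},\otimes_A)$ of $A$-$A$-bimodules. Let $[\mathscr B,\mathbf{Cat}_\Bbbk]_\Bbbk$ be the bicategory of $\Bbbk$-linear pseudofunctors from $\mathscr B$ to $\Bbbk$-linear categories, with strong transformations and modifications. Such a pseudofunctor is a finitary birepresentation if its value at $\mathtt i$ is $\Bbbk$-linearly equivalent to the category of finite dimensional projective modules over some finite dimensional $\Bbbk$-algebra. Let $\mathbf P$ be the principal birepresentation $\mathscr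 B(\mathtt i,-)$, let $\Gamma:\mathbf N\to\mathbf P$ be the inclusion of the subbirepresentation $\mathbf N=\mathrm{add}\{Ae_k\otimes_\Bbbk e_0A\mid 0\le k\le n\}$, and let $\mathbf C$ be the birepresentation with $\mathbf C(\mathtt i)=A\text{-proj}$, on which a bimodule $M$ acts by $M\otimes_A-$. For $0\le j\le n$ let $\Theta_j=-\otimes_AAe_j:\mathbf P\to\mathbf C$. For $1\le j,l\le n$ let $s_{j,l}:\Theta_j\circ\Gamma\cong\Theta_l\circ\Gamma$ be the invertible modification whose component at $M\in\mathbf N(\mathtt i)$ is the composite $M\otimes_AAe_j\cong Me_j\to Mc\to Me_l\cong M\otimes_AAe_l$, where $Me_j\to Mc$ is the isomorphism given by right multiplication by $a_j$, and $Mc\to Me_l$ is the inverse of right multiplication by $a_l$. Let $\mathfrak P$ be a set partition $$\{0,\dots,n\}=\{0\}\sqcup\{i^1_1,\dots,i^1_{k_1}\}\sqcup\cdots\sqcup\{i^r_1,\dots,i^r_{k_r}\}.$$ Let $\Omega^{\mathtt W}:\mathbf C\to\mathbf C^{\mathtt W}(\mathfrak P)$, with invertible modifications $\widehat x^m_l:\Omega^{\mathtt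 W}\circ\Theta_{i^m_l}\cong\Omega^{\mathtt W}\circ\Theta_{i^m_{l+1}}$ for $1\le m\le r$ and $1\le l<k_m$, be the multiple (bicategorical) coisoinserter in $[\mathscr B,\mathbf{Cat}_\Bbbk]_\Bbbk$ of the pairs $\Theta_{i^m_l},\Theta_{i^m_{l+1}}:\mathbf P\to\mathbf C$. Let $\Omega^{\mathtt R}:\mathbf C^{\mathtt W}(\mathfrak P)\to\mathbf C^{\mathtt{WR}}(\mathfrak P)$ be the multiple (bicategorical) coequifier of the pairs $\widehat x^m_l\bullet\Gamma$ and $\Omega^{\mathtt W}\bullet s_{i^m_l,i^m_{l+1}}$, and let $\Omega=\Omega^{\mathtt R}\circ\Omega^{\mathtt W}:\mathbf C\to\mathbf C^{\mathtt{WR}}(\mathfrak P)$. Then these colimits exist and, for every choice of them, $\mathbf C^{\mathtt{WR}}(\mathfrak P)$ is a finitary birepresentation of $\mathscr B$, and $\mathbf C^{\mathtt{WR}}(\mathfrak P)(\mathtt i)$ is $\Bbbk$-linearly equivalent to $A_r\text{-proj}$. Moreover: 1. $\Omega$ is faithful. 2. For indecomposable objects $X,Y\in\mathbf C(\mathtt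 i)$, the map $\Omega_{X,Y}:\mathrm{Hom}(X,Y)\to\mathrm{Hom}(\Omega(X),\Omega(Y))$ is a bijection unless $X\not\cong Y$ and $\Omega(X)\cong\Omega(Y)$, and in this exceptional case it is not a bijection. 3. If $U\subseteq\{0,\dots,n\}$ is a transversal of $\mathfrak P$ (it contains exactly one element of each block), then the restriction of $\Omega$ to $\mathrm{add}\{Ae_k\mid k\in U\}$ is an equivalence of categories. -/

import Mathlib

universe u v w v' w' v'' w''

noncomputable section

open CategoryTheory MonoidalCategory MulOpposite
open scoped TensorProduct

set_option linter.unusedSectionVars false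

namespace StarRep
/-! ### Tensor product of a bimodule with a left module over a noncommutative ring -/

section NTensor

variable (A : Type u) [Ring A]

/-- The balancing relations `m a ⊗ x = m ⊗ a x`. -/
def NTensor.rel (M X : Type u) [AddCommGroup M] [AddCommGroup X] [Module Aᵐᵒᵖ M] [Module A X] :
    AddSubgroup (M ⊗[ℤ] X) :=
  AddSubgroup.closure
    {t | ∃ (m : M) (a : A) (x : X), t = (op a • m) ⊗ₜ[ℤ] x - m ⊗ₜ[ℤ] (a • x)}

/-- The tensor product `M ⊗_A X` of a right `A`-module `M` and a left `A`-module `X`;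
right modules are modules over `Aᵐᵒᵖ`. -/
def NTensor (M X : Type u) [AddCommGroup M] [AddCommGroup X] [Module Aᵐᵒᵖ M] [Module A X] :
    Type u :=
  (M ⊗[ℤ] X) ⧸ NTensor.rel A M X

namespace NTensor

variable {M M' M'' X X' X'' P : Type u} [AddCommGroup M] [AddCommGroup M'] [AddCommGroup M'']
  [AddCommGroup X] [AddCommGroup X'] [AddCommGroup X''] [AddCommGroup P]
  [Module Aᵐᵒᵖ M] [Module Aᵐᵒᵖ M'] [Module Aᵐᵒᵖ M'']
  [Module A X] [Module A X'] [Module A X'']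

instance : AddCommGroup (NTensor A M X) :=
  inferInstanceAs (AddCommGroup ((M ⊗[ℤ] X) ⧸ NTensor.rel A M X))

/-- The pure tensor `m ⊗ x`. -/
def tmul (m : M) (x : X) : NTensor A M X :=
  QuotientAddGroup.mk (m ⊗ₜ[ℤ] x)

variable {A}

theorem tmul_add (m : M) (x y : X) : tmul A m (x + y) = tmul A m x + tmul A m y :=
  congrArg (QuotientAddGroup.mk (s := NTensor.rel A M X)) (TensorProduct.tmul_add m x y)

theorem add_tmul (m m' : M) (x : X) : tmul A (m + m') x = tmul A m x + tmul A m' x :=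
  congrArg (QuotientAddGroup.mk (s := NTensor.rel A M X)) (TensorProduct.add_tmul m m' x)

theorem smul_tmul (m : M) (a : A) (x : X) : tmul A (op a • m) x = tmul A m (a • x) := by
  refine (QuotientAddGroup.eq_iff_sub_mem (N := NTensor.rel A M X)).2 ?_
  exact AddSubgroup.subset_closure ⟨m, a, x, rfl⟩

theorem induction {p : NTensor A M X → Prop} (t : NTensor A M X) (h0 : p 0)
    (ht : ∀ m x, p (tmul A m x)) (ha : ∀ s t, p s → p t → p (s + t)) : p t := by
  obtain ⟨t, rfl⟩ := QuotientAddGroup.mk_surjective t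
  induction t using TensorProduct.induction_on with
  | zero => exact h0
  | tmul m x => exact ht m x
  | add s t hs ht' => exact ha _ _ hs ht'

/-- The universal property: balanced biadditive maps extend to the tensor product. -/
def lift (f : M →+ X →+ P) (hf : ∀ m (a : A) x, f (op a • m) x = f m (a • x)) :
    NTensor A M X →+ P :=
  QuotientAddGroup.lift (NTensor.rel A M X)
    (TensorProduct.liftAddHom f (fun r m x => by simp)) (by
      refine (AddSubgroup.closure_le _).2 ?_
      rintro _ ⟨m, a, x, rfl⟩
      simp [hf])

@[simp]
theorem lift_tmul (f : M →+ X →+ P) (hf : ∀ m (a : A) x, f (op a • m) x = f m (a • x))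
    (m : M) (x : X) : lift f hf (tmul A m x) = f m x := by
  rfl

theorem hom_ext {f g : NTensor A M X →+ P} (h : ∀ m x, f (tmul A m x) = g (tmul A m x)) :
    f = g := by
  ext t
  induction t using NTensor.induction with
  | h0 => simp
  | ht m x => exact h m x
  | ha s t hs ht => simp [hs, ht]

variable (A) in
/-- `m ↦ x ↦ m ⊗ x` as a biadditive map. -/
def mk (M X : Type u) [AddCommGroup M] [AddCommGroup X] [Module Aᵐᵒᵖ M] [Module A X] :
    M →+ X →+ NTensor A M X :=
  AddMonoidHom.mk' (fun m => AddMonoidHom.mk' (fun x => tmul A m x) (tmul_add m))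
    (fun m m' => by ext x; exact add_tmul m m' x)

@[simp]
theorem mk_apply (m : M) (x : X) : mk A M X m x = tmul A m x := rfl

@[simp]
theorem zero_tmul (x : X) : tmul A (0 : M) x = 0 := by
  rw [← mk_apply, map_zero, AddMonoidHom.zero_apply]

@[simp]
theorem tmul_zero (m : M) : tmul A m (0 : X) = 0 := by
  rw [← mk_apply, map_zero]

/-- Functoriality of `M ⊗_A X` in both variables. -/
def map (f : M →ₗ[Aᵐᵒᵖ] M') (g : X →ₗ[A] X') : NTensor A M X →+ NTensor A M' X' :=
  lift (((mk A M' X').comp f.toAddMonoidHom).compl₂ g.toAddMonoidHom) (fun m a x => by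
    simp [smul_tmul])

@[simp]
theorem map_tmul (f : M →ₗ[Aᵐᵒᵖ] M') (g : X →ₗ[A] X') (m : M) (x : X) :
    map f g (tmul A m x) = tmul A (f m) (g x) := by
  simp [map]

section actions

variable [Module A M] [SMulCommClass A Aᵐᵒᵖ M]

instance : SMul A (NTensor A M X) :=
  ⟨fun a t => map (Module.toModuleEnd Aᵐᵒᵖ M a) LinearMap.id t⟩

@[simp]
theorem smul_tmul_left (a : A) (m : M) (x : X) : a • tmul A m x = tmul A (a • m) x :=
  map_tmul _ _ m x

/-- The left action of `A` on `M ⊗_A X` through `M`. -/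
instance : Module A (NTensor A M X) where
  smul_zero a := map_zero (map (Module.toModuleEnd Aᵐᵒᵖ M a) LinearMap.id)
  smul_add a := map_add (map (Module.toModuleEnd Aᵐᵒᵖ M a) LinearMap.id)
  one_smul t := by
    change map (X := X) (Module.toModuleEnd Aᵐᵒᵖ M 1) LinearMap.id t = AddMonoidHom.id _ t
    congr 1; apply hom_ext; simp
  mul_smul a b t := by
    change map (X := X) (Module.toModuleEnd Aᵐᵒᵖ M (a * b)) LinearMap.id t =
      ((map (Module.toModuleEnd Aᵐᵒᵖ M a) LinearMap.id).comp
        (map (Module.toModuleEnd Aᵐᵒᵖ M b) LinearMap.id)) t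
    congr 1; apply hom_ext; simp [mul_smul]
  add_smul a b t := by
    change map (X := X) (Module.toModuleEnd Aᵐᵒᵖ M (a + b)) LinearMap.id t =
      (map (Module.toModuleEnd Aᵐᵒᵖ M a) LinearMap.id +
        map (Module.toModuleEnd Aᵐᵒᵖ M b) LinearMap.id : NTensor A M X →+ NTensor A M X) t
    congr 1; apply hom_ext; simp [add_smul, add_tmul]
  zero_smul t := by
    change map (X := X) (Module.toModuleEnd Aᵐᵒᵖ M 0) LinearMap.id t = (0 : _ →+ _) t
    congr 1; apply hom_ext; simp

end actions

/-- Right multiplication on a bimodule, as a left linear map. -/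
def rightMul (X : Type u) [AddCommGroup X] [Module A X] [Module Aᵐᵒᵖ X] [SMulCommClass A Aᵐᵒᵖ X]
    (a : Aᵐᵒᵖ) : X →ₗ[A] X where
  toFun x := a • x
  map_add' := smul_add a
  map_smul' b x := (smul_comm b a x).symm

@[simp]
theorem rightMul_apply (X : Type u) [AddCommGroup X] [Module A X] [Module Aᵐᵒᵖ X]
    [SMulCommClass A Aᵐᵒᵖ X] (a : Aᵐᵒᵖ) (x : X) : rightMul X a x = a • x := rfl

section actions

variable [Module Aᵐᵒᵖ X] [SMulCommClass A Aᵐᵒᵖ X]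

instance : SMul Aᵐᵒᵖ (NTensor A M X) :=
  ⟨fun a t => map LinearMap.id (rightMul X a) t⟩

@[simp]
theorem smul_tmul_right (a : Aᵐᵒᵖ) (m : M) (x : X) : a • tmul A m x = tmul A m (a • x) :=
  map_tmul _ _ m x

/-- The right action of `A` on `M ⊗_A X` through the bimodule `X`. -/
instance : Module Aᵐᵒᵖ (NTensor A M X) where
  smul_zero a := map_zero (map LinearMap.id (rightMul X a))
  smul_add a := map_add (map LinearMap.id (rightMul X a))
  one_smul t := by
    change map (M := M) LinearMap.id (rightMul X 1) t = AddMonoidHom.id _ t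
    congr 1; apply hom_ext; simp
  mul_smul a b t := by
    change map (M := M) LinearMap.id (rightMul X (a * b)) t =
      ((map LinearMap.id (rightMul X a)).comp (map LinearMap.id (rightMul X b))) t
    congr 1; apply hom_ext; simp [mul_smul]
  add_smul a b t := by
    change map (M := M) LinearMap.id (rightMul X (a + b)) t =
      (map LinearMap.id (rightMul X a) + map LinearMap.id (rightMul X b) :
        NTensor A M X →+ NTensor A M X) t
    congr 1; apply hom_ext; simp [tmul_add, add_smul]
  zero_smul t := by
    change map (M := M) LinearMap.id (rightMul X 0) t = (0 : _ →+ _) t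
    congr 1; apply hom_ext; simp

instance [Module A M] [SMulCommClass A Aᵐᵒᵖ M] : SMulCommClass A Aᵐᵒᵖ (NTensor A M X) where
  smul_comm a b t := by
    induction t using NTensor.induction with
    | h0 => simp
    | ht m x => simp
    | ha s t hs ht => simp [hs, ht]

end actions

end NTensor

/-- A left `A`-linear map out of `M ⊗_A X` from its values on pure tensors. -/
def NTensor.linearMk {A : Type u} [Ring A] {M X Y : Type u} [AddCommGroup M] [AddCommGroup X]
    [AddCommGroup Y] [Module A M] [Module Aᵐᵒᵖ M] [SMulCommClass A Aᵐᵒᵖ M] [Module A X]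
    [Module A Y] (f : NTensor A M X →+ Y)
    (hf : ∀ (a : A) m x, f (tmul A (a • m) x) = a • f (tmul A m x)) : NTensor A M X →ₗ[A] Y where
  toFun := f
  map_add' := map_add f
  map_smul' a t := by
    induction t using NTensor.induction with
    | h0 => simp
    | ht m x => simp [hf]
    | ha s t hs ht => simp_all

@[simp]
theorem NTensor.linearMk_apply {A : Type u} [Ring A] {M X Y : Type u} [AddCommGroup M]
    [AddCommGroup X] [AddCommGroup Y] [Module A M] [Module Aᵐᵒᵖ M] [SMulCommClass A Aᵐᵒᵖ M]
    [Module A X] [Module A Y] (f : NTensor A M X →+ Y)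
    (hf : ∀ (a : A) m x, f (tmul A (a • m) x) = a • f (tmul A m x)) (t : NTensor A M X) :
    NTensor.linearMk f hf t = f t := rfl

theorem NTensor.linear_ext {A : Type u} [Ring A] {M X Y : Type u} [AddCommGroup M]
    [AddCommGroup X] [AddCommGroup Y] [Module A M] [Module Aᵐᵒᵖ M] [SMulCommClass A Aᵐᵒᵖ M]
    [Module A X] [Module A Y] {f g : NTensor A M X →ₗ[A] Y}
    (h : ∀ m x, f (tmul A m x) = g (tmul A m x)) : f = g := by
  ext t
  exact DFunLike.congr_fun (NTensor.hom_ext (f := f.toAddMonoidHom) (g := g.toAddMonoidHom) h) t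

namespace NTensor

variable {A}
variable {M N X : Type u} [AddCommGroup M] [AddCommGroup N] [AddCommGroup X]
  [Module A M] [Module Aᵐᵒᵖ M] [SMulCommClass A Aᵐᵒᵖ M]
  [Module A N] [Module Aᵐᵒᵖ N] [SMulCommClass A Aᵐᵒᵖ N] [Module A X]

/-- `n ↦ n ⊗ x`. -/
def tmulRight (N : Type u) [AddCommGroup N] [Module A N] [Module Aᵐᵒᵖ N] [SMulCommClass A Aᵐᵒᵖ N]
    (x : X) : N →ₗ[A] NTensor A N X where
  toFun n := tmul A n x
  map_add' n n' := add_tmul n n' x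
  map_smul' a n := by simp

/-- `n ↦ m ⊗ n`. -/
def tmulLeft (N : Type u) [AddCommGroup N] [Module A N] [Module Aᵐᵒᵖ N] [SMulCommClass A Aᵐᵒᵖ N]
    (m : M) : N →ₗ[Aᵐᵒᵖ] NTensor A M N where
  toFun n := tmul A m n
  map_add' n n' := tmul_add m n n'
  map_smul' a n := by simp

/-- `(m ⊗ n) ⊗ x ↦ m ⊗ (n ⊗ x)`. -/
def assocHom (M N X : Type u) [AddCommGroup M] [AddCommGroup N] [AddCommGroup X]
    [Module A M] [Module Aᵐᵒᵖ M] [SMulCommClass A Aᵐᵒᵖ M]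
    [Module A N] [Module Aᵐᵒᵖ N] [SMulCommClass A Aᵐᵒᵖ N] [Module A X] :
    NTensor A (NTensor A M N) X →+ NTensor A M (NTensor A N X) :=
  lift (AddMonoidHom.flip (AddMonoidHom.mk'
      (fun x : X => map (LinearMap.id : M →ₗ[Aᵐᵒᵖ] M) (tmulRight N x))
      (fun x y => by apply hom_ext; intro m n; simp [tmulRight, tmul_add])))
    (fun t a x => by
      induction t using NTensor.induction with
      | h0 => simp
      | ht m n => simp [tmulRight, smul_tmul]
      | ha s t hs ht => simp_all)

/-- `m ⊗ (n ⊗ x) ↦ (m ⊗ n) ⊗ x`. -/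
def assocInv (M N X : Type u) [AddCommGroup M] [AddCommGroup N] [AddCommGroup X]
    [Module A M] [Module Aᵐᵒᵖ M] [SMulCommClass A Aᵐᵒᵖ M]
    [Module A N] [Module Aᵐᵒᵖ N] [SMulCommClass A Aᵐᵒᵖ N] [Module A X] :
    NTensor A M (NTensor A N X) →+ NTensor A (NTensor A M N) X :=
  lift (AddMonoidHom.mk'
      (fun m : M => map (tmulLeft N m) (LinearMap.id : X →ₗ[A] X))
      (fun x y => by apply hom_ext; intro m n; simp [tmulLeft, add_tmul]))
    (fun m a t => by
      induction t using NTensor.induction with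
      | h0 => simp
      | ht m n => simp [tmulLeft, smul_tmul]
      | ha s t hs ht => simp_all)

@[simp]
theorem assocHom_tmul (m : M) (n : N) (x : X) :
    assocHom M N X (tmul A (tmul A m n) x) = tmul A m (tmul A n x) := by
  simp [assocHom, tmulRight]

@[simp]
theorem assocInv_tmul (m : M) (n : N) (x : X) :
    assocInv M N X (tmul A m (tmul A n x)) = tmul A (tmul A m n) x := by
  simp [assocInv, tmulLeft]

/-- The associator. -/
def assoc (M N X : Type u) [AddCommGroup M] [AddCommGroup N] [AddCommGroup X]
    [Module A M] [Module Aᵐᵒᵖ M] [SMulCommClass A Aᵐᵒᵖ M]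
    [Module A N] [Module Aᵐᵒᵖ N] [SMulCommClass A Aᵐᵒᵖ N] [Module A X] :
    NTensor A (NTensor A M N) X ≃ₗ[A] NTensor A M (NTensor A N X) where
  toFun := assocHom M N X
  invFun := assocInv M N X
  map_add' := map_add _
  map_smul' a t := by
    induction t using NTensor.induction with
    | h0 => simp
    | ht t x =>
      induction t using NTensor.induction with
      | h0 => simp
      | ht m n => simp
      | ha s t hs ht => simp_all [add_tmul]
    | ha s t hs ht => simp_all
  left_inv t := by
    induction t using NTensor.induction with
    | h0 => simp
    | ht t x =>
      induction t using NTensor.induction with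
      | h0 => simp
      | ht m n => simp
      | ha s t hs ht => simp_all [add_tmul]
    | ha s t hs ht => simp_all
  right_inv t := by
    induction t using NTensor.induction with
    | h0 => simp
    | ht m t =>
      induction t using NTensor.induction with
      | h0 => simp
      | ht m n => simp
      | ha s t hs ht => simp_all [tmul_add]
    | ha s t hs ht => simp_all

@[simp]
theorem assoc_tmul (m : M) (n : N) (x : X) :
    assoc M N X (tmul A (tmul A m n) x) = tmul A m (tmul A n x) :=
  assocHom_tmul m n x

@[simp]
theorem assoc_symm_tmul (m : M) (n : N) (x : X) :
    (assoc M N X).symm (tmul A m (tmul A n x)) = tmul A (tmul A m n) x :=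
  assocInv_tmul m n x

theorem linear_ext₃ {Y : Type u} [AddCommGroup Y] [Module A Y]
    {f g : NTensor A (NTensor A M N) X →ₗ[A] Y}
    (h : ∀ m n x, f (tmul A (tmul A m n) x) = g (tmul A (tmul A m n) x)) : f = g := by
  apply linear_ext
  intro t x
  induction t using NTensor.induction with
  | h0 => simp
  | ht m n => exact h m n x
  | ha s t hs ht => simp [add_tmul, hs, ht]

/-- `a ⊗ x ↦ a x`. -/
def leftUnit (X : Type u) [AddCommGroup X] [Module A X] : NTensor A A X ≃ₗ[A] X where
  toFun := lift (AddMonoidHom.mk' (fun a => DistribSMul.toAddMonoidHom X a)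
      (fun a b => by ext x; simp [add_smul])) (fun m a x => by simp [mul_smul])
  invFun x := tmul A 1 x
  map_add' := map_add _
  map_smul' a t := by
    induction t using NTensor.induction with
    | h0 => simp
    | ht m x => simp [mul_smul]
    | ha s t hs ht => simp_all
  left_inv t := by
    induction t using NTensor.induction with
    | h0 => simp
    | ht m x => simp [← smul_tmul]
    | ha s t hs ht => simp_all [tmul_add]
  right_inv x := by simp

@[simp]
theorem leftUnit_tmul (a : A) (x : X) : leftUnit X (tmul A a x) = a • x := by
  simp [leftUnit]

@[simp]
theorem leftUnit_symm_apply (x : X) : (leftUnit X).symm x = tmul A 1 x := rfl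

/-- `m ⊗ a ↦ m a`. -/
def rightUnit (M : Type u) [AddCommGroup M] [Module A M] [Module Aᵐᵒᵖ M]
    [SMulCommClass A Aᵐᵒᵖ M] : NTensor A M A ≃ₗ[A] M where
  toFun := lift (AddMonoidHom.flip (AddMonoidHom.mk'
      (fun a : A => DistribSMul.toAddMonoidHom M (op a))
      (fun a b => by ext x; simp [add_smul]))) (fun m a x => by simp [mul_smul])
  invFun m := tmul A m 1
  map_add' := map_add _
  map_smul' a t := by
    induction t using NTensor.induction with
    | h0 => simp
    | ht m x => simp [smul_comm]
    | ha s t hs ht => simp_all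
  left_inv t := by
    induction t using NTensor.induction with
    | h0 => simp
    | ht m x => simp [smul_tmul]
    | ha s t hs ht => simp_all [add_tmul]
  right_inv x := by simp

@[simp]
theorem rightUnit_tmul (m : M) (a : A) : rightUnit M (tmul A m a) = op a • m := by
  simp [rightUnit]

@[simp]
theorem rightUnit_symm_apply (m : M) : (rightUnit M).symm m = tmul A m (1 : A) := rfl

end NTensor
end NTensor

/-! ### The monoidal category of bimodules and its action on left modules -/

section Bimodules

variable (k : Type u) [Field k] (A : Type u) [Ring A] [Algebra k A]

/-- An `A`-`A`-bimodule over the `k`-algebra `A`: commuting left and right actions of `A` such that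
the two induced actions of `k` agree. -/
structure Bim where
  carrier : Type u
  [addCommGroup : AddCommGroup carrier]
  [left : Module A carrier]
  [right : Module Aᵐᵒᵖ carrier]
  [comm : SMulCommClass A Aᵐᵒᵖ carrier]
  central : ∀ (c : k) (m : carrier), op (algebraMap k A c) • m = algebraMap k A c • m

namespace Bim

attribute [instance] addCommGroup left right comm

variable {k A}

/-- Bimodule homomorphisms: left linear maps that commute with the right action. -/
@[ext]
structure Hom (M N : Bim k A) where
  lin : M.carrier →ₗ[A] N.carrier
  map_op : ∀ (a : Aᵐᵒᵖ) (m : M.carrier), lin (a • m) = a • lin m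

instance : Category (Bim k A) where
  Hom M N := Hom M N
  id M := ⟨LinearMap.id, fun _ _ => rfl⟩
  comp f g := ⟨g.lin.comp f.lin, fun a m => by simp [f.map_op, g.map_op]⟩

/-- The right linear map underlying a bimodule homomorphism. -/
def Hom.rlin {M N : Bim k A} (f : Hom M N) : M.carrier →ₗ[Aᵐᵒᵖ] N.carrier where
  toFun := f.lin
  map_add' := map_add _
  map_smul' := f.map_op

@[simp]
theorem rlin_apply {M N : Bim k A} (f : M ⟶ N) (m : M.carrier) : Hom.rlin f m = f.lin m := rfl

@[simp]
theorem id_lin (M : Bim k A) : Hom.lin (𝟙 M) = LinearMap.id := rfl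

@[simp]
theorem comp_lin {M N P : Bim k A} (f : M ⟶ N) (g : N ⟶ P) :
    Hom.lin (f ≫ g) = (Hom.lin g).comp (Hom.lin f) := rfl

@[ext]
theorem hom_ext {M N : Bim k A} {f g : M ⟶ N} (h : ∀ m, Hom.lin f m = Hom.lin g m) : f = g :=
  Hom.ext (LinearMap.ext h)

/-- A left linear equivalence commuting with the right action is an isomorphism of bimodules. -/
@[simps]
def mkIso {M N : Bim k A} (e : M.carrier ≃ₗ[A] N.carrier)
    (h : ∀ (a : Aᵐᵒᵖ) m, e (a • m) = a • e m) : M ≅ N where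
  hom := ⟨e.toLinearMap, h⟩
  inv := ⟨e.symm.toLinearMap, fun a m => by
    apply e.injective
    simp [h]⟩

section linear

variable {M N P : Bim k A}

instance : Add (M ⟶ N) := ⟨fun f g => ⟨Hom.lin f + Hom.lin g, fun a m => by
  simp [Hom.map_op f, Hom.map_op g]⟩⟩
instance : Zero (M ⟶ N) := ⟨⟨0, fun a m => by simp⟩⟩
instance : Neg (M ⟶ N) := ⟨fun f => ⟨-Hom.lin f, fun a m => by simp [Hom.map_op f]⟩⟩
instance : Sub (M ⟶ N) := ⟨fun f g => ⟨Hom.lin f - Hom.lin g, fun a m => by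
  simp [Hom.map_op f, Hom.map_op g, smul_sub]⟩⟩

/-- The underlying map of the product of a scalar and a bimodule homomorphism. -/
def smulLin (c : k) (f : M ⟶ N) : M.carrier →ₗ[A] N.carrier where
  toFun m := algebraMap k A c • Hom.lin f m
  map_add' := by simp
  map_smul' a m := by simp [← mul_smul, Algebra.commutes]

instance : SMul k (M ⟶ N) := ⟨fun c f => ⟨smulLin c f, fun a m => by
  simp [smulLin, Hom.map_op f, smul_comm]⟩⟩

@[simp] theorem add_lin (f g : M ⟶ N) : Hom.lin (f + g) = Hom.lin f + Hom.lin g := rfl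
@[simp] theorem zero_lin : Hom.lin (0 : M ⟶ N) = 0 := rfl
@[simp] theorem neg_lin (f : M ⟶ N) : Hom.lin (-f) = -Hom.lin f := rfl
@[simp] theorem sub_lin (f g : M ⟶ N) : Hom.lin (f - g) = Hom.lin f - Hom.lin g := rfl
@[simp] theorem smul_lin_apply (c : k) (f : M ⟶ N) (m : M.carrier) :
    Hom.lin (c • f) m = algebraMap k A c • Hom.lin f m := rfl

instance : AddCommGroup (M ⟶ N) where
  add_assoc f g h := by ext; simp [add_assoc]
  zero_add f := by ext; simp
  add_zero f := by ext; simp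
  nsmul := nsmulRec
  zsmul := zsmulRec
  neg_add_cancel f := by ext; simp
  add_comm f g := by ext; simp [add_comm]
  sub_eq_add_neg f g := by ext; simp [sub_eq_add_neg]

instance : Preadditive (Bim k A) where
  add_comp := by intros; ext; simp
  comp_add := by intros; ext; simp

instance : Module k (M ⟶ N) where
  one_smul f := by ext; simp
  mul_smul c d f := by ext; simp [mul_smul]
  smul_zero c := by ext; simp
  smul_add c f g := by ext; simp
  add_smul c d f := by ext; simp [add_smul]
  zero_smul f := by ext; simp

instance : Linear k (Bim k A) where
  smul_comp := by intros; ext; simp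
  comp_smul := by intros; ext; simp

end linear

/-- `M ⊗_A N`. -/
abbrev tensor (M N : Bim k A) : Bim k A where
  carrier := NTensor A M.carrier N.carrier
  central c t := by
    induction t using NTensor.induction with
    | h0 => simp
    | ht m n => simp [N.central, ← M.central, NTensor.smul_tmul]
    | ha s t hs ht => simp [hs, ht]

/-- `f ⊗_A g`. -/
def tensorMap {M M' N N' : Bim k A} (f : M ⟶ M') (g : N ⟶ N') : tensor M N ⟶ tensor M' N' where
  lin := NTensor.linearMk (NTensor.map (Hom.rlin f) (Hom.lin g)) (by simp)
  map_op a t := by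
    induction t using NTensor.induction with
    | h0 => simp
    | ht m n => simp [Hom.map_op g]
    | ha s t hs ht => simp_all

variable (k A) in
/-- The regular bimodule. -/
abbrev unit : Bim k A where
  carrier := A
  central c m := by simp [Algebra.commutes]

@[simp]
theorem tensorMap_tmul {M M' N N' : Bim k A} (f : M ⟶ M') (g : N ⟶ N') (m : M.carrier)
    (n : N.carrier) : Hom.lin (tensorMap f g) (NTensor.tmul A m n) =
      (NTensor.tmul A (Hom.lin f m) (Hom.lin g n) : NTensor A M'.carrier N'.carrier) :=
  NTensor.map_tmul _ _ m n

theorem tensor_hom_ext {M N P : Bim k A} {f g : tensor M N ⟶ P}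
    (h : ∀ m n, Hom.lin f (NTensor.tmul A m n) = Hom.lin g (NTensor.tmul A m n)) : f = g :=
  Hom.ext (NTensor.linear_ext h)

theorem tensor_hom_ext₃ {M N L P : Bim k A} {f g : tensor (tensor M N) L ⟶ P}
    (h : ∀ m n l, Hom.lin f (NTensor.tmul A (NTensor.tmul A m n) l) =
      Hom.lin g (NTensor.tmul A (NTensor.tmul A m n) l)) : f = g :=
  Hom.ext (NTensor.linear_ext₃ h)

/-- The associator. -/
def assocIso (M N L : Bim k A) : tensor (tensor M N) L ≅ tensor M (tensor N L) :=
  mkIso (NTensor.assoc M.carrier N.carrier L.carrier) (fun a t => by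
    induction t using NTensor.induction with
    | h0 => simp
    | ht t l =>
      induction t using NTensor.induction with
      | h0 => simp
      | ht m n => simp
      | ha s t hs ht => simp_all [NTensor.add_tmul]
    | ha s t hs ht => simp_all)

/-- The left unitor. -/
def leftUnitIso (M : Bim k A) : tensor (unit k A) M ≅ M :=
  mkIso (NTensor.leftUnit M.carrier) (fun a t => by
    induction t using NTensor.induction with
    | h0 => simp
    | ht m n => simp [smul_comm]
    | ha s t hs ht => simp_all)

/-- The right unitor. -/
def rightUnitIso (M : Bim k A) : tensor M (unit k A) ≅ M :=
  mkIso (NTensor.rightUnit M.carrier) (fun a t => by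
    induction t using NTensor.induction with
    | h0 => simp
    | ht m n => simp [mul_smul]
    | ha s t hs ht => simp_all)

end Bim
end Bimodules

section Bimodules

variable {k : Type u} [Field k] {A : Type u} [Ring A] [Algebra k A]

namespace Bim

instance : MonoidalCategoryStruct (Bim k A) where
  tensorObj := tensor
  whiskerLeft M _ _ f := tensorMap (𝟙 M) f
  whiskerRight f M := tensorMap f (𝟙 M)
  tensorHom := tensorMap
  tensorUnit := unit k A
  associator := assocIso
  leftUnitor := leftUnitIso
  rightUnitor := rightUnitIso

/-- Bimodules form a monoidal category under `⊗_A`. -/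
instance : MonoidalCategory (Bim k A) where
  tensorHom_def f g := tensor_hom_ext fun m n => rfl
  id_tensorHom_id M N := tensor_hom_ext fun m n => rfl
  tensorHom_comp_tensorHom f g h i := tensor_hom_ext fun m n => rfl
  whiskerLeft_id M N := tensor_hom_ext fun m n => rfl
  id_whiskerRight M N := tensor_hom_ext fun m n => rfl
  associator_naturality f g h := tensor_hom_ext₃ fun m n l => rfl
  leftUnitor_naturality f := tensor_hom_ext fun m n => (map_smul (Hom.lin f) _ n).symm
  rightUnitor_naturality f := tensor_hom_ext fun m n => (Hom.map_op f (op n) m).symm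
  pentagon M N L P := by
    refine Hom.ext (NTensor.linear_ext fun t p => ?_)
    induction t using NTensor.induction with
    | h0 => rw [NTensor.zero_tmul, map_zero, map_zero]
    | ht t l =>
      induction t using NTensor.induction with
      | h0 => rw [NTensor.zero_tmul, NTensor.zero_tmul, map_zero, map_zero]
      | ht m n => rfl
      | ha s t hs ht => rw [NTensor.add_tmul, NTensor.add_tmul, map_add, map_add, hs, ht]
    | ha s t hs ht => rw [NTensor.add_tmul, map_add, map_add, hs, ht]
  triangle M N := tensor_hom_ext₃ fun m a n => (NTensor.smul_tmul m a n).symm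

theorem whiskerLeft_tmul (M : Bim k A) {N N' : Bim k A} (f : N ⟶ N') (m : M.carrier)
    (n : N.carrier) :
    Hom.lin (M ◁ f) (NTensor.tmul A m n) = NTensor.tmul A m (Hom.lin f n) := rfl

theorem whiskerRight_tmul (M : Bim k A) {N N' : Bim k A} (f : N ⟶ N') (m : M.carrier)
    (n : N.carrier) :
    Hom.lin (f ▷ M) (NTensor.tmul A n m) = NTensor.tmul A (Hom.lin f n) m := rfl

theorem whiskerLeft_add' (M : Bim k A) {N N' : Bim k A} (f g : N ⟶ N') :
    M ◁ (f + g) = M ◁ f + M ◁ g :=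
  tensor_hom_ext fun m n => NTensor.tmul_add m (Hom.lin f n) (Hom.lin g n)

theorem add_whiskerRight' (M : Bim k A) {N N' : Bim k A} (f g : N ⟶ N') :
    (f + g) ▷ M = f ▷ M + g ▷ M :=
  tensor_hom_ext fun m n => NTensor.add_tmul (Hom.lin f m) (Hom.lin g m) n

theorem smul_whiskerRight' (M : Bim k A) {N N' : Bim k A} (c : k) (f : N ⟶ N') :
    (c • f) ▷ M = c • (f ▷ M) :=
  tensor_hom_ext fun _ _ => rfl

theorem whiskerLeft_smul' (M : Bim k A) {N N' : Bim k A} (c : k) (f : N ⟶ N') :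
    M ◁ (c • f) = c • (M ◁ f) :=
  tensor_hom_ext fun m n => by
    change NTensor.tmul A m (algebraMap k A c • Hom.lin f n) =
      NTensor.tmul A (algebraMap k A c • m) (Hom.lin f n)
    rw [← NTensor.smul_tmul, M.central]

end Bim

/-! The action of bimodules on left modules by `M ⊙ X = M ⊗_A X`. -/

/-- `M ⊗_A X` as a left module. -/
abbrev actObj (M : Bim k A) (X : ModuleCat.{u} A) : ModuleCat.{u} A :=
  ModuleCat.of A (NTensor A M.carrier X)

/-- `f ⊗_A g`. -/
def actMap {M M' : Bim k A} {X X' : ModuleCat.{u} A} (f : M ⟶ M') (g : X ⟶ X') :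
    actObj M X ⟶ actObj M' X' :=
  ModuleCat.ofHom (NTensor.linearMk (NTensor.map (Bim.Hom.rlin f) g.hom) (by simp))

theorem actMap_tmul {M M' : Bim k A} {X X' : ModuleCat.{u} A} (f : M ⟶ M') (g : X ⟶ X')
    (m : M.carrier) (x : X) :
    (actMap f g).hom (NTensor.tmul A m x) = NTensor.tmul A (Bim.Hom.lin f m) (g.hom x) := rfl

theorem act_hom_ext {M : Bim k A} {X Y : ModuleCat.{u} A} {f g : actObj M X ⟶ Y}
    (h : ∀ m x, f.hom (NTensor.tmul A m x) = g.hom (NTensor.tmul A m x)) : f = g :=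
  ModuleCat.hom_ext (NTensor.linear_ext h)

theorem act_hom_ext₃ {M N : Bim k A} {X Y : ModuleCat.{u} A}
    {f g : actObj (M ⊗ N) X ⟶ Y}
    (h : ∀ m n x, f.hom (NTensor.tmul A (NTensor.tmul A m n : (M ⊗ N).carrier) x) =
      g.hom (NTensor.tmul A (NTensor.tmul A m n : (M ⊗ N).carrier) x)) : f = g :=
  ModuleCat.hom_ext (NTensor.linear_ext₃ h)

instance : MonoidalLeftActionStruct (Bim k A) (ModuleCat.{u} A) where
  actionObj := actObj
  actionHomLeft f X := actMap f (𝟙 X)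
  actionHomRight M _ _ g := actMap (𝟙 M) g
  actionHom f g := actMap f g
  actionAssocIso M N X := (NTensor.assoc M.carrier N.carrier X).toModuleIso
  actionUnitIso X := (NTensor.leftUnit X).toModuleIso

/-- The bimodules act on left modules by tensor product over `A`. -/
instance : MonoidalLeftAction (Bim k A) (ModuleCat.{u} A) where
  actionHom_def f g := act_hom_ext fun _ _ => rfl
  actionHomRight_id M X := act_hom_ext fun _ _ => rfl
  id_actionHomLeft M X := act_hom_ext fun _ _ => rfl
  actionHom_comp f f' g g' := act_hom_ext fun _ _ => rfl
  actionAssocIso_hom_naturality f g h := act_hom_ext₃ fun _ _ _ => rfl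
  actionUnitIso_hom_naturality g := act_hom_ext fun a x => map_smul g.hom a x
  whiskerLeft_actionHomLeft M _ _ f X := act_hom_ext₃ fun _ _ _ => rfl
  whiskerRight_actionHomLeft N f X := act_hom_ext₃ fun _ _ _ => rfl
  associator_actionHom M N L X := by
    refine ModuleCat.hom_ext (NTensor.linear_ext fun t p => ?_)
    induction t using NTensor.induction with
    | h0 => rw [NTensor.zero_tmul, map_zero, map_zero]
    | ht t l =>
      induction t using NTensor.induction with
      | h0 => rw [NTensor.zero_tmul, NTensor.zero_tmul, map_zero, map_zero]
      | ht m n => rfl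
      | ha s t hs ht => rw [NTensor.add_tmul, NTensor.add_tmul, map_add, map_add, hs, ht]
    | ha s t hs ht => rw [NTensor.add_tmul, map_add, map_add, hs, ht]
  leftUnitor_actionHom M X := act_hom_ext₃ fun _ _ _ => rfl
  rightUnitor_actionHom M X := act_hom_ext₃ fun m a x => NTensor.smul_tmul m a x

open MonoidalLeftAction

theorem actL_add {M M' : Bim k A} (f g : M ⟶ M') (X : ModuleCat.{u} A) :
    (f + g) ⊵ₗ X = f ⊵ₗ X + g ⊵ₗ X :=
  act_hom_ext fun m x => NTensor.add_tmul (Bim.Hom.lin f m) (Bim.Hom.lin g m) x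

theorem actR_add (M : Bim k A) {X X' : ModuleCat.{u} A} (f g : X ⟶ X') :
    M ⊴ₗ (f + g) = M ⊴ₗ f + M ⊴ₗ g :=
  act_hom_ext fun m x => NTensor.tmul_add m (f.hom x) (g.hom x)

theorem actL_smul {M M' : Bim k A} (c : k) (f : M ⟶ M') (X : ModuleCat.{u} A) :
    (c • f) ⊵ₗ X = c • (f ⊵ₗ X) :=
  act_hom_ext fun _ _ => rfl

theorem actR_smul (M : Bim k A) {X X' : ModuleCat.{u} A} (c : k) (f : X ⟶ X') :
    M ⊴ₗ (c • f) = c • (M ⊴ₗ f) :=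
  act_hom_ext fun m x => by
    change NTensor.tmul A m (algebraMap k A c • f.hom x) =
      NTensor.tmul A (algebraMap k A c • m) (f.hom x)
    rw [← NTensor.smul_tmul, M.central]

end Bimodules

/-! ### Birepresentations, strong transformations, modifications -/

section Birepresentations

open MonoidalLeftAction Functor.LaxLeftLinear Functor.OplaxLeftLinear Functor.LeftLinear

variable (k : Type u) [Field k] (B : Type w') [Category.{v'} B] [MonoidalCategory B]
  [Preadditive B] [Linear k B]

/-- A `k`-linear pseudofunctor to `Cat_k` from the bicategory with a single object whose `k`-linear
category of 1-morphisms is `B`, with horizontal composition the tensor product of `B`.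
It consists of a `k`-linear category (the value at the single object), and of a `k`-linear
assignment of `k`-linear endofunctors `b ⊙ₗ -` to the objects of `B`, with coherent isomorphisms
`(b ⊗ b') ⊙ₗ X ≅ b ⊙ₗ b' ⊙ₗ X` and `𝟙 ⊙ₗ X ≅ X`. -/
structure Birep where
  carrier : Type w
  [category : Category.{v} carrier]
  [preadditive : Preadditive carrier]
  [linear : Linear k carrier]
  [action : MonoidalLeftAction B carrier]
  actL_add : ∀ {b b' : B} (f g : b ⟶ b') (X : carrier), (f + g) ⊵ₗ X = f ⊵ₗ X + g ⊵ₗ X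
  actL_smul : ∀ {b b' : B} (c : k) (f : b ⟶ b') (X : carrier), (c • f) ⊵ₗ X = c • f ⊵ₗ X
  actR_add : ∀ (b : B) {X Y : carrier} (f g : X ⟶ Y), b ⊴ₗ (f + g) = b ⊴ₗ f + b ⊴ₗ g
  actR_smul : ∀ (b : B) {X Y : carrier} (c : k) (f : X ⟶ Y), b ⊴ₗ (c • f) = c • b ⊴ₗ f

attribute [instance] Birep.category Birep.preadditive Birep.linear Birep.action

variable {k B}

/-- A strong transformation of `k`-linear pseudofunctors: a `k`-linear functor `F` with coherent
natural isomorphisms `b ⊙ₗ F X ≅ F (b ⊙ₗ X)`. -/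
structure StrongTrans (M : Birep.{u, v, w} k B) (N : Birep.{u, v'', w''} k B) where
  functor : M.carrier ⥤ N.carrier
  [additive : functor.Additive]
  [linear : functor.Linear k]
  [leftLinear : functor.LeftLinear B]

attribute [instance] StrongTrans.additive StrongTrans.linear StrongTrans.leftLinear

/-- A modification between strong transformations. -/
@[ext]
structure Modification {M : Birep.{u, v, w} k B} {N : Birep.{u, v'', w''} k B}
    (F G : StrongTrans M N) where
  nat : F.functor ⟶ G.functor
  comm : ∀ (b : B) (X : M.carrier),
    μₗ F.functor b X ≫ nat.app (b ⊙ₗ X) = b ⊴ₗ nat.app X ≫ μₗ G.functor b X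

end Birepresentations

section Transformations

open MonoidalLeftAction Functor.LaxLeftLinear Functor.OplaxLeftLinear Functor.LeftLinear

variable {k : Type u} [Field k] {B : Type w'} [Category.{v'} B] [MonoidalCategory B]
  [Preadditive B] [Linear k B]

universe v₁ w₁ v₂ w₂ v₃ w₃ v₄ w₄

/-- A functor with coherent natural isomorphisms `b ⊙ F X ≅ F (b ⊙ X)`. -/
abbrev mkLeftLinear {D : Type w₁} [Category.{v₁} D] {D' : Type w₂} [Category.{v₂} D']
    [MonoidalLeftAction B D] [MonoidalLeftAction B D'] (F : D ⥤ D')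
    (e : ∀ (b : B) (X : D), b ⊙ₗ F.obj X ≅ F.obj (b ⊙ₗ X))
    (h₁ : ∀ {b b' : B} (f : b ⟶ b') (X : D),
      f ⊵ₗ F.obj X ≫ (e b' X).hom = (e b X).hom ≫ F.map (f ⊵ₗ X))
    (h₂ : ∀ (b : B) {X Y : D} (f : X ⟶ Y),
      b ⊴ₗ F.map f ≫ (e b Y).hom = (e b X).hom ≫ F.map (b ⊴ₗ f))
    (h₃ : ∀ (b b' : B) (X : D), (e (b ⊗ b') X).hom ≫ F.map (αₗ b b' X).hom =
      (αₗ b b' (F.obj X)).hom ≫ b ⊴ₗ (e b' X).hom ≫ (e b (b' ⊙ₗ X)).hom)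
    (h₄ : ∀ X : D, (λₗ (F.obj X)).hom = (e (𝟙_ B) X).hom ≫ F.map (λₗ X).hom) :
    F.LeftLinear B where
  μₗ b X := (e b X).hom
  δₗ b X := (e b X).inv
  μₗ_naturality_left := h₁
  μₗ_naturality_right := h₂
  μₗ_associativity := h₃
  μₗ_unitality := h₄
  δₗ_naturality_left f X := by
    rw [Iso.comp_inv_eq, Category.assoc, h₁, Iso.inv_hom_id_assoc]
  δₗ_naturality_right b _ _ f := by
    rw [Iso.comp_inv_eq, Category.assoc, h₂, Iso.inv_hom_id_assoc]
  δₗ_associativity b b' X := by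
    rw [← cancel_epi (e (b ⊗ b') X).hom, Iso.hom_inv_id_assoc, ← Category.assoc, h₃]
    simp
  δₗ_unitality_inv X := by
    rw [Iso.eq_comp_inv, Iso.inv_comp_eq, h₄, Category.assoc, ← F.map_comp, Iso.hom_inv_id,
      F.map_id, Category.comp_id]
  μₗ_comp_δₗ b X := (e b X).hom_inv_id
  δₗ_comp_μₗ b X := (e b X).inv_hom_id

variable {L : Birep.{u, v₁, w₁} k B} {M : Birep.{u, v₂, w₂} k B} {N : Birep.{u, v₃, w₃} k B}
  {R : Birep.{u, v₄, w₄} k B}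

/-- Strong transformations and modifications form a category. -/
instance : Category (StrongTrans M N) where
  Hom := Modification
  id F := ⟨𝟙 _, by simp⟩
  comp α β := ⟨α.nat ≫ β.nat, fun b X => by
    rw [NatTrans.comp_app, ← Category.assoc, α.comm, Category.assoc, β.comm, ← Category.assoc,
      NatTrans.comp_app, actionHomRight_comp]⟩

@[ext]
theorem Modification.hom_ext {F G : StrongTrans M N} {α β : F ⟶ G}
    (h : ∀ X, (Modification.nat α).app X = (Modification.nat β).app X) : α = β :=
  Modification.ext (NatTrans.ext (funext h))

@[simp]
theorem Modification.id_nat (F : StrongTrans M N) : Modification.nat (𝟙 F) = 𝟙 _ := rfl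

@[simp]
theorem Modification.comp_nat {F G H : StrongTrans M N} (α : F ⟶ G) (β : G ⟶ H) :
    Modification.nat (α ≫ β) = Modification.nat α ≫ Modification.nat β := rfl

/-- An isomorphism of strong transformations from its invertible components. -/
@[simps]
def StrongTrans.mkIso {F G : StrongTrans M N} (e : F.functor ≅ G.functor)
    (h : ∀ (b : B) (X : M.carrier),
      μₗ F.functor b X ≫ e.hom.app (b ⊙ₗ X) = b ⊴ₗ e.hom.app X ≫ μₗ G.functor b X) : F ≅ G where
  hom := ⟨e.hom, h⟩
  inv := ⟨e.inv, fun b X => by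
    rw [← cancel_mono (e.hom.app (b ⊙ₗ X)), Category.assoc, Category.assoc, h,
      ← Category.assoc (b ⊴ₗ _), ← actionHomRight_comp]
    simp⟩
  hom_inv_id := by ext; simp
  inv_hom_id := by ext; simp

namespace StrongTrans

/-- Composites of functors linear over the action of `B` are again so. -/
instance compLeftLinear {D : Type w₁} [Category.{v₁} D] {D' : Type w₂} [Category.{v₂} D']
    {D'' : Type w₃} [Category.{v₃} D''] [MonoidalLeftAction B D] [MonoidalLeftAction B D']
    [MonoidalLeftAction B D''] (F : D ⥤ D') (G : D' ⥤ D'') [F.LeftLinear B] [G.LeftLinear B] :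
    (F ⋙ G).LeftLinear B :=
  mkLeftLinear (F ⋙ G)
    (fun b X => μₗIso G b (F.obj X) ≪≫ G.mapIso (μₗIso F b X))
    (fun f X => by
      simp only [Iso.trans_hom, Functor.mapIso_hom, Functor.comp_map, Category.assoc,
        ← G.map_comp, ← μₗ_naturality_left, Functor.comp_obj]
      rw [μₗ_naturality_left_assoc, G.map_comp])
    (fun b _ _ f => by
      simp only [Iso.trans_hom, Functor.mapIso_hom, Functor.comp_map, Category.assoc,
        ← G.map_comp, ← μₗ_naturality_right, Functor.comp_obj]
      rw [μₗ_naturality_right_assoc, G.map_comp])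
    (fun b b' X => by
      simp only [Iso.trans_hom, Functor.mapIso_hom, Functor.comp_map, Category.assoc,
        ← G.map_comp, μₗ_associativity, Functor.comp_obj]
      simp only [Functor.map_comp, μₗ_associativity_assoc, actionHomRight_comp, Category.assoc,
        μₗ_naturality_right_assoc])
    (fun X => by
      simp only [Iso.trans_hom, Functor.mapIso_hom, Functor.comp_map, Category.assoc,
        ← G.map_comp, Functor.comp_obj]
      rw [← μₗ_unitality, ← μₗ_unitality])

theorem comp_mu {D : Type w₁} [Category.{v₁} D] {D' : Type w₂} [Category.{v₂} D']
    {D'' : Type w₃} [Category.{v₃} D''] [MonoidalLeftAction B D] [MonoidalLeftAction B D']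
    [MonoidalLeftAction B D''] (F : D ⥤ D') (G : D' ⥤ D'') [F.LeftLinear B] [G.LeftLinear B]
    (b : B) (X : D) : μₗ (F ⋙ G) b X = μₗ G b (F.obj X) ≫ G.map (μₗ F b X) := rfl

/-- The structural isomorphisms of a strong transformation. -/
def mu (F : StrongTrans M N) (b : B) (X : M.carrier) :
    b ⊙ₗ F.functor.obj X ⟶ F.functor.obj (b ⊙ₗ X) :=
  μₗ F.functor b X

/-- Composition of strong transformations. -/
abbrev comp (F : StrongTrans L M) (G : StrongTrans M N) : StrongTrans L N where
  functor := F.functor ⋙ G.functor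

/-- The horizontal composite of a strong transformation followed by a modification. -/
def whiskerLeft (F : StrongTrans L M) {G G' : StrongTrans M N} (α : G ⟶ G') :
    comp F G ⟶ comp F G' where
  nat := Functor.whiskerLeft F.functor (Modification.nat α)
  comm b X := by
    rw [comp_mu, comp_mu, Category.assoc]
    erw [(Modification.nat α).naturality, ← Category.assoc, Modification.comm α]
    simp

/-- The horizontal composite of a modification followed by a strong transformation. -/
def whiskerRight {F F' : StrongTrans L M} (α : F ⟶ F') (G : StrongTrans M N) :
    comp F G ⟶ comp F' G where
  nat := Functor.whiskerRight (Modification.nat α) G.functor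
  comm b X := by
    rw [comp_mu, comp_mu, Category.assoc]
    change _ ≫ G.functor.map _ ≫ G.functor.map _ = b ⊴ₗ G.functor.map _ ≫ _
    rw [← G.functor.map_comp, Modification.comm α, μₗ_naturality_right_assoc, G.functor.map_comp]

/-- Composition of strong transformations is associative. -/
def assoc (F : StrongTrans L M) (G : StrongTrans M N) (H : StrongTrans N R) :
    comp (comp F G) H ≅ comp F (comp G H) :=
  mkIso (Functor.associator F.functor G.functor H.functor) (fun b X => by
    rw [comp_mu, comp_mu, comp_mu, comp_mu]
    simp)

@[simp]
theorem whiskerLeft_app (F : StrongTrans L M) {G G' : StrongTrans M N} (α : G ⟶ G')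
    (X : L.carrier) : (Modification.nat (whiskerLeft F α)).app X =
      (Modification.nat α).app (F.functor.obj X) := rfl

@[simp]
theorem whiskerRight_app {F F' : StrongTrans L M} (α : F ⟶ F') (G : StrongTrans M N)
    (X : L.carrier) : (Modification.nat (whiskerRight α G)).app X =
      G.functor.map ((Modification.nat α).app X) := rfl

@[simp]
theorem assoc_hom_app (F : StrongTrans L M) (G : StrongTrans M N) (H : StrongTrans N R)
    (X : L.carrier) : (Modification.nat (assoc F G H).hom).app X = 𝟙 _ := rfl

@[simp]
theorem assoc_inv_app (F : StrongTrans L M) (G : StrongTrans M N) (H : StrongTrans N R)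
    (X : L.carrier) : (Modification.nat (assoc F G H).inv).app X = 𝟙 _ := rfl

/-- The components of modifications at a given object. -/
def modEval (X : M.carrier) : StrongTrans M N ⥤ N.carrier where
  obj F := F.functor.obj X
  map α := (Modification.nat α).app X

/-- Whiskering an invertible modification by a strong transformation. -/
@[simps]
def whiskerRightIso {F F' : StrongTrans L M} (α : F ≅ F') (G : StrongTrans M N) :
    comp F G ≅ comp F' G where
  hom := whiskerRight α.hom G
  inv := whiskerRight α.inv G
  hom_inv_id := by
    ext X
    exact (G.functor.mapIso ((modEval X).mapIso α)).hom_inv_id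
  inv_hom_id := by
    ext X
    exact (G.functor.mapIso ((modEval X).mapIso α)).inv_hom_id

end StrongTrans

/-! ### Coisoinserters and coequifiers -/

/-- Given strong transformations `F i, G i : L ⟶ M`, a strong transformation `Υ : M ⟶ N` with
invertible modifications `Υ ∘ F i ≅ Υ ∘ G i`. -/
structure IsoCone {ι : Type} (F G : ι → StrongTrans L M) (N : Birep.{u, v₃, w₃} k B) where
  trans : StrongTrans M N
  iso : ∀ i, StrongTrans.comp (F i) trans ≅ StrongTrans.comp (G i) trans

/-- Modifications compatible with the invertible modifications of two cones. -/
@[ext]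
structure IsoCone.Hom {ι : Type} {F G : ι → StrongTrans L M} (S T : IsoCone F G N) where
  mod : S.trans ⟶ T.trans
  comm : ∀ i, (S.iso i).hom ≫ StrongTrans.whiskerLeft (G i) mod =
    StrongTrans.whiskerLeft (F i) mod ≫ (T.iso i).hom

section

variable {ι : Type} {F G : ι → StrongTrans L M}

theorem StrongTrans.whiskerLeft_comp (F : StrongTrans L M) {G G' G'' : StrongTrans M N}
    (α : G ⟶ G') (β : G' ⟶ G'') : StrongTrans.whiskerLeft F (α ≫ β) =
      StrongTrans.whiskerLeft F α ≫ StrongTrans.whiskerLeft F β := by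
  ext; simp

theorem StrongTrans.whiskerLeft_id (F : StrongTrans L M) (G : StrongTrans M N) :
    StrongTrans.whiskerLeft F (𝟙 G) = 𝟙 _ := by
  ext; simp

instance : Category (IsoCone F G N) where
  Hom := IsoCone.Hom
  id S := ⟨𝟙 _, fun i => by simp [StrongTrans.whiskerLeft_id]⟩
  comp f g := ⟨f.mod ≫ g.mod, fun i => by
    simp only [StrongTrans.whiskerLeft_comp]
    rw [← Category.assoc, f.comm, Category.assoc, g.comm, Category.assoc]⟩

/-- The cone obtained by composing a cone with a strong transformation. -/
@[simps trans]
def IsoCone.postcomp (S : IsoCone F G N) (H : StrongTrans N R) : IsoCone F G R where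
  trans := StrongTrans.comp S.trans H
  iso i := (StrongTrans.assoc _ _ _).symm ≪≫ StrongTrans.whiskerRightIso (S.iso i) H ≪≫
    StrongTrans.assoc _ _ _

/-- Composition of a fixed cone with strong transformations, as a functor. -/
def IsoCone.postcompFunctor (S : IsoCone F G N) (R : Birep.{u, v₄, w₄} k B) :
    StrongTrans N R ⥤ IsoCone F G R where
  obj H := S.postcomp H
  map {H H'} α := IsoCone.Hom.mk (S := S.postcomp H) (T := S.postcomp H')
    (StrongTrans.whiskerLeft S.trans α) (fun i => by
      ext X
      simp [IsoCone.postcomp])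
  map_id H := IsoCone.Hom.ext (StrongTrans.whiskerLeft_id _ _)
  map_comp α β := IsoCone.Hom.ext (StrongTrans.whiskerLeft_comp _ _ _)

/-- The cone `S` exhibits `N` as the (multiple) coisoinserter of the pairs `F i, G i`: composition
with `S` is an equivalence from the category of strong transformations `N ⟶ R` to the category of
cones with values in `R`, for all `R`. -/
def IsCoisoinserter (S : IsoCone F G N) : Prop :=
  ∀ R : Birep.{u, v₃, w₃} k B, (S.postcompFunctor R).IsEquivalence

end

section

variable {ι : Type} {F G : ι → StrongTrans L M} (α β : ∀ i, F i ⟶ G i)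

/-- The strong transformations `Υ` such that the modifications `Υ • α i` and `Υ • β i` are equal
for all `i`. -/
def equifies (N : Birep.{u, v₃, w₃} k B) : ObjectProperty (StrongTrans M N) := fun Υ =>
  ∀ i, StrongTrans.whiskerRight (α i) Υ = StrongTrans.whiskerRight (β i) Υ

theorem equifies_comp {Υ : StrongTrans M N} (h : equifies α β N Υ) (H : StrongTrans N R) :
    equifies α β R (StrongTrans.comp Υ H) := fun i => by
  ext X
  have := congrArg (fun γ => (Modification.nat γ).app X) (h i)
  exact congrArg H.functor.map this

/-- Composition of a fixed strong transformation which equifies `α i` and `β i` with strong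
transformations, as a functor. -/
def equifiesFunctor {Υ : StrongTrans M N} (h : equifies α β N Υ) (R : Birep.{u, v₄, w₄} k B) :
    StrongTrans N R ⥤ (equifies α β R).FullSubcategory where
  obj H := ⟨StrongTrans.comp Υ H, equifies_comp α β h H⟩
  map γ := ObjectProperty.homMk (StrongTrans.whiskerLeft Υ γ)
  map_id H := by
    ext1
    exact StrongTrans.whiskerLeft_id _ _
  map_comp γ δ := by
    ext1
    exact StrongTrans.whiskerLeft_comp _ _ _

/-- The strong transformation `Υ : M ⟶ N` exhibits `N` as the (multiple) coequifier of the pairs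
`α i, β i`: it equifies them, and composition with `Υ` is an equivalence from the category of
strong transformations `N ⟶ R` to the category of strong transformations `M ⟶ R` equifying
all pairs, for all `R`. -/
def IsCoequifier (Υ : StrongTrans M N) : Prop :=
  ∃ h : equifies α β N Υ, ∀ R : Birep.{u, v₃, w₃} k B, (equifiesFunctor α β h R).IsEquivalence

end

end Transformations

/-! ### Additive closures and restriction of actions to full subcategories -/

section AddClosure

universe v₁ w₁ v₂ w₂

variable {D : Type w₁} [Category.{v₁} D] [Preadditive D] {D' : Type w₂} [Category.{v₂} D']
  [Preadditive D']

/-- The objects of `add S`: the retracts of finite direct sums of objects in `S`. -/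
def inAdd (S : ObjectProperty D) : ObjectProperty D := fun X =>
  ∃ (ι : Type) (_ : Fintype ι) (Y : ι → D) (p : ∀ i, X ⟶ Y i) (q : ∀ i, Y i ⟶ X),
    (∀ i, S (Y i)) ∧ ∑ i, p i ≫ q i = 𝟙 X

theorem inAdd_of {S : ObjectProperty D} {X : D} (h : S X) : inAdd S X :=
  ⟨Unit, inferInstance, fun _ => X, fun _ => 𝟙 X, fun _ => 𝟙 X, fun _ => h, by simp⟩

theorem inAdd_map (F : D ⥤ D') [F.Additive] {S : ObjectProperty D} {T : ObjectProperty D'}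
    (h : ∀ Y, S Y → inAdd T (F.obj Y)) {X : D} (hX : inAdd S X) : inAdd T (F.obj X) := by
  obtain ⟨ι, _, Y, p, q, hY, e⟩ := hX
  choose κ hκ Z p' q' hZ e' using fun i => h (Y i) (hY i)
  refine ⟨Σ i, κ i, inferInstance, fun x => Z x.1 x.2, fun x => F.map (p x.1) ≫ p' x.1 x.2,
    fun x => q' x.1 x.2 ≫ F.map (q x.1), fun x => hZ x.1 x.2, ?_⟩
  rw [Fintype.sum_sigma, ← F.map_id, ← e, F.map_sum]
  refine Finset.sum_congr rfl fun i _ => ?_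
  have : F.map (p i) ≫ (∑ j, p' i j ≫ q' i j) ≫ F.map (q i) = F.map (p i ≫ q i) := by
    rw [e', Category.id_comp, F.map_comp]
  simpa [Preadditive.comp_sum, Preadditive.sum_comp] using this

theorem inAdd_trans {S T : ObjectProperty D} (h : ∀ Y, S Y → inAdd T Y) {X : D}
    (hX : inAdd S X) : inAdd T X :=
  inAdd_map (𝟭 D) h hX

theorem inAdd_of_iso {S : ObjectProperty D} {X Y : D} (e : X ≅ Y) (hX : inAdd S X) :
    inAdd S Y := by
  obtain ⟨ι, _, Z, p, q, hZ, h⟩ := hX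
  refine ⟨ι, inferInstance, Z, fun i => e.inv ≫ p i, fun i => q i ≫ e.hom, hZ, ?_⟩
  have : e.inv ≫ (∑ i, p i ≫ q i) ≫ e.hom = 𝟙 Y := by simp [h]
  simpa [Preadditive.comp_sum, Preadditive.sum_comp] using this

end AddClosure

section Restriction

open MonoidalLeftAction

universe v₁ w₁ v₂ w₂

variable {B : Type w₁} [Category.{v₁} B] [MonoidalCategory B]
  {D : Type w₂} [Category.{v₂} D] [MonoidalLeftAction B D]

/-- The objects in `Q` are stable under the action of the objects in `P`. -/
class StableUnder (P : ObjectProperty B) (Q : ObjectProperty D) : Prop where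
  prop_act : ∀ {b : B} {X : D}, P b → Q X → Q (b ⊙ₗ X)

variable (P : ObjectProperty B) [P.IsMonoidal] (Q : ObjectProperty D) [StableUnder P Q]

instance : MonoidalLeftActionStruct P.FullSubcategory Q.FullSubcategory where
  actionObj b X := ⟨b.1 ⊙ₗ X.1, StableUnder.prop_act b.2 X.2⟩
  actionHomLeft f X := ObjectProperty.homMk (f.hom ⊵ₗ X.1)
  actionHomRight b _ _ g := ObjectProperty.homMk (b.1 ⊴ₗ g.hom)
  actionHom f g := ObjectProperty.homMk (f.hom ⊙ₗₘ g.hom)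
  actionAssocIso b b' X := Q.isoMk (αₗ b.1 b'.1 X.1)
  actionUnitIso X := Q.isoMk (λₗ X.1)

/-- The restriction of an action to full subcategories. -/
instance restrictAction : MonoidalLeftAction P.FullSubcategory Q.FullSubcategory where
  actionHom_def f g := ObjectProperty.hom_ext _ (actionHom_def f.hom g.hom)
  actionHomRight_id b X := ObjectProperty.hom_ext _ (actionHomRight_id b.1 X.1)
  id_actionHomLeft b X := ObjectProperty.hom_ext _ (id_actionHomLeft b.1 X.1)
  actionHom_comp f f' g g' :=
    ObjectProperty.hom_ext _ (actionHom_comp f.hom f'.hom g.hom g'.hom)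
  actionAssocIso_hom_naturality f g h :=
    ObjectProperty.hom_ext _ (actionAssocIso_hom_naturality f.hom g.hom h.hom)
  actionUnitIso_hom_naturality g :=
    ObjectProperty.hom_ext _ (actionUnitIso_hom_naturality g.hom)
  whiskerLeft_actionHomLeft b _ _ f X :=
    ObjectProperty.hom_ext _ (whiskerLeft_actionHomLeft b.1 f.hom X.1)
  whiskerRight_actionHomLeft b f X :=
    ObjectProperty.hom_ext _ (whiskerRight_actionHomLeft b.1 f.hom X.1)
  associator_actionHom b c d X :=
    ObjectProperty.hom_ext _ (associator_actionHom b.1 c.1 d.1 X.1)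
  leftUnitor_actionHom b X := ObjectProperty.hom_ext _ (leftUnitor_actionHom b.1 X.1)
  rightUnitor_actionHom b X := ObjectProperty.hom_ext _ (rightUnitor_actionHom b.1 X.1)

end Restriction

section RestrictedBirep

open MonoidalLeftAction

universe v₁ w₁ v₂ w₂

variable (k : Type u) [Field k] (B : Type w₁) [Category.{v₁} B] [MonoidalCategory B]
  [Preadditive B] [Linear k B] (D : Type w₂) [Category.{v₂} D] [Preadditive D] [Linear k D]
  [MonoidalLeftAction B D]

/-- The action functor `B × D ⥤ D` is `k`-linear in both variables. -/
class BilinearAction : Prop where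
  actL_add : ∀ {b b' : B} (f g : b ⟶ b') (X : D), (f + g) ⊵ₗ X = f ⊵ₗ X + g ⊵ₗ X
  actL_smul : ∀ {b b' : B} (c : k) (f : b ⟶ b') (X : D), (c • f) ⊵ₗ X = c • f ⊵ₗ X
  actR_add : ∀ (b : B) {X Y : D} (f g : X ⟶ Y), b ⊴ₗ (f + g) = b ⊴ₗ f + b ⊴ₗ g
  actR_smul : ∀ (b : B) {X Y : D} (c : k) (f : X ⟶ Y), b ⊴ₗ (c • f) = c • b ⊴ₗ f

variable {B D}
variable [BilinearAction k B D] (P : ObjectProperty B) [P.IsMonoidal] (Q : ObjectProperty D)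
  [StableUnder P Q]

/-- The birepresentation on a full subcategory, obtained by restricting a bilinear action. -/
abbrev restrictBirep : Birep.{u, v₂, w₂} k P.FullSubcategory where
  carrier := Q.FullSubcategory
  actL_add f g X := ObjectProperty.hom_ext _ (BilinearAction.actL_add k f.hom g.hom X.1)
  actL_smul c f X := ObjectProperty.hom_ext _ (BilinearAction.actL_smul c f.hom X.1)
  actR_add b _ _ f g := ObjectProperty.hom_ext _ (BilinearAction.actR_add k b.1 f.hom g.hom)
  actR_smul b _ _ c f := ObjectProperty.hom_ext _ (BilinearAction.actR_smul b.1 c f.hom)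

/-- The action of a monoidal category on itself, as a birepresentation. -/
abbrev regularBirep {E : Type w₁} [Category.{v₁} E] [MonoidalCategory E] [Preadditive E]
    [Linear k E] [MonoidalPreadditive E] [MonoidalLinear k E] : Birep.{u, v₁, w₁} k E where
  carrier := E
  action := selfLeftAction E
  actL_add f g _ := MonoidalPreadditive.add_whiskerRight f g
  actL_smul c f X := MonoidalLinear.smul_whiskerRight c f X
  actR_add _ _ _ f g := MonoidalPreadditive.whiskerLeft_add f g
  actR_smul b _ _ c f := MonoidalLinear.whiskerLeft_smul b c f

/-- The strong transformation `b ↦ b ⊙ X` from the principal birepresentation of `E` given by an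
object `X` of a birepresentation of `E`. -/
def evalTrans {E : Type w₁} [Category.{v₁} E] [MonoidalCategory E] [Preadditive E]
    [Linear k E] [MonoidalPreadditive E] [MonoidalLinear k E] (M : Birep.{u, v₂, w₂} k E)
    (X : M.carrier) : StrongTrans (regularBirep k (E := E)) M where
  functor :=
    { obj := fun b => b ⊙ₗ X
      map := fun f => f ⊵ₗ X }
  additive := ⟨fun {_ _ f g} => M.actL_add f g X⟩
  linear := ⟨fun f c => M.actL_smul c f X⟩
  leftLinear := mkLeftLinear (D := E) _ (fun b c => (αₗ b c X).symm)
    (fun f c => by simp) (fun b _ _ f => by simp) (fun b b' c => by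
      simp only [Iso.symm_hom]
      change (αₗ (b ⊗ b') c X).inv ≫ (α_ b b' c).hom ⊵ₗ X = (αₗ b b' (c ⊙ₗ X)).hom ≫
        b ⊴ₗ (αₗ b' c X).inv ≫ (αₗ b (b' ⊗ c) X).inv
      rw [Iso.inv_comp_eq, ← associator_actionHom_assoc]
      simp)
    (fun c => by simp)

end RestrictedBirep

section Inclusion

open MonoidalLeftAction

universe v₁ w₁

variable {k : Type u} [Field k] {B : Type w₁} [Category.{v₁} B] [MonoidalCategory B]
  [Preadditive B] [Linear k B] [MonoidalPreadditive B] [MonoidalLinear k B]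

/-- The tensor product is a bilinear action. -/
instance : BilinearAction k B B where
  actL_add f g _ := MonoidalPreadditive.add_whiskerRight f g
  actL_smul c f X := MonoidalLinear.smul_whiskerRight c f X
  actR_add _ _ _ f g := MonoidalPreadditive.whiskerLeft_add f g
  actR_smul b _ _ c f := MonoidalLinear.whiskerLeft_smul b c f

variable {P : ObjectProperty B} [P.IsMonoidal] {Q : ObjectProperty B} [StableUnder P Q]

/-- The inclusion of a birepresentation on a full subcategory of the principal birepresentation. -/
def inclTrans (h : Q ≤ P) :
    StrongTrans (restrictBirep k P Q) (regularBirep k (E := P.FullSubcategory)) where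
  functor := ObjectProperty.ιOfLE h
  additive := ⟨rfl⟩
  linear := ⟨fun _ _ => rfl⟩
  leftLinear := mkLeftLinear (D := Q.FullSubcategory) (D' := P.FullSubcategory)
    (ObjectProperty.ιOfLE h) (fun b X => Iso.refl _)
    (fun f X => by simp; rfl) (fun b _ _ f => by simp; rfl) (fun b b' X => by simp; rfl)
    (fun X => by simp; rfl)

end Inclusion

/-! ### The bimodules `U ⊗_k V` and the bicategory they generate -/

section Outer

open MonoidalLeftAction

variable {k : Type u} [Field k] {A : Type u} [Ring A] [Algebra k A]

instance : MonoidalPreadditive (Bim k A) where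
  whiskerLeft_zero := by intros; exact Bim.tensor_hom_ext fun m n => NTensor.tmul_zero m
  zero_whiskerRight := by intros; exact Bim.tensor_hom_ext fun m n => NTensor.zero_tmul n
  whiskerLeft_add f g := Bim.whiskerLeft_add' _ f g
  add_whiskerRight f g := Bim.add_whiskerRight' _ f g

instance : MonoidalLinear k (Bim k A) where
  whiskerLeft_smul M _ _ c f := Bim.whiskerLeft_smul' M c f
  smul_whiskerRight c _ _ f M := Bim.smul_whiskerRight' M c f

instance : BilinearAction k (Bim k A) (ModuleCat.{u} A) where
  actL_add := actL_add
  actL_smul := actL_smul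
  actR_add := actR_add
  actR_smul := actR_smul

variable (U V U' V' : Type u) [AddCommGroup U] [Module A U] [Module k U] [IsScalarTower k A U]
  [AddCommGroup V] [Module Aᵐᵒᵖ V] [Module k V] [IsScalarTower k Aᵐᵒᵖ V]
  [AddCommGroup U'] [Module A U'] [Module k U'] [IsScalarTower k A U']
  [AddCommGroup V'] [Module Aᵐᵒᵖ V'] [Module k V'] [IsScalarTower k Aᵐᵒᵖ V']

/-- The right action on `U ⊗_k V`. -/
abbrev outerRight : Module Aᵐᵒᵖ (U ⊗[k] V) :=
  Module.compHom (U ⊗[k] V) ((Module.End.lTensorAlgHom k V U).comp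
    (Algebra.lsmul k k V : Aᵐᵒᵖ →ₐ[k] Module.End k V)).toRingHom

variable (k A) in
/-- The bimodule `U ⊗_k V`, for a left module `U` and a right module `V`. -/
def outer : Bim k A where
  carrier := U ⊗[k] V
  right := outerRight U V
  comm := by
    let _ : Module Aᵐᵒᵖ (U ⊗[k] V) := outerRight U V
    refine ⟨fun a b t => ?_⟩
    induction t using TensorProduct.induction_on with
    | zero => simp
    | tmul u v => rfl
    | add s t hs ht => rw [smul_add, smul_add, smul_add, smul_add, hs, ht]
  central c t := by
    let _ : Module Aᵐᵒᵖ (U ⊗[k] V) := outerRight U V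
    induction t using TensorProduct.induction_on with
    | zero => simp
    | tmul u v =>
      change u ⊗ₜ[k] ((algebraMap k Aᵐᵒᵖ c) • v) = (algebraMap k A c • u) ⊗ₜ[k] v
      rw [algebraMap_smul, algebraMap_smul, TensorProduct.smul_tmul]
    | add s t hs ht => rw [smul_add, smul_add, hs, ht]

variable {U V U' V'}

variable (k A) in
/-- The element `u ⊗ v` of `U ⊗_k V`. -/
def pureTensor (u : U) (v : V) : (outer k A U V).carrier := u ⊗ₜ[k] v

theorem op_smul_pure (a : Aᵐᵒᵖ) (u : U) (v : V) : a • pureTensor k A u v = pureTensor k A u (a • v) := rfl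

theorem smul_pure (a : A) (u : U) (v : V) : a • pureTensor k A u v = pureTensor k A (a • u) v := rfl

theorem add_pure (u u' : U) (v : V) : pureTensor k A (u + u') v = pureTensor k A u v + pureTensor k A u' v :=
  TensorProduct.add_tmul u u' v

theorem pure_add (u : U) (v v' : V) : pureTensor k A u (v + v') = pureTensor k A u v + pureTensor k A u v' :=
  TensorProduct.tmul_add u v v'

theorem pure_smul (c : k) (u : U) (v : V) : pureTensor k A (c • u) v = pureTensor k A u (c • v) :=
  TensorProduct.smul_tmul c u v

theorem pure_sum {ι : Type*} (s : Finset ι) (u : U) (v : ι → V) :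
    pureTensor k A u (∑ i ∈ s, v i) = ∑ i ∈ s, pureTensor k A u (v i) :=
  TensorProduct.tmul_sum u s v

theorem outer_induction {p : (outer k A U V).carrier → Prop} (t : (outer k A U V).carrier)
    (h0 : p 0) (ht : ∀ u v, p (pureTensor k A u v)) (ha : ∀ s t, p s → p t → p (s + t)) : p t :=
  TensorProduct.induction_on t h0 ht ha

/-- For a `k`-bilinear form `β` on `V × U'`, the map
`(u ⊗ v) ⊗ (u' ⊗ v') ↦ β (v, u') u ⊗ v'`. -/
def contractAux (β : V →ₗ[k] U' →ₗ[k] k) : U ⊗[k] V →ₗ[k] U' ⊗[k] V' →ₗ[k] U ⊗[k] V' :=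
  TensorProduct.lift (LinearMap.mk₂ k
    (fun u v => TensorProduct.map ((β v).smulRight u) LinearMap.id)
    (fun _ _ _ => by ext; simp [TensorProduct.add_tmul])
    (fun _ _ _ => by ext; simp [TensorProduct.smul_tmul']; rw [smul_comm])
    (fun _ _ _ => by ext; simp [TensorProduct.add_tmul, add_smul])
    (fun _ _ _ => by ext; simp [TensorProduct.smul_tmul', mul_smul]))

/-- The biadditive map underlying `contractAux`. -/
def contractAdd (β : V →ₗ[k] U' →ₗ[k] k) : U ⊗[k] V →+ U' ⊗[k] V' →+ U ⊗[k] V' :=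
  LinearMap.toAddMonoidHom'.comp (contractAux β).toAddMonoidHom

/-- The biadditive map underlying `contractAux`, on the bimodules. -/
def contractHom (β : V →ₗ[k] U' →ₗ[k] k) :
    (outer k A U V).carrier →+ (outer k A U' V').carrier →+ (outer k A U V').carrier :=
  contractAdd β

theorem contractHom_pure (β : V →ₗ[k] U' →ₗ[k] k) (u : U) (v : V) (u' : U') (v' : V') :
    contractHom β (pureTensor k A u v) (pureTensor k A u' v') = pureTensor k A (β v u' • u) v' := rfl

theorem contractHom_balanced (β : V →ₗ[k] U' →ₗ[k] k)
    (hβ : ∀ (a : A) v u', β (op a • v) u' = β v (a • u')) (m : (outer k A U V).carrier) (a : A)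
    (x : (outer k A U' V').carrier) : contractHom β (op a • m) x = contractHom β m (a • x) := by
  induction m using outer_induction with
  | h0 => simp
  | ha s t hs ht => simp_all
  | ht u v =>
    induction x using outer_induction with
    | h0 => simp
    | ha s t hs ht => simp_all
    | ht u' v' =>
      rw [op_smul_pure, smul_pure, contractHom_pure, contractHom_pure, hβ]

theorem contractHom_smul (β : V →ₗ[k] U' →ₗ[k] k) (a : A) (m : (outer k A U V).carrier)
    (x : (outer k A U' V').carrier) : contractHom β (a • m) x = a • contractHom β m x := by
  induction m using outer_induction with
  | h0 => simp
  | ha s t hs ht => simp_all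
  | ht u v =>
    induction x using outer_induction with
    | h0 => simp
    | ha s t hs ht => simp_all
    | ht u' v' =>
      rw [smul_pure, contractHom_pure, contractHom_pure, smul_pure, smul_algebra_smul_comm]

theorem contractHom_op_smul (β : V →ₗ[k] U' →ₗ[k] k) (a : Aᵐᵒᵖ) (m : (outer k A U V).carrier)
    (x : (outer k A U' V').carrier) : contractHom β m (a • x) = a • contractHom β m x := by
  induction m using outer_induction with
  | h0 => simp
  | ha s t hs ht => simp_all
  | ht u v =>
    induction x using outer_induction with
    | h0 => simp
    | ha s t hs ht => simp_all
    | ht u' v' =>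
      rw [op_smul_pure, contractHom_pure, contractHom_pure, op_smul_pure]

/-- For a balanced `k`-bilinear form `β` on `V × U'`, the bimodule homomorphism
`(u ⊗ v) ⊗ (u' ⊗ v') ↦ β (v, u') u ⊗ v'`. -/
def contract (β : V →ₗ[k] U' →ₗ[k] k) (hβ : ∀ (a : A) v u', β (op a • v) u' = β v (a • u')) :
    Bim.tensor (outer k A U V) (outer k A U' V') ⟶ outer k A U V' where
  lin := NTensor.linearMk (NTensor.lift (contractHom β) (contractHom_balanced β hβ))
    (fun a m x => contractHom_smul β a m x)
  map_op a t := by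
    induction t using NTensor.induction with
    | h0 => rw [smul_zero, map_zero, smul_zero]
    | ha s t hs ht => rw [smul_add, map_add, map_add, smul_add, hs, ht]
    | ht m x => exact contractHom_op_smul β a m x

/-- For `w ∈ V` and `z ∈ U'`, the biadditive map `(u, v') ↦ (u ⊗ w) ⊗ (z ⊗ v')`. -/
def expandAux (w : V) (z : U') :
    U →+ V' →+ NTensor A (outer k A U V).carrier (outer k A U' V').carrier :=
  AddMonoidHom.mk' (fun u => AddMonoidHom.mk'
    (fun v' => NTensor.tmul A (pureTensor k A u w) (pureTensor k A z v'))
    (fun x y => by rw [pure_add, NTensor.tmul_add]))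
    (fun x y => by
      ext v'
      simp only [AddMonoidHom.mk'_apply, AddMonoidHom.add_apply]
      rw [add_pure, NTensor.add_tmul])

theorem expandAux_smul (w : V) (z : U') (c : k) (u : U) (v' : V') :
    expandAux (k := k) (A := A) (V' := V') w z (c • u) v' = expandAux (k := k) w z u (c • v') := by
  have h₁ : pureTensor k A (c • u) w = op (algebraMap k A c) • pureTensor k A u w := by
    rw [op_smul_pure, pure_smul, ← MulOpposite.algebraMap_apply, algebraMap_smul]
  have h₂ : pureTensor k A z (c • v') = algebraMap k A c • pureTensor k A z v' := by
    rw [smul_pure, ← pure_smul, algebraMap_smul]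
  change NTensor.tmul A (pureTensor k A (c • u) w) (pureTensor k A z v') =
    NTensor.tmul A (pureTensor k A u w) (pureTensor k A z (c • v'))
  rw [h₁, h₂, NTensor.smul_tmul]

variable (k A) in
/-- Biadditive maps which are balanced over `k` extend to `U ⊗_k V`. -/
def outerLift {P : Type*} [AddCommGroup P] (f : U →+ V →+ P)
    (h : ∀ (c : k) u v, f (c • u) v = f u (c • v)) : (outer k A U V).carrier →+ P :=
  TensorProduct.liftAddHom f h

theorem outerLift_pure {P : Type*} [AddCommGroup P] (f : U →+ V →+ P)
    (h : ∀ (c : k) u v, f (c • u) v = f u (c • v)) (u : U) (v : V) :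
    outerLift k A f h (pureTensor k A u v) = f u v := rfl

/-- For `w ∈ V` and `z ∈ U'`, the bimodule homomorphism `u ⊗ v' ↦ (u ⊗ w) ⊗ (z ⊗ v')`. -/
def expand (w : V) (z : U') :
    outer k A U V' ⟶ Bim.tensor (outer k A U V) (outer k A U' V') where
  lin :=
    { outerLift k A (expandAux w z) (expandAux_smul w z) with
      map_smul' := fun a t => by
        induction t using outer_induction with
        | h0 => simp
        | ha s t hs ht => simp_all
        | ht u v => rfl }
  map_op a t := by
    induction t using outer_induction with
    | h0 => simp
    | ha s t hs ht => simp_all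
    | ht u v => rfl

theorem Bim.sum_lin {M N : Bim k A} {ι : Type} (s : Finset ι) (g : ι → (M ⟶ N)) (t : M.carrier) :
    Bim.Hom.lin (∑ i ∈ s, g i : M ⟶ N) t = ∑ i ∈ s, Bim.Hom.lin (g i) t :=
  map_sum (AddMonoidHom.mk' (fun f : M ⟶ N => Bim.Hom.lin f t) (fun _ _ => rfl)) g s

theorem outer_tensor_outer {ι : Type} [Fintype ι] (w : ι → V) (z : U')
    (β : ι → V →ₗ[k] U' →ₗ[k] k) (hβ : ∀ i (a : A) v u', β i (op a • v) u' = β i v (a • u'))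
    (h : ∀ v u', ∃ a : A, u' = a • z ∧ op a • v = ∑ i, β i v u' • w i) :
    ∑ i, contract (V' := V') (β i) (hβ i) ≫ expand (U := U) (w i) z =
      𝟙 (outer k A U V ⊗ outer k A U' V') := by
  refine Bim.tensor_hom_ext fun m x => ?_
  rw [Bim.sum_lin]
  change ∑ i, Bim.Hom.lin (expand (w i) z) (contractHom (β i) m x) = NTensor.tmul A m x
  induction m using outer_induction with
  | h0 => simp
  | ha s t hs ht => simp [hs, ht, Finset.sum_add_distrib, NTensor.add_tmul]
  | ht u v =>
    induction x using outer_induction with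
    | h0 => simp
    | ha s t hs ht => simp [hs, ht, Finset.sum_add_distrib, NTensor.tmul_add]
    | ht u' v' =>
      obtain ⟨a, ha, hw⟩ := h v u'
      have : ∀ i, Bim.Hom.lin (expand (w i) z) (contractHom (β i) (pureTensor k A u v)
          (pureTensor k A u' v')) = NTensor.tmul A (pureTensor k A u (β i v u' • w i)) (pureTensor k A z v') := by
        intro i
        rw [contractHom_pure, ← pure_smul]
        rfl
      simp only [this]
      rw [ha, ← smul_pure, ← NTensor.smul_tmul, op_smul_pure, hw, pure_sum, ← NTensor.mk_apply,
        map_sum, AddMonoidHom.finsetSum_apply]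
      simp only [ha, NTensor.mk_apply]

end Outer

/-! ### The bimodules `A e ⊗_k f A` -/

section Idempotents

open MonoidalLeftAction

variable (k : Type u) [Field k] {A : Type u} [Ring A] [Algebra k A]

/-- The left module `A e`, for an idempotent `e`. -/
def leftIdeal (e : A) : Submodule A A where
  carrier := {x | x * e = x}
  add_mem' hx hy := by simp_all [add_mul]
  zero_mem' := by simp
  smul_mem' a x hx := by simp_all [mul_assoc]

/-- The right module `f A`, for an idempotent `f`. -/
def rightIdeal (f : A) : Submodule Aᵐᵒᵖ A where
  carrier := {x | f * x = x}
  add_mem' hx hy := by simp_all [mul_add]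
  zero_mem' := by simp
  smul_mem' a x hx := by simp_all [← mul_assoc]

/-- The bimodule `A e ⊗_k f A`, for idempotents `e` and `f`. -/
abbrev projBim (e f : A) : Bim k A := outer k A (leftIdeal e) (rightIdeal f)

/-- The form `(v, u) ↦ φ (v u)` on `f A × A e`. -/
def mulForm (e f : A) (φ : A →ₗ[k] k) : rightIdeal f →ₗ[k] leftIdeal e →ₗ[k] k :=
  LinearMap.mk₂ k (fun v u => φ (v.1 * u.1))
    (by intros; simp [add_mul]) (by intros; simp) (by intros; simp [mul_add]) (by intros; simp)

variable {k}

theorem sum_mulForm [Module.Finite k A] {e f : A} (v : rightIdeal f) (u : leftIdeal e)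
    (w : Fin (Module.finrank k A) → rightIdeal f)
    (hw : ∀ i, (w i).1 = f * Module.finBasis k A i) :
    op u.1 • v = ∑ i, mulForm k e f ((Module.finBasis k A).coord i) v u • w i := by
  have hv : f * v.1 = v.1 := v.2
  apply Subtype.ext
  rw [AddSubmonoidClass.coe_finsetSum]
  change v.1 * u.1 = ∑ i, (Module.finBasis k A).coord i (v.1 * u.1) • (w i).1
  simp only [hw, ← mul_smul_comm, ← Finset.mul_sum]
  conv_lhs => rw [← hv, mul_assoc]
  congr 1
  exact ((Module.finBasis k A).sum_repr _).symm

theorem projBim_tensor_projBim [Module.Finite k A] {e f e' f' : A} (he' : e' * e' = e')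
    (hf : f * f = f) (T : ObjectProperty (Bim k A)) (hT : T (projBim k e f')) :
    inAdd T (projBim k e f ⊗ projBim k e' f') := by
  obtain ⟨w, hw⟩ : ∃ w : Fin (Module.finrank k A) → rightIdeal f,
      ∀ i, (w i).1 = f * Module.finBasis k A i :=
    ⟨fun i => ⟨f * Module.finBasis k A i, by simp [rightIdeal, ← mul_assoc, hf]⟩, fun _ => rfl⟩
  have hβ : ∀ i (a : A) (v : rightIdeal f) (u : leftIdeal e'),
      mulForm k e' f ((Module.finBasis k A).coord i) (op a • v) u =
        mulForm k e' f ((Module.finBasis k A).coord i) v (a • u) := fun i a v u => by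
    change (Module.finBasis k A).coord i ((v.1 * a) * u.1) =
      (Module.finBasis k A).coord i (v.1 * (a * u.1))
    rw [mul_assoc]
  have h := outer_tensor_outer (k := k) (A := A) (U := leftIdeal e) (V' := rightIdeal f') w
    (⟨e', he'⟩ : leftIdeal e') _ hβ (fun v u => ⟨u.1, Subtype.ext u.2.symm, sum_mulForm v u w hw⟩)
  exact ⟨_, _, fun _ => projBim k e f', _, _, fun _ => hT, h⟩

theorem leftIdeal_inAdd {e : A} (he : e * e = e) :
    inAdd (fun X => X = ModuleCat.of A A) (ModuleCat.of A (leftIdeal e)) := by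
  refine ⟨Unit, inferInstance, fun _ => ModuleCat.of A A,
    fun _ => ModuleCat.ofHom (leftIdeal e).subtype,
    fun _ => ModuleCat.ofHom ((LinearMap.toSpanSingleton A A e).codRestrict (leftIdeal e)
      (fun x => ?_)), fun _ => rfl, ?_⟩
  · simp [leftIdeal, mul_assoc, he]
  · rw [Finset.univ_unique, Finset.sum_singleton, ← ModuleCat.ofHom_comp]
    refine ModuleCat.hom_ext (LinearMap.ext fun x => ?_)
    exact Subtype.ext (show x.1 * e = x.1 from x.2)

section

variable {U V : Type u} [AddCommGroup U] [Module A U] [Module k U] [IsScalarTower k A U]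
  [AddCommGroup V] [Module Aᵐᵒᵖ V] [Module k V] [IsScalarTower k Aᵐᵒᵖ V]

variable (U) in
/-- The left linear map `u ⊗ v ↦ φ (v) u`. -/
def outerProj (φ : V →ₗ[k] k) : (outer k A U V).carrier →ₗ[A] U :=
  { outerLift k A (AddMonoidHom.mk' (fun u => AddMonoidHom.mk' (fun v => φ v • u)
      (fun x y => by simp [add_smul])) (fun x y => by ext; simp))
      (fun c u v => by simp [mul_smul, smul_comm c]) with
    map_smul' := fun a t => by
      induction t using outer_induction with
      | h0 => simp
      | ha s t hs ht => simp_all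
      | ht u v => exact (smul_algebra_smul_comm (φ v) a u).symm }

variable (k U) in
/-- The left linear map `u ↦ u ⊗ w`. -/
def outerIncl (w : V) : U →ₗ[A] (outer k A U V).carrier where
  toFun u := pureTensor k A u w
  map_add' x y := add_pure x y w
  map_smul' _ _ := rfl

theorem sum_outerIncl {ι : Type} [Fintype ι] (φ : ι → V →ₗ[k] k) (w : ι → V)
    (h : ∀ v, v = ∑ i, φ i v • w i) (t : (outer k A U V).carrier) :
    ∑ i, outerIncl k U (w i) (outerProj U (φ i) t) = t := by
  induction t using outer_induction with
  | h0 => simp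
  | ha s t hs ht => simp [Finset.sum_add_distrib, hs, ht]
  | ht u v =>
    have : pureTensor k A u v = ∑ i, pureTensor k A u (φ i v • w i) := by rw [← pure_sum, ← h]
    refine Eq.trans ?_ this.symm
    exact Finset.sum_congr rfl fun i _ => pure_smul (φ i v) u (w i)

theorem outer_inAdd {ι : Type} [Fintype ι] (φ : ι → V →ₗ[k] k) (w : ι → V)
    (h : ∀ v, v = ∑ i, φ i v • w i) :
    inAdd (fun X => X = ModuleCat.of A U) (ModuleCat.of A (outer k A U V).carrier) := by
  refine ⟨ι, inferInstance, fun _ => ModuleCat.of A U, fun i => ModuleCat.ofHom (outerProj U (φ i)),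
    fun i => ModuleCat.ofHom (outerIncl k U (w i)), fun _ => rfl, ?_⟩
  simp only [← ModuleCat.ofHom_comp]
  refine ModuleCat.hom_ext (LinearMap.ext fun t => ?_)
  rw [ModuleCat.hom_sum, LinearMap.sum_apply]
  exact sum_outerIncl φ w h t

end

theorem projBim_act_regular [Module.Finite k A] {e f : A} (he : e * e = e) (hf : f * f = f) :
    inAdd (fun X => X = ModuleCat.of A A) (projBim k e f ⊙ₗ ModuleCat.of A A) := by
  refine inAdd_of_iso ((NTensor.rightUnit (projBim k e f).carrier).toModuleIso).symm ?_
  refine inAdd_trans (S := fun X => X = ModuleCat.of A (leftIdeal e)) ?_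
    (outer_inAdd (fun i => ((Module.finBasis k A).coord i).comp
      ((rightIdeal f).restrictScalars k).subtype)
      (fun i => (⟨f * Module.finBasis k A i, by simp [rightIdeal, ← mul_assoc, hf]⟩ :
        rightIdeal f)) fun v => ?_)
  · rintro _ rfl
    exact leftIdeal_inAdd he
  · have hv : f * v.1 = v.1 := v.2
    apply Subtype.ext
    rw [AddSubmonoidClass.coe_finsetSum]
    change v.1 = ∑ i, (Module.finBasis k A).coord i v.1 • (f * Module.finBasis k A i)
    simp only [← mul_smul_comm, ← Finset.mul_sum]
    conv_lhs => rw [← hv]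
    congr 1
    exact ((Module.finBasis k A).sum_repr _).symm

end Idempotents

section StableAdd

open MonoidalLeftAction

universe v₁ w₁ v₂ w₂

theorem inAdd_act (k : Type u) [Field k] {B : Type w₁} [Category.{v₁} B] [MonoidalCategory B]
    [Preadditive B] [Linear k B] {D : Type w₂} [Category.{v₂} D] [Preadditive D] [Linear k D]
    [MonoidalLeftAction B D] [BilinearAction k B D] {S : ObjectProperty B} {T : ObjectProperty D}
    (h : ∀ b X, S b → T X → inAdd T (b ⊙ₗ X)) {b : B} {X : D} (hb : inAdd S b) (hX : inAdd T X) :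
    inAdd T (b ⊙ₗ X) := by
  let F (X : D) : B ⥤ D := { obj := fun b => b ⊙ₗ X, map := fun f => f ⊵ₗ X }
  let G (b : B) : D ⥤ D := { obj := fun X => b ⊙ₗ X, map := fun f => b ⊴ₗ f }
  have hF (X : D) : (F X).Additive := ⟨fun {_ _ f g} => BilinearAction.actL_add k f g X⟩
  have hG (b : B) : (G b).Additive := ⟨fun {_ _ f g} => BilinearAction.actR_add k b f g⟩
  exact inAdd_map (F X) (fun b hb => inAdd_map (G b) (fun X hX => h b X hb hX) hX) hb

end StableAdd

section Projectives

variable (A : Type u) [Ring A]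

/-- The finitely generated projective left modules. -/
def IsProj : ObjectProperty (ModuleCat.{u} A) := fun X => Module.Finite A X ∧ Module.Projective A X

variable {A}

theorem isProj_iff_inAdd (X : ModuleCat.{u} A) :
    IsProj A X ↔ inAdd (fun Y => Y = ModuleCat.of A A) X := by
  constructor
  · rintro ⟨h₁, h₂⟩
    obtain ⟨n, f, g, -, -, h⟩ := Module.Finite.exists_comp_eq_id_of_projective A X
    refine ⟨Fin n, inferInstance, fun _ => ModuleCat.of A A,
      fun i => ModuleCat.ofHom ((LinearMap.proj i).comp g),
      fun i => ModuleCat.ofHom (f.comp (LinearMap.single A (fun _ => A) i)), fun _ => rfl, ?_⟩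
    simp only [← ModuleCat.ofHom_comp]
    refine ModuleCat.hom_ext (LinearMap.ext fun x => ?_)
    rw [ModuleCat.hom_sum, LinearMap.sum_apply]
    change ∑ i, f (Pi.single i (g x i)) = x
    rw [← map_sum, Finset.univ_sum_single]
    exact DFunLike.congr_fun h x
  · rintro ⟨ι, _, Y, p, q, hY, h⟩
    obtain rfl : Y = fun _ => ModuleCat.of A A := funext hY
    let g : X →ₗ[A] (ι → A) := LinearMap.pi fun i => (p i).hom
    let f : (ι → A) →ₗ[A] X := ∑ i, (q i).hom.comp (LinearMap.proj i)
    have hfg : f.comp g = LinearMap.id := by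
      refine LinearMap.ext fun x => ?_
      have := congrArg (fun φ : X ⟶ X => φ.hom x) h
      simpa [f, g] using this
    exact ⟨Module.Finite.of_surjective f fun x => ⟨g x, DFunLike.congr_fun hfg x⟩,
      Module.Projective.of_split g f hfg⟩

end Projectives

/-! ### The star algebras -/

section StarAlgebra

/-- The algebra `A_n` over `k`, given by the basis of paths `e₀, eᵢ, aᵢ, bᵢ, c` (for `1 ≤ i ≤ n`) of
the zigzag algebra of the star graph with center `0` and leaves `1, …, n`, modulo the span of the
`2`-cycles `aᵢ bᵢ`. The nonzero products of basis elements are those with the vertex idempotents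
`e₀, eᵢ`, where `aᵢ = eᵢ aᵢ e₀`, `bᵢ = e₀ bᵢ eᵢ`, `c = e₀ c e₀`, and `bᵢ aᵢ = c`.
An element is recorded by its coefficients; the index `i : Fin n` stands for the vertex `i + 1`. -/
@[ext]
structure StarAlg (k : Type u) (n : ℕ) : Type u where
  e₀ : k
  c : k
  e : Fin n → k
  a : Fin n → k
  b : Fin n → k

namespace StarAlg

variable {k : Type u} [Field k] {n : ℕ}

instance : Zero (StarAlg k n) := ⟨⟨0, 0, 0, 0, 0⟩⟩
instance : One (StarAlg k n) := ⟨⟨1, 0, 1, 0, 0⟩⟩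
instance : Add (StarAlg k n) := ⟨fun x y => ⟨x.e₀ + y.e₀, x.c + y.c, x.e + y.e, x.a + y.a, x.b + y.b⟩⟩
instance : Neg (StarAlg k n) := ⟨fun x => ⟨-x.e₀, -x.c, -x.e, -x.a, -x.b⟩⟩
instance : SMul k (StarAlg k n) :=
  ⟨fun r x => ⟨r * x.e₀, r * x.c, r • x.e, r • x.a, r • x.b⟩⟩
instance : Mul (StarAlg k n) := ⟨fun x y =>
  { e₀ := x.e₀ * y.e₀
    c := x.e₀ * y.c + x.c * y.e₀ + ∑ i, x.b i * y.a i
    e := fun i => x.e i * y.e i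
    a := fun i => x.e i * y.a i + x.a i * y.e₀
    b := fun i => x.e₀ * y.b i + x.b i * y.e i }⟩

section lemmas
variable (x y : StarAlg k n) (r : k) (i : Fin n)
@[simp] theorem zero_e₀ : (0 : StarAlg k n).e₀ = 0 := rfl
@[simp] theorem zero_c : (0 : StarAlg k n).c = 0 := rfl
@[simp] theorem zero_e : (0 : StarAlg k n).e i = 0 := rfl
@[simp] theorem zero_a : (0 : StarAlg k n).a i = 0 := rfl
@[simp] theorem zero_b : (0 : StarAlg k n).b i = 0 := rfl
@[simp] theorem one_e₀ : (1 : StarAlg k n).e₀ = 1 := rfl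
@[simp] theorem one_c : (1 : StarAlg k n).c = 0 := rfl
@[simp] theorem one_e : (1 : StarAlg k n).e i = 1 := rfl
@[simp] theorem one_a : (1 : StarAlg k n).a i = 0 := rfl
@[simp] theorem one_b : (1 : StarAlg k n).b i = 0 := rfl
@[simp] theorem add_e₀ : (x + y).e₀ = x.e₀ + y.e₀ := rfl
@[simp] theorem add_c : (x + y).c = x.c + y.c := rfl
@[simp] theorem add_e : (x + y).e i = x.e i + y.e i := rfl
@[simp] theorem add_a : (x + y).a i = x.a i + y.a i := rfl
@[simp] theorem add_b : (x + y).b i = x.b i + y.b i := rfl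
@[simp] theorem neg_e₀ : (-x).e₀ = -x.e₀ := rfl
@[simp] theorem neg_c : (-x).c = -x.c := rfl
@[simp] theorem neg_e : (-x).e i = -x.e i := rfl
@[simp] theorem neg_a : (-x).a i = -x.a i := rfl
@[simp] theorem neg_b : (-x).b i = -x.b i := rfl
@[simp] theorem smul_e₀ : (r • x).e₀ = r * x.e₀ := rfl
@[simp] theorem smul_c : (r • x).c = r * x.c := rfl
@[simp] theorem smul_e : (r • x).e i = r * x.e i := rfl
@[simp] theorem smul_a : (r • x).a i = r * x.a i := rfl
@[simp] theorem smul_b : (r • x).b i = r * x.b i := rfl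
@[simp] theorem mul_e₀ : (x * y).e₀ = x.e₀ * y.e₀ := rfl
@[simp] theorem mul_c : (x * y).c = x.e₀ * y.c + x.c * y.e₀ + ∑ i, x.b i * y.a i := rfl
@[simp] theorem mul_e : (x * y).e i = x.e i * y.e i := rfl
@[simp] theorem mul_a : (x * y).a i = x.e i * y.a i + x.a i * y.e₀ := rfl
@[simp] theorem mul_b : (x * y).b i = x.e₀ * y.b i + x.b i * y.e i := rfl
end lemmas

instance : AddCommGroup (StarAlg k n) where
  add_assoc x y z := by ext <;> simp [add_assoc]
  zero_add x := by ext <;> simp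
  add_zero x := by ext <;> simp
  add_comm x y := by ext <;> simp [add_comm]
  neg_add_cancel x := by ext <;> simp
  nsmul := nsmulRec
  zsmul := zsmulRec

instance : Ring (StarAlg k n) where
  left_distrib x y z := by ext <;> simp [mul_add, Finset.sum_add_distrib] <;> ring
  right_distrib x y z := by ext <;> simp [add_mul, Finset.sum_add_distrib] <;> ring
  zero_mul x := by ext <;> simp
  mul_zero x := by ext <;> simp
  mul_assoc x y z := by
    ext
    · simp [mul_assoc]
    · simp only [mul_c, mul_e₀, mul_b, mul_a, add_mul, mul_add, Finset.sum_add_distrib,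
        Finset.mul_sum, Finset.sum_mul, mul_assoc]
      abel
    · simp [mul_assoc]
    · simp only [mul_a, mul_e₀, mul_e]; ring
    · simp only [mul_b, mul_e₀, mul_e]; ring
  one_mul x := by ext <;> simp
  mul_one x := by ext <;> simp
  neg_add_cancel := neg_add_cancel
  zsmul := zsmulRec

instance : Module k (StarAlg k n) where
  one_smul x := by ext <;> simp
  mul_smul r s x := by ext <;> simp [mul_assoc]
  smul_zero r := by ext <;> simp
  smul_add r x y := by ext <;> simp [mul_add]
  add_smul r s x := by ext <;> simp [add_mul]
  zero_smul x := by ext <;> simp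

instance : Algebra k (StarAlg k n) := Algebra.ofModule
  (fun r x y => by ext <;> simp [mul_add, mul_assoc, Finset.mul_sum])
  (fun r x y => by ext <;> simp [mul_add, Finset.mul_sum] <;> ring_nf)

/-- The coordinates. -/
def coords : StarAlg k n →ₗ[k] k × k × (Fin n → k) × (Fin n → k) × (Fin n → k) where
  toFun x := (x.e₀, x.c, x.e, x.a, x.b)
  map_add' _ _ := rfl
  map_smul' _ _ := rfl

instance : Module.Finite k (StarAlg k n) :=
  Module.Finite.of_injective (coords (k := k) (n := n)) (fun x y h => by
    simp only [coords, LinearMap.coe_mk, AddHom.coe_mk, Prod.mk.injEq] at h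
    obtain ⟨h₁, h₂, h₃, h₄, h₅⟩ := h
    exact StarAlg.ext h₁ h₂ h₃ h₄ h₅)

variable (k n) in
/-- The idempotent of the vertex `i`. -/
def idem (i : Fin (n + 1)) : StarAlg k n :=
  Fin.cases ⟨1, 0, 0, 0, 0⟩ (fun i => ⟨0, 0, Pi.single i 1, 0, 0⟩) i

variable (k) in
/-- The arrow `aᵢ`. -/
def arrowA (i : Fin n) : StarAlg k n := ⟨0, 0, 0, Pi.single i 1, 0⟩

variable (k) in
/-- The arrow `bᵢ`. -/
def arrowB (i : Fin n) : StarAlg k n := ⟨0, 0, 0, 0, Pi.single i 1⟩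

variable (k n) in
/-- The element `c = bᵢ aᵢ`. -/
def loop : StarAlg k n := ⟨0, 1, 0, 0, 0⟩

theorem idem_mul_idem (i : Fin (n + 1)) : idem k n i * idem k n i = idem k n i := by
  refine Fin.cases ?_ (fun i => ?_) i
  · ext <;> simp [idem]
  · ext j <;> simp [idem, Pi.single_apply]

theorem arrowB_mul_arrowA (i j : Fin n) :
    arrowB k i * arrowA k j = if i = j then loop k n else 0 := by
  split_ifs with h
  · subst h
    ext <;> simp [arrowA, arrowB, loop, Pi.single_apply]
  · ext <;> simp [arrowA, arrowB, Pi.single_apply, Ne.symm h]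

theorem arrowA_mul_arrowB (i j : Fin n) : arrowA k i * arrowB k j = 0 := by
  ext <;> simp [arrowA, arrowB]

theorem idem_mul_arrowA (i : Fin n) :
    idem k n i.succ * arrowA k i * idem k n 0 = arrowA k i := by
  ext <;> simp [arrowA, idem, Pi.single_apply]

theorem idem_mul_arrowB (i : Fin n) :
    idem k n 0 * arrowB k i * idem k n i.succ = arrowB k i := by
  ext <;> simp [arrowB, idem, Pi.single_apply]

end StarAlg

end StarAlgebra

/-! ### The bicategory of projective bimodules and its birepresentations -/

section Birepresentations

open MonoidalLeftAction StarAlg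

variable (k : Type u) [Field k] (n : ℕ)

/-- The bimodules `A eᵢ ⊗_k e₀ A`. -/
def genN : ObjectProperty (Bim k (StarAlg k n)) := fun X =>
  ∃ i, X = projBim k (idem k n i) (idem k n 0)

/-- The regular bimodule `A` and the bimodules `A eᵢ ⊗_k e₀ A`. -/
def genB : ObjectProperty (Bim k (StarAlg k n)) := fun X => X = 𝟙_ _ ∨ genN k n X

theorem genN_le_genB : inAdd (genN k n) ≤ inAdd (genB k n) := fun _ h =>
  inAdd_trans (fun _ hY => inAdd_of (Or.inr hY)) h

theorem genB_act_genN (b X : Bim k (StarAlg k n)) (hb : genB k n b) (hX : genN k n X) :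
    inAdd (genN k n) (b ⊙ₗ X) := by
  obtain ⟨j, rfl⟩ := hX
  obtain rfl | ⟨i, rfl⟩ := hb
  · exact inAdd_of_iso (λ_ _).symm (inAdd_of ⟨j, rfl⟩)
  · exact projBim_tensor_projBim (idem_mul_idem j) (idem_mul_idem 0) _ ⟨i, rfl⟩

instance : (inAdd (genB k n)).IsMonoidal where
  prop_unit := inAdd_of (Or.inl rfl)
  prop_tensor b X hb hX := inAdd_act (D := Bim k (StarAlg k n)) k (fun b X hb hX => by
    obtain rfl | hX := hX
    · exact inAdd_of_iso (ρ_ b).symm (inAdd_of hb)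
    · exact genN_le_genB k n _ (genB_act_genN k n b X hb hX)) hb hX

instance : StableUnder (inAdd (genB k n)) (inAdd (genN k n)) where
  prop_act hb hX := inAdd_act k (genB_act_genN k n) hb hX

instance : StableUnder (inAdd (genB k n)) (IsProj (StarAlg k n)) where
  prop_act hb hX := by
    rw [isProj_iff_inAdd] at hX ⊢
    refine inAdd_act k (fun b X hb hX => ?_) hb hX
    obtain rfl := hX
    obtain rfl | ⟨i, rfl⟩ := hb
    · exact inAdd_of_iso (λₗ _).symm (inAdd_of rfl)
    · exact projBim_act_regular (idem_mul_idem i) (idem_mul_idem 0)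

/-- The monoidal category `(add {A, A eᵢ ⊗_k e₀ A | 0 ≤ i ≤ n}, ⊗_A)` for `A = A_n`, that is, the
bicategory with a single object and with this category of 1-morphisms. -/
abbrev StarBicat : Type (u + 1) := (inAdd (genB k n)).FullSubcategory

/-- The principal birepresentation. -/
abbrev birepP : Birep.{u, u, u + 1} k (StarBicat k n) := regularBirep k

/-- The subbirepresentation `add {A eᵢ ⊗_k e₀ A | 0 ≤ i ≤ n}` of the principal
birepresentation. -/
abbrev birepN : Birep.{u, u, u + 1} k (StarBicat k n) :=
  restrictBirep k (inAdd (genB k n)) (inAdd (genN k n))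

/-- The cell birepresentation: the category of finitely generated projective left `A_n`-modules,
on which a bimodule `M` acts by `M ⊗_A -`. -/
abbrev birepC : Birep.{u, u, u + 1} k (StarBicat k n) :=
  restrictBirep k (inAdd (genB k n)) (IsProj (StarAlg k n))

/-- The inclusion of `N` in the principal birepresentation. -/
def Gamma : StrongTrans (birepN k n) (birepP k n) := inclTrans (genN_le_genB k n)

variable {n}

/-- The indecomposable projective module `A eᵢ`, as an object of `C`. -/
def projObj (i : Fin (n + 1)) : (birepC k n).carrier :=
  ⟨ModuleCat.of (StarAlg k n) (leftIdeal (idem k n i)),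
    (isProj_iff_inAdd _).2 (leftIdeal_inAdd (idem_mul_idem i))⟩

/-- The strong transformation `Θᵢ = - ⊗_A A eᵢ` from the principal birepresentation to `C`. -/
def Theta (i : Fin (n + 1)) : StrongTrans (birepP k n) (birepC k n) :=
  evalTrans k (birepC k n) (projObj k i)

end Birepresentations

/-! ### The isomorphisms `s_{j,l}` -/

section IsoS

open MonoidalLeftAction StarAlg Functor.LaxLeftLinear

variable {k : Type u} [Field k]

section general

variable {A : Type u} [Ring A] [Algebra k A]

/-- The right multiplication by an element of `A` on a bimodule. -/
def Bim.rmul (M : Bim k A) (a : A) : M.carrier →ₗ[A] M.carrier where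
  toFun m := op a • m
  map_add' := smul_add _
  map_smul' b m := (smul_comm b (op a) m).symm

/-- The left linear map `M ⊗_A A e ⟶ M`, `m ⊗ x ↦ m x a`, that is, the composite of the
isomorphism `M ⊗_A A e ≅ M e` with the right multiplication by `a`. -/
def mulRightMap (M : Bim k A) (e a : A) : NTensor A M.carrier (leftIdeal e) →ₗ[A] M.carrier :=
  NTensor.linearMk (NTensor.lift
    (AddMonoidHom.mk' (fun m => AddMonoidHom.mk' (fun x : leftIdeal e => op (x.1 * a) • m)
      (fun x y => by simp [add_mul, add_smul])) (fun x y => by ext; simp))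
    (fun m b x => by
      change op (x.1 * a) • op b • m = op ((b * x.1) * a) • m
      rw [← mul_smul, ← op_mul, mul_assoc]))
    (fun b m x => (smul_comm b (op (x.1 * a)) m).symm)

theorem mulRightMap_tmul (M : Bim k A) (e a : A) (m : M.carrier) (x : leftIdeal e) :
    mulRightMap M e a (NTensor.tmul A m x) = op (x.1 * a) • m := rfl

/-- The map `f ⊗_A A e`. -/
abbrev mapLeft {M N : Bim k A} (f : M ⟶ N) (e : A) :
    NTensor A M.carrier (leftIdeal e) →ₗ[A] NTensor A N.carrier (leftIdeal e) :=
  (actMap f (𝟙 (ModuleCat.of A (leftIdeal e)))).hom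

theorem mulRightMap_natural {M N : Bim k A} (f : M ⟶ N) (e a : A)
    (t : NTensor A M.carrier (leftIdeal e)) :
    mulRightMap N e a (mapLeft f e t) = Bim.Hom.lin f (mulRightMap M e a t) := by
  have : (mulRightMap N e a).comp (mapLeft f e) = (Bim.Hom.lin f).comp (mulRightMap M e a) :=
    NTensor.linear_ext fun m x => (Bim.Hom.map_op f (op (x.1 * a)) m).symm
  exact DFunLike.congr_fun this t

theorem mulRightMap_assoc (M N : Bim k A) (e a : A) (m : M.carrier)
    (t : NTensor A N.carrier (leftIdeal e)) :
    mulRightMap (M ⊗ N) e a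
      ((NTensor.assoc M.carrier N.carrier (leftIdeal e)).symm (NTensor.tmul A m t)) =
      NTensor.tmul A m (mulRightMap N e a t) := by
  induction t using NTensor.induction with
  | h0 => simp
  | ha s t hs ht => simp_all [NTensor.tmul_add]
  | ht n x => rfl

/-- The condition on `M` that right multiplication by `a` is injective on `M e`, with image
`M c`. -/
def GoodRight (e a c : A) (M : Bim k A) : Prop :=
  Function.Injective (mulRightMap M e a) ∧
    LinearMap.range (mulRightMap M e a) = LinearMap.range (M.rmul c)

theorem GoodRight.of_inAdd {e a c : A} {S : ObjectProperty (Bim k A)}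
    (h : ∀ M, S M → GoodRight e a c M) {M : Bim k A} (hM : inAdd S M) : GoodRight e a c M := by
  obtain ⟨ι, _, Y, p, q, hY, hpq⟩ := hM
  have hg := fun i => h _ (hY i)
  have h₁ : ∀ m : M.carrier, ∑ i, Bim.Hom.lin (q i) (Bim.Hom.lin (p i) m) = m := fun m => by
    have := congrArg (fun f : M ⟶ M => Bim.Hom.lin f m) hpq
    rw [Bim.sum_lin] at this
    exact this
  have h₂ : ∀ t, ∑ i, mapLeft (q i) e (mapLeft (p i) e t) = t := fun t => by
    induction t using NTensor.induction with
    | h0 => simp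
    | ha s t hs ht => simp [Finset.sum_add_distrib, hs, ht]
    | ht m x =>
      have : NTensor.mk A _ _ (∑ i, Bim.Hom.lin (q i) (Bim.Hom.lin (p i) m)) x =
        NTensor.tmul A m x := by rw [h₁]; rfl
      rw [map_sum, AddMonoidHom.finsetSum_apply] at this
      exact this
  refine ⟨?_, le_antisymm ?_ ?_⟩
  · refine (injective_iff_map_eq_zero _).2 fun t ht => ?_
    rw [← h₂ t]
    refine Finset.sum_eq_zero fun i _ => ?_
    rw [(injective_iff_map_eq_zero _).1 (hg i).1 (mapLeft (p i) e t), map_zero]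
    rw [mulRightMap_natural, ht, map_zero]
  · rintro _ ⟨t, rfl⟩
    rw [← h₁ (mulRightMap M e a t)]
    refine Submodule.sum_mem _ fun i _ => ?_
    rw [← mulRightMap_natural]
    obtain ⟨y, hy⟩ := (hg i).2.le ⟨mapLeft (p i) e t, rfl⟩
    rw [← hy]
    exact ⟨Bim.Hom.lin (q i) y, (Bim.Hom.map_op (q i) (op c) y).symm⟩
  · rintro _ ⟨m, rfl⟩
    rw [← h₁ (M.rmul c m)]
    refine Submodule.sum_mem _ fun i _ => ?_
    obtain ⟨t, ht⟩ := (hg i).2.ge ⟨Bim.Hom.lin (p i) m, rfl⟩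
    have : Bim.Hom.lin (p i) (M.rmul c m) = (Y i).rmul c (Bim.Hom.lin (p i) m) :=
      Bim.Hom.map_op (p i) (op c) m
    rw [this, ← ht, ← mulRightMap_natural]
    exact ⟨_, rfl⟩

/-- For elements `w ∈ f A`, `z ∈ A e` and a linear form `φ` on `f A`, the map
`U ⊗_k f A ⟶ (U ⊗_k f A) ⊗_A A e` given by `u ⊗ v ↦ (u ⊗ φ(v) w) ⊗ z`. -/
def backMap (U : Type u) [AddCommGroup U] [Module A U] [Module k U] [IsScalarTower k A U]
    {e f : A} (φ : rightIdeal f →ₗ[k] k) (w : rightIdeal f) (z : leftIdeal e) :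
    (outer k A U (rightIdeal f)).carrier →+
      NTensor A (outer k A U (rightIdeal f)).carrier (leftIdeal e) :=
  outerLift k A (AddMonoidHom.mk' (fun u => AddMonoidHom.mk'
    (fun v => NTensor.tmul A (pureTensor k A u (φ v • w)) z)
    (fun x y => by rw [map_add, add_smul, pure_add, NTensor.add_tmul]))
    (fun x y => by ext v; simp [add_pure, NTensor.add_tmul]))
    (fun c u v => by simp [pure_smul, mul_smul])

end general

variable {n : ℕ}

theorem rightIdeal_zero_mul {v u : StarAlg k n} {j : Fin n}
    (hv : idem k n 0 * v = v) (hu : u * idem k n j.succ = u) :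
    v * u = (v * u).b j • arrowB k j := by
  rw [← hv, ← hu]
  ext i
  · simp [idem, arrowB]
  · simp [idem, arrowB]
  · simp [idem, arrowB]
  · simp [idem, arrowB]
  · by_cases h : i = j
    · subst h; simp [idem, arrowB]
    · simp [idem, arrowB, h]

/-- The coefficient of `c`, on `e₀ A`. -/
def coefC : rightIdeal (idem k n 0) →ₗ[k] k where
  toFun v := v.1.c
  map_add' _ _ := rfl
  map_smul' _ _ := rfl

/-- The element `bⱼ` of `e₀ A`. -/
def elemB (j : Fin n) : rightIdeal (idem k n 0) :=
  ⟨arrowB k j, by change idem k n 0 * arrowB k j = arrowB k j; ext <;> simp [idem, arrowB]⟩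

/-- The element `e₀` of `e₀ A`. -/
def elemE : rightIdeal (idem k n 0) := ⟨idem k n 0, idem_mul_idem 0⟩

/-- The element `eⱼ` of `A eⱼ`. -/
def genE (j : Fin n) : leftIdeal (idem k n j.succ) := ⟨idem k n j.succ, idem_mul_idem _⟩

theorem smul_arrowB_mul_arrowA (r : k) (j : Fin n) :
    r • arrowB k j * arrowA k j = r • loop k n := by
  rw [Algebra.smul_mul_assoc, arrowB_mul_arrowA, if_pos rfl]

theorem op_mul_smul (v : rightIdeal (idem k n 0)) {j : Fin n} (x : leftIdeal (idem k n j.succ)) :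
    op (x.1 * arrowA k j) • v = (v.1 * x.1).b j • op (loop k n) • elemE := by
  apply Subtype.ext
  change v.1 * (x.1 * arrowA k j) = (v.1 * x.1).b j • (idem k n 0 * loop k n)
  rw [← mul_assoc, rightIdeal_zero_mul v.2 x.2, smul_arrowB_mul_arrowA]
  congr 1
  · simp [arrowB]
  · ext <;> simp [idem, loop]

theorem op_loop_smul (v : rightIdeal (idem k n 0)) (j : Fin n) :
    op (loop k n) • v = op ((genE j).1 * arrowA k j) • (v.1.e₀ • elemB j) := by
  apply Subtype.ext
  have hv : idem k n 0 * v.1 = v.1 := v.2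
  change v.1 * loop k n = (v.1.e₀ • arrowB k j) * (idem k n j.succ * arrowA k j)
  have h : idem k n j.succ * arrowA k j = arrowA k j := by
    ext <;> simp [idem, arrowA, Pi.single_apply]
  rw [h, smul_arrowB_mul_arrowA]
  rw [← hv]
  ext <;> simp [idem, loop]

theorem goodRight_outer (U : Type u) [AddCommGroup U] [Module (StarAlg k n) U] [Module k U]
    [IsScalarTower k (StarAlg k n) U] (j : Fin n) :
    GoodRight (idem k n j.succ) (arrowA k j) (loop k n)
      (outer k (StarAlg k n) U (rightIdeal (idem k n 0))) := by
  have hinv : ∀ t, backMap U coefC (elemB j) (genE j)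
      (mulRightMap (outer k (StarAlg k n) U (rightIdeal (idem k n 0))) _ (arrowA k j) t) = t := by
    intro t
    induction t using NTensor.induction with
    | h0 => simp
    | ha s t hs ht => simp_all
    | ht m x =>
      induction m using outer_induction with
      | h0 => simp
      | ha s t hs ht => simp_all [NTensor.add_tmul]
      | ht u v =>
        have h₁ : coefC (op (x.1 * arrowA k j) • v) • elemB j = op x.1 • v := by
          apply Subtype.ext
          change (v.1 * (x.1 * arrowA k j)).c • arrowB k j = v.1 * x.1
          rw [← mul_assoc, rightIdeal_zero_mul v.2 x.2, smul_arrowB_mul_arrowA]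
          simp [loop, arrowB]
        have h₂ : x.1 • genE j = x := Subtype.ext x.2
        rw [mulRightMap_tmul, op_smul_pure]
        change NTensor.tmul _ (pureTensor k (StarAlg k n) u
          (coefC (op (x.1 * arrowA k j) • v) • elemB j)) (genE j) = _
        rw [h₁, ← op_smul_pure, NTensor.smul_tmul, h₂]
  refine ⟨Function.LeftInverse.injective hinv, le_antisymm ?_ ?_⟩
  · rintro _ ⟨t, rfl⟩
    induction t using NTensor.induction with
    | h0 => simp
    | ha s t hs ht => rw [map_add]; exact Submodule.add_mem _ hs ht
    | ht m x =>
      induction m using outer_induction with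
      | h0 => simp
      | ha s t hs ht => rw [NTensor.add_tmul, map_add]; exact Submodule.add_mem _ hs ht
      | ht u v =>
        rw [mulRightMap_tmul, op_smul_pure, op_mul_smul, ← pure_smul]
        exact ⟨pureTensor k _ _ elemE, rfl⟩
  · rintro _ ⟨t, rfl⟩
    induction t using outer_induction with
    | h0 => simp
    | ha s t hs ht => rw [map_add]; exact Submodule.add_mem _ hs ht
    | ht u v =>
      refine ⟨NTensor.tmul _ (pureTensor k _ u (v.1.e₀ • elemB j)) (genE j), ?_⟩
      rw [mulRightMap_tmul, op_smul_pure, ← op_loop_smul]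
      rfl

theorem goodRight_of_mem {M : Bim k (StarAlg k n)} (hM : inAdd (genN k n) M) (j : Fin n) :
    GoodRight (idem k n j.succ) (arrowA k j) (loop k n) M :=
  GoodRight.of_inAdd (by rintro _ ⟨i, rfl⟩; exact goodRight_outer _ j) hM

/-- The isomorphism `M ⊗_A A eⱼ ≅ M eⱼ ≅ M c ≅ M eₗ ≅ M ⊗_A A eₗ`, whose second arrow is the right
multiplication by `aⱼ` and whose third arrow is the inverse of the right multiplication by `aₗ`. -/
def sEquiv (j l : Fin n) {M : Bim k (StarAlg k n)} (hM : inAdd (genN k n) M) :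
    NTensor (StarAlg k n) M.carrier (leftIdeal (idem k n j.succ)) ≃ₗ[StarAlg k n]
      NTensor (StarAlg k n) M.carrier (leftIdeal (idem k n l.succ)) :=
  (LinearEquiv.ofInjective _ (goodRight_of_mem hM j).1).trans
    ((LinearEquiv.ofEq _ _ ((goodRight_of_mem hM j).2.trans (goodRight_of_mem hM l).2.symm)).trans
      (LinearEquiv.ofInjective _ (goodRight_of_mem hM l).1).symm)

theorem mulRightMap_sEquiv (j l : Fin n) {M : Bim k (StarAlg k n)} (hM : inAdd (genN k n) M)
    (t : NTensor (StarAlg k n) M.carrier (leftIdeal (idem k n j.succ))) :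
    mulRightMap M _ (arrowA k l) (sEquiv j l hM t) = mulRightMap M _ (arrowA k j) t := by
  have h := LinearEquiv.apply_symm_apply (LinearEquiv.ofInjective _ (goodRight_of_mem hM l).1)
    (LinearEquiv.ofEq _ _ ((goodRight_of_mem hM j).2.trans (goodRight_of_mem hM l).2.symm)
      (LinearEquiv.ofInjective _ (goodRight_of_mem hM j).1 t))
  exact congrArg Subtype.val h

theorem sEquiv_natural (j l : Fin n) {M N : Bim k (StarAlg k n)} (hM : inAdd (genN k n) M)
    (hN : inAdd (genN k n) N) (f : M ⟶ N)
    (t : NTensor (StarAlg k n) M.carrier (leftIdeal (idem k n j.succ))) :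
    sEquiv j l hN (mapLeft f _ t) = mapLeft f _ (sEquiv j l hM t) := by
  apply (goodRight_of_mem hN l).1
  rw [mulRightMap_natural, mulRightMap_sEquiv, mulRightMap_sEquiv, mulRightMap_natural]

theorem sEquiv_assoc (j l : Fin n) {M N : Bim k (StarAlg k n)} (hN : inAdd (genN k n) N)
    (hMN : inAdd (genN k n) (M ⊗ N)) (m : M.carrier)
    (t : NTensor (StarAlg k n) N.carrier (leftIdeal (idem k n j.succ))) :
    sEquiv j l hMN ((NTensor.assoc M.carrier N.carrier (leftIdeal (idem k n j.succ))).symm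
      (NTensor.tmul _ m t)) =
    (NTensor.assoc M.carrier N.carrier (leftIdeal (idem k n l.succ))).symm
      (NTensor.tmul _ m (sEquiv j l hN t)) := by
  apply (goodRight_of_mem hMN l).1
  rw [mulRightMap_sEquiv, mulRightMap_assoc, mulRightMap_assoc, mulRightMap_sEquiv]

theorem mu_Gamma_Theta (b : StarBicat k n) (M : (birepN k n).carrier) (i : Fin (n + 1)) :
    (StrongTrans.comp (Gamma k n) (Theta k i)).mu b M =
      (αₗ b ((Gamma k n).functor.obj M) (projObj k i)).inv := by
  have h : (Theta k i).functor.map (𝟙 (b ⊗ (Gamma k n).functor.obj M)) = 𝟙 _ :=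
    CategoryTheory.Functor.map_id _ _
  exact (congrArg (fun f => (αₗ b ((Gamma k n).functor.obj M) (projObj k i)).inv ≫ f) h).trans
    (Category.comp_id _)

variable (k) in
/-- The invertible modification `s_{j,l} : Θⱼ ∘ Γ ≅ Θₗ ∘ Γ`. -/
def sIso (j l : Fin n) : StrongTrans.comp (Gamma k n) (Theta k j.succ) ≅
    StrongTrans.comp (Gamma k n) (Theta k l.succ) :=
  StrongTrans.mkIso (NatIso.ofComponents
    (fun M => (IsProj (StarAlg k n)).isoMk (sEquiv j l M.2).toModuleIso)
    (fun {M N} f => ObjectProperty.hom_ext _ (ModuleCat.hom_ext (LinearMap.ext fun t =>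
      sEquiv_natural j l M.2 N.2 f.hom t))))
    (fun b M => by
      change StrongTrans.mu _ b M ≫ _ = _ ≫ StrongTrans.mu _ b M
      rw [mu_Gamma_Theta, mu_Gamma_Theta]
      exact ObjectProperty.hom_ext _ (ModuleCat.hom_ext (NTensor.linear_ext fun m t =>
        sEquiv_assoc j l M.2 (StableUnder.prop_act b.2 M.2) m t)))

end IsoS

/-! ### The birepresentation associated to a partition -/

section Partition

/-- A set partition of `{0, 1, …, n}` with `{0}` as one of its blocks, with an enumeration
`i^m_1, …, i^m_{k_m}` of each of the other `r` blocks. The element `i + 1` of `{1, …, n}` is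
represented by `i : Fin n`. -/
structure StarPartition (n : ℕ) where
  /-- The number of blocks other than `{0}`. -/
  r : ℕ
  /-- The numbers of elements of these blocks. -/
  len : Fin r → ℕ
  len_pos : ∀ m, 0 < len m
  /-- The enumeration `(m, l) ↦ i^m_l`. -/
  enum : (Σ m : Fin r, Fin (len m)) ≃ Fin n

namespace StarPartition

variable {n : ℕ} (P : StarPartition n)

/-- The pairs `(m, l)` such that both `i^m_l` and `i^m_{l+1}` are defined. -/
abbrev Step : Type := Σ m : Fin P.r, Fin (P.len m - 1)

/-- The element `i^m_l`. -/
def src (s : P.Step) : Fin n := P.enum ⟨s.1, ⟨s.2.1, by have := s.2.2; omega⟩⟩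

/-- The element `i^m_{l+1}`. -/
def tgt (s : P.Step) : Fin n := P.enum ⟨s.1, ⟨s.2.1 + 1, by have := s.2.2; omega⟩⟩

/-- A set which contains exactly one element of each block. -/
def IsTransversal (U : Set (Fin (n + 1))) : Prop :=
  0 ∈ U ∧ ∀ m : Fin P.r, ∃! l : Fin (P.len m), (P.enum ⟨m, l⟩).succ ∈ U

end StarPartition

/-- A birepresentation `C^W` with the structure of a multiple coisoinserter of the pairs
`Θ_{i^m_l}, Θ_{i^m_{l+1}} : P ⟶ C`, consisting of `Ω^W : C ⟶ C^W` and invertible modifications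
`x^m_l : Ω^W ∘ Θ_{i^m_l} ≅ Ω^W ∘ Θ_{i^m_{l+1}}`, and a birepresentation `C^WR` with the structure
`Ω^R : C^W ⟶ C^WR` of a multiple coequifier of the pairs of invertible modifications
`x^m_l • Γ, Ω^W • s_{i^m_l, i^m_{l+1}} : Ω^W ∘ Θ_{i^m_l} ∘ Γ ⟶ Ω^W ∘ Θ_{i^m_{l+1}} ∘ Γ`. -/
structure CWRData (k : Type u) [Field k] {n : ℕ} (P : StarPartition n) where
  CW : Birep.{u, u + 1, u + 1} k (StarBicat k n)
  cone : IsoCone (fun s : P.Step => Theta k (P.src s).succ) (fun s => Theta k (P.tgt s).succ) CW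
  isCoisoinserter : IsCoisoinserter cone
  CWR : Birep.{u, u + 1, u + 1} k (StarBicat k n)
  ΩR : StrongTrans CW CWR
  isCoequifier : IsCoequifier
    (F := fun s : P.Step => StrongTrans.comp (Gamma k n)
      (StrongTrans.comp (Theta k (P.src s).succ) cone.trans))
    (G := fun s : P.Step => StrongTrans.comp (Gamma k n)
      (StrongTrans.comp (Theta k (P.tgt s).succ) cone.trans))
    (fun s => StrongTrans.whiskerLeft (Gamma k n) (cone.iso s).hom)
    (fun s => (StrongTrans.assoc _ _ _).inv ≫
      StrongTrans.whiskerRight (sIso k (P.src s) (P.tgt s)).hom cone.trans ≫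
        (StrongTrans.assoc _ _ _).hom) ΩR

/-- The strong transformation `Ω^WR = Ω^R ∘ Ω^W : C ⟶ C^WR`. -/
def CWRData.Ω {k : Type u} [Field k] {n : ℕ} {P : StarPartition n} (D : CWRData k P) :
    StrongTrans (birepC k n) D.CWR :=
  StrongTrans.comp D.cone.trans D.ΩR

/-- The full subcategory `add {A e_i | i ∈ U}` of the category of finitely generated projective left
`A_n`-modules. -/
abbrev addProj (k : Type u) [Field k] {n : ℕ} (U : Set (Fin (n + 1))) :
    ObjectProperty (birepC k n).carrier :=
  inAdd fun X => ∃ i ∈ U, X = projObj k i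

end Partition

section Finitary

universe v₁ w₁ v₂ w₂

/-- There is a `k`-linear equivalence between two `k`-linear categories. -/
def LinearlyEquivalent (k : Type u) [Field k] (C : Type w₁) [Category.{v₁} C] [Preadditive C]
    [Linear k C] (D : Type w₂) [Category.{v₂} D] [Preadditive D] [Linear k D] : Prop :=
  ∃ F : C ⥤ D, F.IsEquivalence ∧ F.Additive ∧ F.Linear k

/-- A birepresentation is finitary if its underlying category is linearly equivalent to the category
of finitely generated projective modules over a finite dimensional algebra. -/
def IsFinitary {k : Type u} [Field k] {B : Type w'} [Category.{v'} B] [MonoidalCategory B]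
    [Preadditive B] [Linear k B] (M : Birep.{u, v₁, w₁} k B) : Prop :=
  ∃ (Λ : Type u) (_ : Ring Λ) (_ : Algebra k Λ), Module.Finite k Λ ∧
    LinearlyEquivalent k M.carrier (IsProj Λ).FullSubcategory

end Finitary

end StarRep

end

open CategoryTheory

/-! Apart from their existence, everything about the colimits is deduced from their universal
properties, in four arguments.

Existence (`nonempty_CWRData`). The coisoinserter keeps the objects of `C`. Its morphisms are terms
built from morphisms of `C` and formal components of a cone and their inverses, by composition,
linear combination and the action of the bicategory. Two terms are identified when they take equal
values in every cone. All axioms then hold because they hold in every cone, and a given cone factors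
by evaluation. The coequifier is built in the same way, without new generators.

Faithfulness (`CWRData.faithful`). It suffices to produce one cone, compatible with the `s_{j,l}` on
the ideal `N`, whose functor is faithful. Enlarge the morphisms `X ⟶ Y` of `C` to all families `N ⊗
X ⟶ N ⊗ Y` natural in the objects of the ideal. There `s_{j,l}` is itself an isomorphism from `A
e_j` to `A e_l`, and evaluating at it gives the cone. The functor from `C` is faithful because `e_0
A` detects elements of projective modules, which rests on `b_i a_i = c` being nonzero.

Upper bound on morphisms (`CWRData.generated_and_essSurj`, `CWRData.lifts`). The universal cone
factors through the birepresentation generated by its own values. By uniqueness of factorisations,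
every morphism between images of `Ω` is therefore generated by images of morphisms of `C` and by
components of the cone, and every object is isomorphic to an image. By naturality, only the
components at the generators of the bicategory matter. On `N` they are images of `s`; at the unit
they are isomorphisms `Ω(A e_j) ≅ Ω(A e_l)` between consecutive leaves of a block. These
isomorphisms are compatible with the arrows (`CWRData.map_homB_xUnit`, `CWRData.xUnit_map_homA`).
Indeed right multiplication by `b_j` factors through the multiplication `A e_0 ⊗ e_0 A ⟶ A`, right
multiplication by `a_j` factors through the map `A ⟶ A e_0 ⊗ e_0 A` given by a central element, and
both factorisations are respected by `s`. Hence, after moving every leaf to the first leaf of its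
block, each morphism between images of indecomposable projectives comes from `C`.

Conclusion. The spaces `Hom(A e_i, A e_j)` with a leaf involved have dimension at most one, so `Ω`
is bijective on all of them except between distinct leaves of one block. There the space is zero in
`C`, while the images are isomorphic and nonzero. On a transversal this exception does not occur,
and splitting of idempotents yields an equivalence. Finally, if `e` is the sum of the idempotents of
a transversal, then `e A_n e` is a copy of `A_r`, and `X ↦ e X` identifies the additive closure of
the transversal with `A_r-proj` (`starCorner_isEquivalence`). -/

noncomputable section

open CategoryTheory MonoidalCategory MulOpposite
open scoped TensorProduct

set_option linter.unusedSectionVars false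
set_option linter.checkUnivs false

namespace StarRep

/-! ### The action on morphisms between values of a strong transformation -/

section Conj

open MonoidalLeftAction Functor.LaxLeftLinear Functor.OplaxLeftLinear Functor.LeftLinear

universe v₂ w₂

variable {k : Type u} [Field k] {B : Type w'} [Category.{v'} B] [MonoidalCategory B]
  [Preadditive B] [Linear k B]

namespace StrongTrans

variable {M : Birep.{u, v, w} k B} {R : Birep.{u, v₂, w₂} k B} (Φ : StrongTrans M R)
  {X Y Z : M.carrier}

/-- The action of `b` on a morphism `Φ X ⟶ Φ Y`, as a morphism `Φ (b ⊙ X) ⟶ Φ (b ⊙ Y)`. -/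
def conj (b : B) (f : Φ.functor.obj X ⟶ Φ.functor.obj Y) :
    Φ.functor.obj (b ⊙ₗ X) ⟶ Φ.functor.obj (b ⊙ₗ Y) :=
  δₗ Φ.functor b X ≫ b ⊴ₗ f ≫ μₗ Φ.functor b Y

theorem mu_conj (b : B) (f : Φ.functor.obj X ⟶ Φ.functor.obj Y) :
    μₗ Φ.functor b X ≫ Φ.conj b f = b ⊴ₗ f ≫ μₗ Φ.functor b Y := by
  simp [conj]

theorem conj_map (b : B) (f : X ⟶ Y) : Φ.conj b (Φ.functor.map f) = Φ.functor.map (b ⊴ₗ f) := by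
  simp [conj]

theorem conj_comp (b : B) (f : Φ.functor.obj X ⟶ Φ.functor.obj Y)
    (g : Φ.functor.obj Y ⟶ Φ.functor.obj Z) : Φ.conj b (f ≫ g) = Φ.conj b f ≫ Φ.conj b g := by
  simp [conj]

theorem conj_add (b : B) (f g : Φ.functor.obj X ⟶ Φ.functor.obj Y) :
    Φ.conj b (f + g) = Φ.conj b f + Φ.conj b g := by
  simp [conj, R.actR_add]

theorem conj_smul (b : B) (c : k) (f : Φ.functor.obj X ⟶ Φ.functor.obj Y) :
    Φ.conj b (c • f) = c • Φ.conj b f := by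
  simp [conj, R.actR_smul]

/-- The interchange law of the action, transported along the structure isomorphisms of `Φ`. Together
with `conj_tensor` and `conj_unit` it supplies the less formal axioms of an `Extension`, both for
classes of terms and for generated morphisms. -/
theorem conj_exchange {b b' : B} (f : b ⟶ b') (g : Φ.functor.obj X ⟶ Φ.functor.obj Y) :
    Φ.conj b g ≫ Φ.functor.map (f ⊵ₗ Y) = Φ.functor.map (f ⊵ₗ X) ≫ Φ.conj b' g := by
  simp only [conj, Category.assoc]
  rw [← μₗ_naturality_left, δₗ_naturality_left_assoc, action_exchange_assoc]

theorem conj_tensor (b b' : B) (f : Φ.functor.obj X ⟶ Φ.functor.obj Y) :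
    Φ.conj (b ⊗ b') f ≫ Φ.functor.map (αₗ b b' Y).hom =
      Φ.functor.map (αₗ b b' X).hom ≫ Φ.conj b (Φ.conj b' f) := by
  simp only [conj, Category.assoc, actionHomRight_comp]
  rw [μₗ_associativity, tensor_actionHomRight]
  simp

theorem conj_unit (f : Φ.functor.obj X ⟶ Φ.functor.obj Y) :
    Φ.conj (𝟙_ B) f ≫ Φ.functor.map (λₗ Y).hom = Φ.functor.map (λₗ X).hom ≫ f := by
  simp only [conj, Category.assoc]
  rw [← μₗ_unitality, unit_actionHomRight, ← δₗ_unitality_hom_assoc]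
  simp

/-- The action on isomorphisms. -/
def conjIso (b : B) (e : Φ.functor.obj X ≅ Φ.functor.obj Y) :
    Φ.functor.obj (b ⊙ₗ X) ≅ Φ.functor.obj (b ⊙ₗ Y) where
  hom := Φ.conj b e.hom
  inv := Φ.conj b e.inv
  hom_inv_id := by
    rw [← conj_comp, e.hom_inv_id, ← Φ.functor.map_id, conj_map, actionHomRight_id,
      Φ.functor.map_id]
  inv_hom_id := by
    rw [← conj_comp, e.inv_hom_id, ← Φ.functor.map_id, conj_map, actionHomRight_id,
      Φ.functor.map_id]

end StrongTrans

end Conj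

/-! ### Birepresentations with the objects of a given one and new morphisms -/

section Extension

open MonoidalLeftAction Functor.LaxLeftLinear Functor.OplaxLeftLinear Functor.LeftLinear

variable {k : Type u} [Field k] {B : Type w'} [Category.{v'} B] [MonoidalCategory B]
  [Preadditive B] [Linear k B]

universe v₁ w₁ v₂ w₂ v₃ w₃

/-- New morphisms between the objects of a birepresentation `M`, together with a map from the old
morphisms to the new ones, which carry a `k`-linear action of `B`. -/
structure Extension (M : Birep.{u, v, w} k B) where
  Hom : M.carrier → M.carrier → Type v₁
  [addCommGroup : ∀ X Y, AddCommGroup (Hom X Y)]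
  [module : ∀ X Y, Module k (Hom X Y)]
  of : ∀ {X Y : M.carrier}, (X ⟶ Y) → Hom X Y
  comp : ∀ {X Y Z : M.carrier}, Hom X Y → Hom Y Z → Hom X Z
  act : ∀ (b : B) {X Y : M.carrier}, Hom X Y → Hom (b ⊙ₗ X) (b ⊙ₗ Y)
  id_comp : ∀ {X Y} (f : Hom X Y), comp (of (𝟙 X)) f = f
  comp_id : ∀ {X Y} (f : Hom X Y), comp f (of (𝟙 Y)) = f
  comp_assoc : ∀ {X Y Z W} (f : Hom X Y) (g : Hom Y Z) (h : Hom Z W),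
    comp (comp f g) h = comp f (comp g h)
  add_comp : ∀ {X Y Z} (f f' : Hom X Y) (g : Hom Y Z),
    comp (f + f') g = comp f g + comp f' g
  comp_add : ∀ {X Y Z} (f : Hom X Y) (g g' : Hom Y Z),
    comp f (g + g') = comp f g + comp f g'
  smul_comp : ∀ {X Y Z} (c : k) (f : Hom X Y) (g : Hom Y Z), comp (c • f) g = c • comp f g
  comp_smul : ∀ {X Y Z} (c : k) (f : Hom X Y) (g : Hom Y Z), comp f (c • g) = c • comp f g
  of_comp : ∀ {X Y Z : M.carrier} (f : X ⟶ Y) (g : Y ⟶ Z), of (f ≫ g) = comp (of f) (of g)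
  of_add : ∀ {X Y : M.carrier} (f g : X ⟶ Y), of (f + g) = of f + of g
  of_smul : ∀ {X Y : M.carrier} (c : k) (f : X ⟶ Y), of (c • f) = c • of f
  act_of : ∀ (b : B) {X Y : M.carrier} (f : X ⟶ Y), act b (of f) = of (b ⊴ₗ f)
  act_comp : ∀ (b : B) {X Y Z} (f : Hom X Y) (g : Hom Y Z),
    act b (comp f g) = comp (act b f) (act b g)
  act_add : ∀ (b : B) {X Y} (f g : Hom X Y), act b (f + g) = act b f + act b g
  act_smul : ∀ (b : B) {X Y} (c : k) (f : Hom X Y), act b (c • f) = c • act b f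
  -- The morphisms of `B`, the associators and the unitors act through `M`. The last three axioms
  -- ask that they stay natural with respect to the new morphisms.
  act_exchange : ∀ {b b' : B} (f : b ⟶ b') {X Y} (g : Hom X Y),
    comp (act b g) (of (f ⊵ₗ Y)) = comp (of (f ⊵ₗ X)) (act b' g)
  act_tensor : ∀ (b b' : B) {X Y} (f : Hom X Y),
    comp (act (b ⊗ b') f) (of (αₗ b b' Y).hom) = comp (of (αₗ b b' X).hom) (act b (act b' f))
  act_unit : ∀ {X Y} (f : Hom X Y),
    comp (act (𝟙_ B) f) (of (λₗ Y).hom) = comp (of (λₗ X).hom) f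

namespace Extension

attribute [instance] addCommGroup module

variable {M : Birep.{u, v, w} k B} (E : Extension.{u, v, w, v', w', v₁} M)

/-- The objects of the extended birepresentation. -/
structure Obj (E : Extension.{u, v, w, v', w', v₁} M) where
  base : M.carrier

instance : Category.{v₁} E.Obj where
  Hom X Y := E.Hom X.base Y.base
  id X := E.of (𝟙 X.base)
  comp f g := E.comp f g
  id_comp := E.id_comp
  comp_id := E.comp_id
  assoc := E.comp_assoc

instance : Preadditive E.Obj where
  homGroup X Y := E.addCommGroup X.base Y.base
  add_comp _ _ _ := E.add_comp
  comp_add _ _ _ := E.comp_add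

instance : Linear k E.Obj where
  homModule X Y := E.module X.base Y.base
  smul_comp _ _ _ := E.smul_comp
  comp_smul _ _ _ f c g := E.comp_smul c f g

/-- The functor from the old category to the new one. -/
def toFunctor : M.carrier ⥤ E.Obj where
  obj X := ⟨X⟩
  map f := E.of f
  map_id _ := rfl
  map_comp := E.of_comp

instance : E.toFunctor.Additive := ⟨fun {_ _ f g} => E.of_add f g⟩

instance : E.toFunctor.Linear k := ⟨fun f c => E.of_smul c f⟩

instance : MonoidalLeftActionStruct B E.Obj where
  actionObj b X := ⟨b ⊙ₗ X.base⟩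
  actionHomLeft f X := E.of (f ⊵ₗ X.base)
  actionHomRight b _ _ g := E.act b g
  actionHom {_ b' X _} f g := E.comp (E.of (f ⊵ₗ X.base)) (E.act b' g)
  actionAssocIso b b' X := E.toFunctor.mapIso (αₗ b b' X.base)
  actionUnitIso X := E.toFunctor.mapIso (λₗ X.base)

/-- The coherence axioms only involve images under `of` and are inherited from `M`. New input is
needed only where a new morphism occurs: functoriality uses `act_exchange`, and naturality of the
associator and of the unitor uses `act_tensor` and `act_unit`. -/
instance : MonoidalLeftAction B E.Obj where
  actionHom_def f g := rfl
  actionHomRight_id b X := (E.act_of b _).trans (congrArg E.of (actionHomRight_id b X.base))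
  id_actionHomLeft b X := congrArg E.of (id_actionHomLeft b X.base)
  actionHom_comp f f' g g' := by
    change E.comp (E.of _) (E.act _ (E.comp _ _)) =
      E.comp (E.comp (E.of _) (E.act _ _)) (E.comp (E.of _) (E.act _ _))
    rw [comp_actionHomLeft, E.act_comp, E.of_comp, E.comp_assoc, E.comp_assoc,
      ← E.comp_assoc (E.act _ g), E.act_exchange, E.comp_assoc]
  actionAssocIso_hom_naturality {b₁ b₂ b₃ b₄ X Y} f g h := by
    change E.comp (E.comp (E.of _) (E.act _ _)) (E.of (αₗ _ _ Y.base).hom) =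
      E.comp (E.of (αₗ _ _ X.base).hom)
        (E.comp (E.of _) (E.act _ (E.comp (E.of _) (E.act _ h))))
    rw [E.comp_assoc, E.act_tensor, E.act_comp, E.act_of, ← E.comp_assoc (E.of (f ⊵ₗ _)),
      ← E.of_comp, ← E.comp_assoc, ← E.comp_assoc, ← E.of_comp, ← E.of_comp]
    congr 2
    have : (f ⊗ₘ g) ⊵ₗ X.base ≫ (αₗ b₂ b₄ X.base).hom =
        (αₗ b₁ b₃ X.base).hom ≫ f ⊵ₗ (b₃ ⊙ₗ X.base) ≫ b₂ ⊴ₗ g ⊵ₗ X.base := by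
      simpa [actionHom_def] using actionAssocIso_hom_naturality f g (𝟙 X.base)
    exact this
  actionUnitIso_hom_naturality f := (E.act_unit f).symm
  whiskerLeft_actionHomLeft b _ _ f X := by
    change E.of _ = E.comp (E.of _) (E.comp (E.act _ (E.of _)) (E.of _))
    rw [E.act_of, ← E.of_comp, ← E.of_comp, whiskerLeft_actionHomLeft]
  whiskerRight_actionHomLeft b f X := by
    change E.of _ = E.comp (E.of _) (E.comp (E.of _) (E.of _))
    rw [← E.of_comp, ← E.of_comp]
    exact congrArg E.of (whiskerRight_actionHomLeft b f X.base)
  associator_actionHom b c d X := by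
    change E.comp (E.of _) (E.comp (E.of _) (E.act _ (E.of _))) = E.comp (E.of _) (E.of _)
    rw [E.act_of, ← E.of_comp, ← E.of_comp, ← E.of_comp]
    exact congrArg E.of (associator_actionHom b c d X.base)
  leftUnitor_actionHom b X := by
    change E.of _ = E.comp (E.of _) (E.of _)
    rw [← E.of_comp]
    exact congrArg E.of (leftUnitor_actionHom b X.base)
  rightUnitor_actionHom b X := by
    change E.of _ = E.comp (E.of _) (E.act _ (E.of _))
    rw [E.act_of, ← E.of_comp]
    exact congrArg E.of (rightUnitor_actionHom b X.base)

/-- The extended birepresentation. -/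
def birep : Birep.{u, v₁, w} k B where
  carrier := E.Obj
  actL_add f g X := (congrArg E.of (M.actL_add f g X.base)).trans (E.of_add _ _)
  actL_smul c f X := (congrArg E.of (M.actL_smul c f X.base)).trans (E.of_smul _ _)
  actR_add b _ _ f g := E.act_add b f g
  actR_smul b _ _ c f := E.act_smul b c f

/-- The strong transformation from a birepresentation to its extension. -/
def incl : StrongTrans M E.birep where
  functor := E.toFunctor
  additive := inferInstanceAs E.toFunctor.Additive
  linear := inferInstanceAs (E.toFunctor.Linear k)
  leftLinear := mkLeftLinear (D' := E.Obj) E.toFunctor (fun b X => Iso.refl (b ⊙ₗ E.toFunctor.obj X))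
    (fun f X => (Category.comp_id _).trans (Category.id_comp _).symm)
    (fun b _ _ f => (E.comp_id _).trans ((E.act_of b f).trans (E.id_comp _).symm))
    (fun b b' X => by
      have : b ⊴ₗ (𝟙 (b' ⊙ₗ E.toFunctor.obj X)) = 𝟙 (b ⊙ₗ b' ⊙ₗ E.toFunctor.obj X) :=
        actionHomRight_id b _
      simp only [Iso.refl_hom]
      erw [this, Category.comp_id, Category.comp_id, Category.id_comp]
      rfl)
    (fun X => (Category.id_comp _).symm)

theorem mu_comp_incl {L : Birep.{u, v₂, w₂} k B} (F : StrongTrans L M) (b : B) (X : L.carrier) :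
    μₗ (StrongTrans.comp F E.incl).functor b X = E.of (μₗ F.functor b X) :=
  E.id_comp _

variable {R : Birep.{u, v₂, w₂} k B}

/-- A strong transformation out of an extension of `M`, from a strong transformation out of `M` and
its values on the new morphisms. -/
def desc (Φ : StrongTrans M R)
    (map : ∀ {X Y : M.carrier}, E.Hom X Y → (Φ.functor.obj X ⟶ Φ.functor.obj Y))
    (map_of : ∀ {X Y : M.carrier} (f : X ⟶ Y), map (E.of f) = Φ.functor.map f)
    (map_comp : ∀ {X Y Z : M.carrier} (f : E.Hom X Y) (g : E.Hom Y Z),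
      map (E.comp f g) = map f ≫ map g)
    (map_add : ∀ {X Y : M.carrier} (f g : E.Hom X Y), map (f + g) = map f + map g)
    (map_smul : ∀ {X Y : M.carrier} (c : k) (f : E.Hom X Y), map (c • f) = c • map f)
    (map_act : ∀ (b : B) {X Y : M.carrier} (f : E.Hom X Y),
      Φ.mu b X ≫ map (E.act b f) = b ⊴ₗ map f ≫ Φ.mu b Y) :
    StrongTrans E.birep R :=
  letI F : E.Obj ⥤ R.carrier :=
    { obj := fun X => Φ.functor.obj X.base
      map := fun f => map f
      map_id := fun _ => (map_of _).trans (Φ.functor.map_id _)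
      map_comp := map_comp }
  { functor := F
    additive := ⟨fun {_ _ f g} => map_add f g⟩
    linear := ⟨fun f c => map_smul c f⟩
    leftLinear := mkLeftLinear (D := E.Obj) F (fun b X => μₗIso Φ.functor b X.base)
      (fun f X => (μₗ_naturality_left Φ.functor f X.base).trans
        (congrArg (fun g => μₗ Φ.functor _ _ ≫ g) (map_of _).symm))
      (fun b _ _ f => (map_act b f).symm)
      (fun b b' X => (congrArg (fun g => μₗ Φ.functor _ _ ≫ g) (map_of _)).trans
        (μₗ_associativity Φ.functor b b' X.base))
      (fun X => (μₗ_unitality Φ.functor X.base).trans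
        (congrArg (fun g => μₗ Φ.functor _ _ ≫ g) (map_of _).symm)) }

theorem comp_incl_mu (H : StrongTrans E.birep R) (b : B) (X : M.carrier) :
    μₗ (StrongTrans.comp E.incl H).functor b X = μₗ H.functor b (E.toFunctor.obj X) :=
  (congrArg (fun g => μₗ H.functor b (E.toFunctor.obj X) ≫ g) (H.functor.map_id _)).trans
    (Category.comp_id _)

/-- The values of a strong transformation at the new morphisms. -/
def mapHom (H : StrongTrans E.birep R) {X Y : M.carrier} (f : E.Hom X Y) :
    (StrongTrans.comp E.incl H).functor.obj X ⟶ (StrongTrans.comp E.incl H).functor.obj Y :=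
  H.functor.map (X := E.toFunctor.obj X) (Y := E.toFunctor.obj Y) f

section

variable (H : StrongTrans E.birep R) {X Y Z : M.carrier}

theorem mapHom_comp (f : E.Hom X Y) (g : E.Hom Y Z) :
    E.mapHom H (E.comp f g) = E.mapHom H f ≫ E.mapHom H g :=
  H.functor.map_comp (X := E.toFunctor.obj X) (Y := E.toFunctor.obj Y) (Z := E.toFunctor.obj Z) f g

theorem mapHom_add (f g : E.Hom X Y) :
    E.mapHom H (f + g) = E.mapHom H f + E.mapHom H g :=
  H.functor.map_add (X := E.toFunctor.obj X) (Y := E.toFunctor.obj Y) (f := f) (g := g)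

theorem mapHom_smul (c : k) (f : E.Hom X Y) : E.mapHom H (c • f) = c • E.mapHom H f :=
  H.functor.map_smul (X := E.toFunctor.obj X) (Y := E.toFunctor.obj Y) c f

theorem mapHom_act (b : B) (f : E.Hom X Y) :
    μₗ (StrongTrans.comp E.incl H).functor b X ≫ E.mapHom H (E.act b f) =
      b ⊴ₗ E.mapHom H f ≫ μₗ (StrongTrans.comp E.incl H).functor b Y := by
  rw [comp_incl_mu, comp_incl_mu]
  exact (μₗ_naturality_right H.functor b (d := E.toFunctor.obj X) (d' := E.toFunctor.obj Y)
    f).symm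

end

section

variable {H H' : StrongTrans E.birep R}
  (α : StrongTrans.comp E.incl H ⟶ StrongTrans.comp E.incl H') {X Y Z : M.carrier}

/-- A modification between the restrictions of two strong transformations is natural at a new
morphism. -/
def NaturalAt (f : E.Hom X Y) : Prop :=
  E.mapHom H f ≫ (Modification.nat α).app Y = (Modification.nat α).app X ≫ E.mapHom H' f

variable {E α}

/-- Naturality passes through each constructor of terms; these closure properties are the inductive
steps of `Models.natural_of_gen`. -/
theorem NaturalAt.comp {f : E.Hom X Y} {g : E.Hom Y Z} (hf : E.NaturalAt α f)
    (hg : E.NaturalAt α g) : E.NaturalAt α (E.comp f g) := by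
  unfold NaturalAt at *
  rw [mapHom_comp, mapHom_comp, Category.assoc, hg, reassoc_of% hf]

theorem NaturalAt.add {f g : E.Hom X Y} (hf : E.NaturalAt α f) (hg : E.NaturalAt α g) :
    E.NaturalAt α (f + g) := by
  unfold NaturalAt at *
  rw [mapHom_add, mapHom_add, Preadditive.add_comp, Preadditive.comp_add, hf, hg]

theorem NaturalAt.smul (c : k) {f : E.Hom X Y} (hf : E.NaturalAt α f) :
    E.NaturalAt α (c • f) := by
  unfold NaturalAt at *
  rw [mapHom_smul, mapHom_smul, Linear.smul_comp, Linear.comp_smul, hf]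

/-- Acting by `b` on a commuting square gives a commuting square, and the modification axiom
identifies its sides with the required ones once the invertible structure morphism is cancelled. -/
theorem NaturalAt.act (b : B) {f : E.Hom X Y} (hf : E.NaturalAt α f) :
    E.NaturalAt α (E.act b f) := by
  unfold NaturalAt at *
  rw [← cancel_epi (μₗIso (StrongTrans.comp E.incl H).functor b X).hom]
  change μₗ _ b X ≫ _ = μₗ _ b X ≫ _
  have h := Modification.comm α b X
  rw [← Category.assoc, mapHom_act, Category.assoc, Modification.comm α, reassoc_of% h,
    mapHom_act, ← actionHomRight_comp_assoc, hf, actionHomRight_comp_assoc]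

end

/-- A modification between strong transformations out of an extension, from its restriction. -/
def modificationMk {H H' : StrongTrans E.birep R}
    (α : StrongTrans.comp E.incl H ⟶ StrongTrans.comp E.incl H')
    (h : ∀ {X Y : M.carrier} (f : E.Hom X Y), E.NaturalAt α f) : H ⟶ H' where
  nat := { app := fun X => (Modification.nat α).app X.base, naturality := fun _ _ f => h f }
  comm b X := by
    have := Modification.comm α b X.base
    rw [comp_incl_mu, comp_incl_mu] at this
    exact this

theorem whiskerLeft_modificationMk {H H' : StrongTrans E.birep R}
    (α : StrongTrans.comp E.incl H ⟶ StrongTrans.comp E.incl H')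
    (h : ∀ {X Y : M.carrier} (f : E.Hom X Y), E.NaturalAt α f) :
    StrongTrans.whiskerLeft E.incl (E.modificationMk α h) = α := rfl

/-- The objects of the extension are those of `M`, so restriction along `incl` retains every
component. -/
theorem modification_ext {H H' : StrongTrans E.birep R} {α β : H ⟶ H'}
    (h : StrongTrans.whiskerLeft E.incl α = StrongTrans.whiskerLeft E.incl β) : α = β := by
  ext X
  exact congrArg (fun γ => (Modification.nat γ).app X.base) h

/-- The restriction of a strong transformation out of an extension. -/
def inclDesc (Φ : StrongTrans M R)
    (map : ∀ {X Y : M.carrier}, E.Hom X Y → (Φ.functor.obj X ⟶ Φ.functor.obj Y))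
    (map_of : ∀ {X Y : M.carrier} (f : X ⟶ Y), map (E.of f) = Φ.functor.map f)
    (map_comp : ∀ {X Y Z : M.carrier} (f : E.Hom X Y) (g : E.Hom Y Z),
      map (E.comp f g) = map f ≫ map g)
    (map_add : ∀ {X Y : M.carrier} (f g : E.Hom X Y), map (f + g) = map f + map g)
    (map_smul : ∀ {X Y : M.carrier} (c : k) (f : E.Hom X Y), map (c • f) = c • map f)
    (map_act : ∀ (b : B) {X Y : M.carrier} (f : E.Hom X Y),
      Φ.mu b X ≫ map (E.act b f) = b ⊴ₗ map f ≫ Φ.mu b Y) :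
    StrongTrans.comp E.incl (E.desc Φ map map_of map_comp map_add map_smul map_act) ≅ Φ :=
  StrongTrans.mkIso (NatIso.ofComponents (fun X => Iso.refl (Φ.functor.obj X)) (fun f =>
    (Category.comp_id (map (E.of f))).trans
      ((map_of f).trans (Category.id_comp (Φ.functor.map f)).symm)))
    (fun b X => by
      rw [comp_incl_mu]
      refine (Category.comp_id (μₗ Φ.functor b X)).trans ?_
      have := actionHomRight_id b (Φ.functor.obj X)
      exact ((congrArg (· ≫ μₗ Φ.functor b X) this).trans (Category.id_comp _)).symm)

end Extension

end Extension

/-! ### Birepresentations given by generators and semantic relations -/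

section Presentation

open MonoidalLeftAction Functor.LaxLeftLinear Functor.OplaxLeftLinear Functor.LeftLinear

variable {k : Type u} [Field k] {B : Type w'} [Category.{v'} B] [MonoidalCategory B]
  [Preadditive B] [Linear k B]

universe v₁ w₁ v₂ w₂ g t

/-- The terms built from the morphisms of a birepresentation and from additional generators. -/
inductive Term (M : Birep.{u, v, w} k B) (Γ : M.carrier → M.carrier → Type g) :
    M.carrier → M.carrier → Type (max u v w w' g)
  | of {X Y : M.carrier} (f : X ⟶ Y) : Term M Γ X Y
  | gen {X Y : M.carrier} (x : Γ X Y) : Term M Γ X Y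
  | comp {X Y Z : M.carrier} (s : Term M Γ X Y) (t : Term M Γ Y Z) : Term M Γ X Z
  | add {X Y : M.carrier} (s t : Term M Γ X Y) : Term M Γ X Y
  | smul {X Y : M.carrier} (c : k) (t : Term M Γ X Y) : Term M Γ X Y
  | act (b : B) {X Y : M.carrier} (t : Term M Γ X Y) : Term M Γ (b ⊙ₗ X) (b ⊙ₗ Y)

/-- The value of a term under a strong transformation with values for the generators. -/
def Term.eval {M : Birep.{u, v, w} k B} {Γ : M.carrier → M.carrier → Type g}
    {R : Birep.{u, v₂, w₂} k B} (Φ : StrongTrans M R)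
    (γ : ∀ {X Y : M.carrier}, Γ X Y → (Φ.functor.obj X ⟶ Φ.functor.obj Y)) :
    ∀ {X Y : M.carrier}, Term M Γ X Y → (Φ.functor.obj X ⟶ Φ.functor.obj Y)
  | _, _, of f => Φ.functor.map f
  | _, _, gen x => γ x
  | _, _, comp s t => eval Φ γ s ≫ eval Φ γ t
  | _, _, add s t => eval Φ γ s + eval Φ γ t
  | _, _, smul c t => c • eval Φ γ t
  | _, _, act b t => Φ.conj b (eval Φ γ t)

/-- A family of strong transformations out of `M`, each with values for the generators. -/
structure Models (M : Birep.{u, v, w} k B) (Γ : M.carrier → M.carrier → Type g) where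
  Index : Type t
  birep : Index → Birep.{u, v₂, w₂} k B
  trans : ∀ i, StrongTrans M (birep i)
  val : ∀ i {X Y : M.carrier}, Γ X Y → ((trans i).functor.obj X ⟶ (trans i).functor.obj Y)

namespace Models

variable {M : Birep.{u, v, w} k B} {Γ : M.carrier → M.carrier → Type g}
  (K : Models.{u, v, w, v', w', v₂, w₂, g, t} M Γ)

/-- Two terms are equivalent if they have equal values in all models. -/
def setoid (X Y : M.carrier) : Setoid (Term M Γ X Y) where
  r s t := ∀ i, s.eval (K.trans i) (K.val i) = t.eval (K.trans i) (K.val i)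
  iseqv := ⟨fun _ _ => rfl, fun h i => (h i).symm, fun h h' i => (h i).trans (h' i)⟩

/-- Terms modulo equality in all models. -/
def Hom (X Y : M.carrier) : Type (max u v w w' g) := Quotient (K.setoid X Y)

variable {K} {X Y Z : M.carrier}

/-- The class of a term. -/
def Hom.mk (t : Term M Γ X Y) : K.Hom X Y := Quotient.mk (K.setoid X Y) t

/-- The value of a class of terms in a model. -/
def Hom.eval (i : K.Index) : K.Hom X Y →
    ((K.trans i).functor.obj X ⟶ (K.trans i).functor.obj Y) :=
  Quotient.lift (fun t => t.eval (K.trans i) (K.val i)) (fun _ _ h => h i)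

/-- Equality of classes is tested in the models. Hence each axiom below reduces to the same identity
in an honest birepresentation, and no list of relations ever has to be written down. -/
theorem Hom.ext {f g : K.Hom X Y} (h : ∀ i, f.eval i = g.eval i) : f = g := by
  induction f using Quotient.inductionOn with | h s
  induction g using Quotient.inductionOn with | h t
  exact Quotient.sound h

/-- Composition of classes of terms. -/
def Hom.comp : K.Hom X Y → K.Hom Y Z → K.Hom X Z :=
  Quotient.map₂ Term.comp (fun _ _ h _ _ h' i => congrArg₂ (· ≫ ·) (h i) (h' i))

/-- The action on classes of terms. -/
def Hom.act (b : B) : K.Hom X Y → K.Hom (b ⊙ₗ X) (b ⊙ₗ Y) :=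
  Quotient.map (Term.act b) (fun _ _ h i =>
    congrArg ((K.trans i).conj b) (h i))

instance : Add (K.Hom X Y) :=
  ⟨Quotient.map₂ Term.add (fun _ _ h _ _ h' i => congrArg₂ (· + ·) (h i) (h' i))⟩

instance : SMul k (K.Hom X Y) :=
  ⟨fun c => Quotient.map (Term.smul c) (fun _ _ h i => congrArg (c • ·) (h i))⟩

/-- Terms have no constructors for zero and negatives: zero comes from the zero morphism of `M`, and
negation is multiplication by `-1`. -/
instance : Zero (K.Hom X Y) := ⟨Hom.mk (.of 0)⟩

instance : Neg (K.Hom X Y) := ⟨fun f => (-1 : k) • f⟩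

@[simp]
theorem eval_of (i : K.Index) (f : X ⟶ Y) :
    Hom.eval i (Hom.mk (.of f) : K.Hom X Y) = (K.trans i).functor.map f := rfl

@[simp]
theorem eval_comp (i : K.Index) (f : K.Hom X Y) (g : K.Hom Y Z) :
    Hom.eval i (f.comp g) = f.eval i ≫ g.eval i := by
  induction f using Quotient.inductionOn
  induction g using Quotient.inductionOn
  rfl

@[simp]
theorem eval_add (i : K.Index) (f g : K.Hom X Y) :
    Hom.eval i (f + g) = f.eval i + g.eval i := by
  induction f using Quotient.inductionOn
  induction g using Quotient.inductionOn
  rfl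

@[simp]
theorem eval_smul (i : K.Index) (c : k) (f : K.Hom X Y) :
    Hom.eval i (c • f) = c • f.eval i := by
  induction f using Quotient.inductionOn
  rfl

@[simp]
theorem eval_zero (i : K.Index) : Hom.eval i (0 : K.Hom X Y) = 0 :=
  (K.trans i).functor.map_zero X Y

@[simp]
theorem eval_neg (i : K.Index) (f : K.Hom X Y) : Hom.eval i (-f) = -f.eval i :=
  (eval_smul i (-1) f).trans (by simp)

@[simp]
theorem eval_act (i : K.Index) (b : B) (f : K.Hom X Y) : Hom.eval i (f.act b) =
    (K.trans i).conj b (f.eval i) := by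
  induction f using Quotient.inductionOn
  rfl

instance : AddCommGroup (K.Hom X Y) where
  add_assoc f g h := Hom.ext fun i => by simp [add_assoc]
  zero_add f := Hom.ext fun i => by simp
  add_zero f := Hom.ext fun i => by simp
  add_comm f g := Hom.ext fun i => by simp [add_comm]
  neg_add_cancel f := Hom.ext fun i => by simp
  nsmul := nsmulRec
  zsmul := zsmulRec

instance : Module k (K.Hom X Y) where
  one_smul f := Hom.ext fun i => by simp
  mul_smul c d f := Hom.ext fun i => by simp [mul_smul]
  smul_zero c := Hom.ext fun i => by simp
  smul_add c f g := Hom.ext fun i => by simp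
  add_smul c d f := Hom.ext fun i => by simp [add_smul]
  zero_smul f := Hom.ext fun i => by simp

variable (K)

/-- The birepresentation generated by `M` and the additional generators, subject to the relations
valid in all models, as an extension of `M`. -/
def extension : Extension.{u, v, w, v', w', max u v w w' g} M where
  Hom := K.Hom
  of f := Hom.mk (.of f)
  comp := Hom.comp
  act b _ _ := Hom.act b
  id_comp f := Hom.ext fun i => by simp
  comp_id f := Hom.ext fun i => by simp
  comp_assoc f g h := Hom.ext fun i => by simp
  add_comp f f' g := Hom.ext fun i => by simp
  comp_add f g g' := Hom.ext fun i => by simp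
  smul_comp c f g := Hom.ext fun i => by simp
  comp_smul c f g := Hom.ext fun i => by simp
  of_comp f g := Hom.ext fun i => by simp
  of_add f g := Hom.ext fun i => by simp [Functor.map_add]
  of_smul c f := Hom.ext fun i => by simp [Functor.map_smul]
  act_of b X Y f := Hom.ext fun i => by simp [StrongTrans.conj_map]
  act_comp b X Y Z f g := Hom.ext fun i => by simp [StrongTrans.conj_comp]
  act_add b X Y f g := Hom.ext fun i => by simp [StrongTrans.conj_add]
  act_smul b X Y c f := Hom.ext fun i => by simp [StrongTrans.conj_smul]
  act_exchange f X Y g := Hom.ext fun i => by simp [StrongTrans.conj_exchange]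
  act_tensor b b' X Y f := Hom.ext fun i => by simp [StrongTrans.conj_tensor]
  act_unit f := Hom.ext fun i => by simp [StrongTrans.conj_unit]

variable {K} {R : Birep.{u, v₁, w₁} k B}

theorem model_map_act (i : K.Index) (b : B) (f : K.Hom X Y) :
    (K.trans i).mu b X ≫ (f.act b).eval i = b ⊴ₗ f.eval i ≫ (K.trans i).mu b Y := by
  rw [eval_act]
  exact StrongTrans.mu_conj _ _ _

/-- The strong transformation to a model. -/
def descModel (i : K.Index) : StrongTrans K.extension.birep (K.birep i) :=
  K.extension.desc (K.trans i) (Hom.eval i) (eval_of i) (eval_comp i) (eval_add i) (eval_smul i)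
    (fun b _ _ f => model_map_act i b f)

/-- The restriction of the strong transformation to a model. -/
def inclDescModel (i : K.Index) :
    StrongTrans.comp K.extension.incl (descModel i) ≅ K.trans i :=
  K.extension.inclDesc (K.trans i) (Hom.eval i) (eval_of i) (eval_comp i) (eval_add i)
    (eval_smul i) (fun b _ _ f => model_map_act i b f)

/-- Naturality with respect to the generators implies naturality with respect to all
morphisms. -/
theorem natural_of_gen {H H' : StrongTrans K.extension.birep R}
    (α : StrongTrans.comp K.extension.incl H ⟶ StrongTrans.comp K.extension.incl H')
    (h : ∀ {X Y : M.carrier} (x : Γ X Y), K.extension.NaturalAt α (Hom.mk (.gen x)))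
    (f : K.Hom X Y) : K.extension.NaturalAt α f := by
  induction f using Quotient.inductionOn with | h t
  induction t with
  | of f => exact (Modification.nat α).naturality f
  | gen x => exact h x
  | comp s t hs ht => exact hs.comp ht
  | add s t hs ht => exact hs.add ht
  | smul c t ht => exact ht.smul c
  | act b t ht => exact ht.act b

end Models

/-! ### Existence of coisoinserters -/

section Cone

universe v₃ w₃

variable {L : Birep.{u, v₃, w₃} k B} {M : Birep.{u, v, w} k B} {N : Birep.{u, v₁, w₁} k B}
  {R : Birep.{u, v₂, w₂} k B} {ι : Type} {F G : ι → StrongTrans L M}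

/-- An isomorphism of cones from its underlying invertible modification. -/
def IsoCone.mkIso {S T : IsoCone F G N} (e : S.trans ≅ T.trans)
    (h : ∀ i, (S.iso i).hom ≫ StrongTrans.whiskerLeft (G i) e.hom =
      StrongTrans.whiskerLeft (F i) e.hom ≫ (T.iso i).hom) : S ≅ T where
  hom := ⟨e.hom, h⟩
  inv := ⟨e.inv, fun i => by
    have h₁ : StrongTrans.whiskerLeft (F i) e.inv ≫ StrongTrans.whiskerLeft (F i) e.hom = 𝟙 _ := by
      rw [← StrongTrans.whiskerLeft_comp, e.inv_hom_id, StrongTrans.whiskerLeft_id]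
    have h₂ : StrongTrans.whiskerLeft (G i) e.hom ≫ StrongTrans.whiskerLeft (G i) e.inv = 𝟙 _ := by
      rw [← StrongTrans.whiskerLeft_comp, e.hom_inv_id, StrongTrans.whiskerLeft_id]
    calc _ = (StrongTrans.whiskerLeft (F i) e.inv ≫ StrongTrans.whiskerLeft (F i) e.hom) ≫
          (T.iso i).hom ≫ StrongTrans.whiskerLeft (G i) e.inv := by rw [h₁, Category.id_comp]
      _ = StrongTrans.whiskerLeft (F i) e.inv ≫ (S.iso i).hom ≫
          StrongTrans.whiskerLeft (G i) e.hom ≫ StrongTrans.whiskerLeft (G i) e.inv := by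
        rw [Category.assoc, ← Category.assoc _ _ (StrongTrans.whiskerLeft (G i) e.inv), ← h,
          Category.assoc]
      _ = _ := by rw [h₂, Category.comp_id]⟩
  hom_inv_id := IsoCone.Hom.ext e.hom_inv_id
  inv_hom_id := IsoCone.Hom.ext e.inv_hom_id

theorem IsoCone.postcomp_iso_hom_app (S : IsoCone F G N) (H : StrongTrans N R) (i : ι)
    (X : L.carrier) : (Modification.nat ((S.postcomp H).iso i).hom).app X =
      H.functor.map ((Modification.nat (S.iso i).hom).app X) := by
  simp [IsoCone.postcomp]

theorem IsoCone.Hom.comm_app {S T : IsoCone F G N} (f : S ⟶ T) (i : ι) (X : L.carrier) :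
    (Modification.nat (S.iso i).hom).app X ≫ (Modification.nat f.mod).app ((G i).functor.obj X) =
      (Modification.nat f.mod).app ((F i).functor.obj X) ≫
        (Modification.nat (T.iso i).hom).app X :=
  congrArg (fun α => (Modification.nat α).app X) (f.comm i)

end Cone

section Coisoinserter

universe v₃ w₃

variable {L : Birep.{u, v₃, w₃} k B} {M : Birep.{u, v, w} k B} {ι : Type}
  (F G : ι → StrongTrans L M)

/-- Generators for the morphisms of a coisoinserter. -/
inductive IsoGen : M.carrier → M.carrier → Type (max w₃ w)
  | hom (i : ι) (X : L.carrier) : IsoGen ((F i).functor.obj X) ((G i).functor.obj X)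
  | inv (i : ι) (X : L.carrier) : IsoGen ((G i).functor.obj X) ((F i).functor.obj X)

variable {F G}

/-- The values of the generators given by a cone. -/
def IsoCone.val {R : Birep.{u, v₂, w₂} k B} (T : IsoCone F G R) :
    ∀ {X Y : M.carrier}, IsoGen F G X Y → (T.trans.functor.obj X ⟶ T.trans.functor.obj Y)
  | _, _, .hom i X => (Modification.nat (T.iso i).hom).app X
  | _, _, .inv i X => (Modification.nat (T.iso i).inv).app X

variable (F G)

/-- All cones, with values in birepresentations of a given size. -/
def coneModels : Models.{u, v, w, v', w', v₂, w₂, max w₃ w} M (IsoGen F G) where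
  Index := Σ R : Birep.{u, v₂, w₂} k B, IsoCone F G R
  birep T := T.1
  trans T := T.2.trans
  val T := T.2.val

/-- The underlying birepresentation of the coisoinserter. -/
abbrev coisoinserter : Extension M := (coneModels.{u, v, w, v', w', v₂, w₂} F G).extension

/-- The universal cone. -/
def coisoinserterCone :
    IsoCone F G (coisoinserter.{u, v, w, v', w', v₂, w₂} F G).birep where
  trans := (coisoinserter F G).incl
  iso i := StrongTrans.mkIso
    (NatIso.ofComponents (fun X =>
      { hom := Models.Hom.mk (.gen (.hom i X))
        inv := Models.Hom.mk (.gen (.inv i X))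
        -- The relations between the formal components hold since they hold for the components of
        -- every cone `T`.
        hom_inv_id := Models.Hom.ext fun T =>
          ((StrongTrans.modEval X).mapIso (T.2.iso i)).hom_inv_id.trans
            (T.2.trans.functor.map_id _).symm
        inv_hom_id := Models.Hom.ext fun T =>
          ((StrongTrans.modEval X).mapIso (T.2.iso i)).inv_hom_id.trans
            (T.2.trans.functor.map_id _).symm })
      (fun {X Y} f => Models.Hom.ext fun T =>
        (Modification.nat (T.2.iso i).hom).naturality f))
    (fun b X => by
      rw [Extension.mu_comp_incl, Extension.mu_comp_incl]
      refine Models.Hom.ext fun T => ?_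
      have := Modification.comm (T.2.iso i).hom b X
      rw [StrongTrans.comp_mu, StrongTrans.comp_mu, Category.assoc] at this
      change T.2.trans.functor.map _ ≫ _ = T.2.trans.conj b _ ≫ T.2.trans.functor.map _
      rw [← cancel_epi (μₗIso T.2.trans.functor b _).hom]
      refine this.trans ?_
      rw [← Category.assoc]
      exact (congrArg (· ≫ _) (T.2.trans.mu_conj b _).symm).trans (Category.assoc _ _ _))

/-- At the generators `hom` this is the compatibility required of a morphism of cones; at the
generators `inv` it is the same square with two parallel isomorphisms inverted. -/
theorem naturalAt_gen {R : Birep.{u, v₂, w₂} k B}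
    {H H' : StrongTrans (coisoinserter.{u, v, w, v', w', v₁, w₁} F G).birep R}
    (f : (coisoinserterCone F G).postcomp H ⟶ (coisoinserterCone F G).postcomp H')
    {X Y : M.carrier} (x : IsoGen F G X Y) :
    Extension.NaturalAt _ f.mod (Models.Hom.mk (.gen x)) := by
  have h (i : ι) (X : L.carrier) := f.comm_app i X
  simp only [IsoCone.postcomp_iso_hom_app] at h
  cases x with
  | hom i X => exact h i X
  | inv i X =>
    exact ((Iso.inv_comp_eq (H.functor.mapIso ((StrongTrans.modEval X).mapIso
      ((coisoinserterCone F G).iso i)))).2 ((Category.assoc _ _ _).symm.trans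
        ((Iso.eq_comp_inv (H'.functor.mapIso ((StrongTrans.modEval X).mapIso
          ((coisoinserterCone F G).iso i)))).2 (h i X).symm).symm).symm)

/-- Each cone `T` is one of the models, so evaluation at `T` factors it. Full faithfulness holds
because objects are unchanged and naturality need only be tested on generators. The universe levels
are those for which the quotient of terms has the same size as the birepresentations serving as
models; the family of models may be large without enlarging this quotient. -/
theorem isCoisoinserter_coisoinserterCone :
    IsCoisoinserter (coisoinserterCone.{u, v, w, v', w', max u v w w' w₃, w} F G) := fun R =>
  { faithful := ⟨fun h => Extension.modification_ext _ (congrArg IsoCone.Hom.mod h)⟩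
    full := ⟨fun f => ⟨Extension.modificationMk _ f.mod
      (Models.natural_of_gen f.mod (naturalAt_gen F G f)),
        IsoCone.Hom.ext (Extension.whiskerLeft_modificationMk _ _ _)⟩⟩
    essSurj := ⟨fun T => ⟨Models.descModel (K := coneModels F G) ⟨R, T⟩,
      ⟨IsoCone.mkIso (Models.inclDescModel (K := coneModels F G) ⟨R, T⟩) (fun i => by
        ext X
        refine (congrArg (· ≫ _) (IsoCone.postcomp_iso_hom_app _ _ i X)).trans ?_
        exact (Category.comp_id ((Modification.nat (T.iso i).hom).app X)).trans
          (Category.id_comp ((Modification.nat (T.iso i).hom).app X)).symm)⟩⟩⟩ }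

end Coisoinserter

/-! ### Existence of coequifiers -/

section Coequifier

universe v₃ w₃

variable {L : Birep.{u, v₃, w₃} k B} {M : Birep.{u, v, w} k B} {ι : Type}
  {F G : ι → StrongTrans L M} (α β : ∀ i, F i ⟶ G i)

/-- All strong transformations which equify given pairs, with values in birepresentations of a
given size. -/
def equifyModels : Models.{u, v, w, v', w', v₂, w₂, 0} M (fun _ _ => PEmpty) where
  Index := Σ R : Birep.{u, v₂, w₂} k B, (equifies α β R).FullSubcategory
  birep T := T.1
  trans T := T.2.1
  val _ _ _ x := x.elim

/-- The underlying birepresentation of the coequifier. -/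
abbrev coequifier : Extension M := (equifyModels.{u, v, w, v', w', v₂, w₂} α β).extension

/-- The two components become equal classes since every model equifies them by definition. -/
theorem equifies_incl_coequifier :
    equifies α β _ (coequifier.{u, v, w, v', w', v₂, w₂} α β).incl := fun i => by
  ext X
  exact Models.Hom.ext fun T => congrArg (fun γ => (Modification.nat γ).app X) (T.2.2 i)

/-- The same argument as for coisoinserters: an equifying transformation is a model, hence factors
by evaluation. As there are no generators, naturality on `M` already implies naturality on the
quotient. -/
theorem isCoequifier_coequifier :
    IsCoequifier α β (coequifier.{u, v, w, v', w', max u v w w', w} α β).incl :=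
  ⟨equifies_incl_coequifier α β, fun R =>
  { faithful := ⟨fun h => Extension.modification_ext _
      (congrArg (equifies α β R).ι.map h)⟩
    full := ⟨fun f => ⟨Extension.modificationMk _ f.hom
      (Models.natural_of_gen f.hom (fun x => x.elim)),
        ObjectProperty.hom_ext _ (Extension.whiskerLeft_modificationMk _ _ _)⟩⟩
    essSurj := ⟨fun T => ⟨Models.descModel (K := equifyModels α β) ⟨R, T⟩,
      ⟨(equifies α β R).isoMk (Models.inclDescModel (K := equifyModels α β) ⟨R, T⟩)⟩⟩⟩ }⟩

end Coequifier

/-- The birepresentations associated to a partition exist. -/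
theorem nonempty_CWRData (k : Type u) [Field k] {n : ℕ} (P : StarPartition n) :
    Nonempty (CWRData k P) :=
  ⟨{ CW := _
     cone := coisoinserterCone _ _
     isCoisoinserter := isCoisoinserter_coisoinserterCone _ _
     CWR := _
     ΩR := _
     isCoequifier := isCoequifier_coequifier _ _ }⟩

end Presentation

/-! ### The birepresentation generated by a cone -/

section Generated

open MonoidalLeftAction Functor.LaxLeftLinear Functor.OplaxLeftLinear Functor.LeftLinear

variable {k : Type u} [Field k] {B : Type w'} [Category.{v'} B] [MonoidalCategory B]
  [Preadditive B] [Linear k B]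

universe v₁ w₁ v₂ w₂ v₃ w₃

variable {L : Birep.{u, v₃, w₃} k B} {M : Birep.{u, v, w} k B} {R : Birep.{u, v₂, w₂} k B}
  {ι : Type} {F G : ι → StrongTrans L M}

namespace IsoCone

/-- The natural isomorphism underlying an isomorphism of cones. -/
def natIso {S T : IsoCone F G R} (e : S ≅ T) : S.trans.functor ≅ T.trans.functor where
  hom := Modification.nat e.hom.mod
  inv := Modification.nat e.inv.mod
  hom_inv_id := congrArg (fun f => Modification.nat (IsoCone.Hom.mod f)) e.hom_inv_id
  inv_hom_id := congrArg (fun f => Modification.nat (IsoCone.Hom.mod f)) e.inv_hom_id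

/-- The invertible modification underlying an isomorphism of cones. -/
def transIso {S T : IsoCone F G R} (e : S ≅ T) : S.trans ≅ T.trans where
  hom := e.hom.mod
  inv := e.inv.mod
  hom_inv_id := congrArg IsoCone.Hom.mod e.hom_inv_id
  inv_hom_id := congrArg IsoCone.Hom.mod e.inv_hom_id

/-- The morphisms generated by the values of a cone. -/
inductive Generated (T : IsoCone F G R) : ∀ {X Y : M.carrier},
    (T.trans.functor.obj X ⟶ T.trans.functor.obj Y) → Prop
  | of {X Y : M.carrier} (f : X ⟶ Y) : T.Generated (T.trans.functor.map f)
  | hom (i : ι) (X : L.carrier) : T.Generated (X := (F i).functor.obj X)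
      (Y := (G i).functor.obj X) ((Modification.nat (T.iso i).hom).app X)
  | inv (i : ι) (X : L.carrier) : T.Generated (X := (G i).functor.obj X)
      (Y := (F i).functor.obj X) ((Modification.nat (T.iso i).inv).app X)
  | comp {X Y Z : M.carrier} {f : T.trans.functor.obj X ⟶ T.trans.functor.obj Y}
      {g : T.trans.functor.obj Y ⟶ T.trans.functor.obj Z} (hf : T.Generated f)
      (hg : T.Generated g) : T.Generated (f ≫ g)
  | add {X Y : M.carrier} {f g : T.trans.functor.obj X ⟶ T.trans.functor.obj Y}
      (hf : T.Generated f) (hg : T.Generated g) : T.Generated (f + g)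
  | smul (c : k) {X Y : M.carrier} {f : T.trans.functor.obj X ⟶ T.trans.functor.obj Y}
      (hf : T.Generated f) : T.Generated (c • f)

variable (T : IsoCone F G R)

/-- The modification axiom for `e`, with the invertible structure morphism of `Φ` cancelled. -/
theorem map_mu_nat_app {F G : StrongTrans L M} {Φ : StrongTrans M R}
    (e : StrongTrans.comp F Φ ⟶ StrongTrans.comp G Φ) (b : B) (X : L.carrier) :
    Φ.functor.map (μₗ F.functor b X) ≫ (Modification.nat e).app (b ⊙ₗ X) =
      Φ.conj b (X := F.functor.obj X) (Y := G.functor.obj X) ((Modification.nat e).app X) ≫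
        Φ.functor.map (μₗ G.functor b X) := by
  have h := Modification.comm e b X
  rw [StrongTrans.comp_mu, StrongTrans.comp_mu, Category.assoc] at h
  rw [← cancel_epi (μₗIso Φ.functor b _).hom]
  refine h.trans ?_
  rw [← Category.assoc, ← Category.assoc]
  exact congrArg (· ≫ _) (Φ.mu_conj b _).symm

theorem conj_nat_app {F G : StrongTrans L M} {Φ : StrongTrans M R}
    (e : StrongTrans.comp F Φ ⟶ StrongTrans.comp G Φ) (b : B) (X : L.carrier) :
    Φ.conj b (X := F.functor.obj X) (Y := G.functor.obj X) ((Modification.nat e).app X) =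
      Φ.functor.map (μₗ F.functor b X) ≫ (Modification.nat e).app (b ⊙ₗ X) ≫
        Φ.functor.map (δₗ G.functor b X) := by
  have h : Φ.functor.map (μₗ G.functor b X) ≫ Φ.functor.map (δₗ G.functor b X) = 𝟙 _ := by
    rw [← Φ.functor.map_comp, μₗ_comp_δₗ, Φ.functor.map_id]
  rw [← Category.assoc, map_mu_nat_app, Category.assoc, h, Category.comp_id]

/-- The action of `b` on the component of a cone at `X` is, up to images of morphisms of `M`, its
component at `b ⊙ X`. This is why `Generated` needs no constructor for the action, and why only sums
of composites have to be controlled later. -/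
theorem Generated.conj {T : IsoCone F G R} (b : B) {X Y : M.carrier}
    {f : T.trans.functor.obj X ⟶ T.trans.functor.obj Y} (hf : T.Generated f) :
    T.Generated (T.trans.conj b f) := by
  induction hf with
  | of f => rw [StrongTrans.conj_map]; exact .of _
  | hom i X =>
    rw [conj_nat_app]
    exact .comp (.of _) (.comp (.hom i (b ⊙ₗ X)) (.of _))
  | inv i X =>
    rw [conj_nat_app]
    exact .comp (.of _) (.comp (.inv i (b ⊙ₗ X)) (.of _))
  | comp _ _ hf hg => rw [StrongTrans.conj_comp]; exact .comp hf hg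
  | add _ _ hf hg => rw [StrongTrans.conj_add]; exact .add hf hg
  | smul c _ hf => rw [StrongTrans.conj_smul]; exact .smul c hf

/-- The submodule of generated morphisms. -/
def generatedSubmodule (X Y : M.carrier) :
    Submodule k (T.trans.functor.obj X ⟶ T.trans.functor.obj Y) where
  carrier := {f | T.Generated f}
  zero_mem' := by
    have := Generated.of (T := T) (0 : X ⟶ Y)
    rwa [Functor.map_zero] at this
  add_mem' := .add
  smul_mem' c _ := .smul c

/-- The extension by the generated morphisms. -/
def generated : Extension M where
  Hom X Y := T.generatedSubmodule X Y
  of f := ⟨T.trans.functor.map f, .of f⟩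
  comp f g := ⟨f.1 ≫ g.1, .comp f.2 g.2⟩
  act b _ _ f := ⟨T.trans.conj b f.1, f.2.conj b⟩
  id_comp f := Subtype.ext (by simp)
  comp_id f := Subtype.ext (by simp)
  comp_assoc f g h := Subtype.ext (by simp)
  add_comp f f' g := Subtype.ext (by simp)
  comp_add f g g' := Subtype.ext (by simp)
  smul_comp c f g := Subtype.ext (by simp)
  comp_smul c f g := Subtype.ext (by simp)
  of_comp f g := Subtype.ext (by simp)
  of_add f g := Subtype.ext (Functor.map_add _)
  of_smul c f := Subtype.ext (Functor.map_smul _ c f)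
  act_of b X Y f := Subtype.ext (T.trans.conj_map b f)
  act_comp b X Y Z f g := Subtype.ext (T.trans.conj_comp b f.1 g.1)
  act_add b X Y f g := Subtype.ext (T.trans.conj_add b f.1 g.1)
  act_smul b X Y c f := Subtype.ext (T.trans.conj_smul b c f.1)
  act_exchange f X Y g := Subtype.ext (T.trans.conj_exchange f g.1)
  act_tensor b b' X Y f := Subtype.ext (T.trans.conj_tensor b b' f.1)
  act_unit f := Subtype.ext (T.trans.conj_unit f.1)

/-- The inclusion of the birepresentation with the generated morphisms. -/
def generatedIncl : StrongTrans T.generated.birep R :=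
  T.generated.desc T.trans Subtype.val (fun _ => rfl) (fun _ _ => rfl) (fun _ _ => rfl)
    (fun _ _ => rfl) (fun b _ _ f => T.trans.mu_conj b f.1)

/-- A cone factors over the birepresentation with the generated morphisms. -/
def inclGeneratedIncl : StrongTrans.comp T.generated.incl T.generatedIncl ≅ T.trans :=
  T.generated.inclDesc T.trans Subtype.val (fun _ => rfl) (fun _ _ => rfl) (fun _ _ => rfl)
    (fun _ _ => rfl) (fun b _ _ f => T.trans.mu_conj b f.1)

/-- The cone with values in the birepresentation with the generated morphisms. -/
def generatedCone : IsoCone F G T.generated.birep where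
  trans := T.generated.incl
  iso i := StrongTrans.mkIso
    (NatIso.ofComponents (fun X =>
      { hom := ⟨(Modification.nat (T.iso i).hom).app X, .hom i X⟩
        inv := ⟨(Modification.nat (T.iso i).inv).app X, .inv i X⟩
        hom_inv_id := Subtype.ext (((StrongTrans.modEval X).mapIso (T.iso i)).hom_inv_id.trans
          (T.trans.functor.map_id _).symm)
        inv_hom_id := Subtype.ext (((StrongTrans.modEval X).mapIso (T.iso i)).inv_hom_id.trans
          (T.trans.functor.map_id _).symm) })
      (fun {X Y} f => Subtype.ext ((Modification.nat (T.iso i).hom).naturality f)))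
    (fun b X => by
      rw [Extension.mu_comp_incl, Extension.mu_comp_incl]
      exact Subtype.ext (map_mu_nat_app (T.iso i).hom b X))

end IsoCone

variable (R) in
/-- The identity strong transformation. -/
def StrongTrans.id : StrongTrans R R where
  functor := 𝟭 R.carrier
  leftLinear := mkLeftLinear (𝟭 R.carrier) (fun _ _ => Iso.refl _) (fun _ _ => by simp)
    (fun _ _ _ _ => by simp) (fun _ _ _ => by simp) (fun _ => by simp)

/-- The identity strong transformation is a right unit. -/
def StrongTrans.compId (F : StrongTrans M R) : StrongTrans.comp F (StrongTrans.id R) ≅ F :=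
  StrongTrans.mkIso (Functor.rightUnitor F.functor) (fun b X => by
    rw [StrongTrans.comp_mu]
    change (𝟙 _ ≫ μₗ F.functor b X) ≫ 𝟙 _ = b ⊴ₗ 𝟙 _ ≫ _
    rw [actionHomRight_id]
    simp)

end Generated

/-! ### Natural families of morphisms over an ideal -/

section Ideal

open MonoidalLeftAction Functor.LaxLeftLinear Functor.OplaxLeftLinear Functor.LeftLinear

variable {k : Type u} [Field k] {B : Type w'} [Category.{v'} B] [MonoidalCategory B]
  [Preadditive B] [Linear k B]

variable (M : Birep.{u, v, w} k B) (I : ObjectProperty B)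

/-- The families of morphisms `N ⊙ X ⟶ N ⊙ Y`, natural in the object `N` of `I`. -/
def naturalFamilies (X Y : M.carrier) :
    Submodule k (∀ N : I.FullSubcategory, N.obj ⊙ₗ X ⟶ N.obj ⊙ₗ Y) where
  carrier := {g | ∀ (N N' : I.FullSubcategory) (f : N.obj ⟶ N'.obj),
    g N ≫ f ⊵ₗ Y = f ⊵ₗ X ≫ g N'}
  zero_mem' _ _ _ := by simp
  add_mem' hg hg' _ _ f := by simp [hg _ _ f, hg' _ _ f]
  smul_mem' c _ hg _ _ f := by simp [hg _ _ f]

/-- The extension of `M` by natural families over a right ideal `I`. -/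
def idealExtension (hI : ∀ N b, I N → I (N ⊗ b)) : Extension M where
  Hom X Y := naturalFamilies M I X Y
  of f := ⟨fun N => N.obj ⊴ₗ f, fun _ _ _ => action_exchange _ _⟩
  comp f g := ⟨fun N => f.1 N ≫ g.1 N, fun _ _ h => by
    simp only [Category.assoc]
    rw [g.2, reassoc_of% f.2 _ _ h]⟩
  -- An object `b` acts on a family by reindexing along `N ↦ N ⊗ b`; this is the use of the ideal
  -- property.
  act b X Y f := ⟨fun N => (αₗ N.obj b X).inv ≫ f.1 ⟨N.obj ⊗ b, hI _ b N.2⟩ ≫ (αₗ N.obj b Y).hom,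
    fun N N' h => by
      have := f.2 ⟨N.obj ⊗ b, hI _ b N.2⟩ ⟨N'.obj ⊗ b, hI _ b N'.2⟩ (h ▷ b)
      rw [whiskerRight_actionHomLeft, whiskerRight_actionHomLeft] at this
      simp only [Category.assoc]
      rw [Iso.inv_comp_eq]
      simpa using this =≫ (αₗ _ _ _).hom⟩
  id_comp f := Subtype.ext (by ext N; simp)
  comp_id f := Subtype.ext (by ext N; simp)
  comp_assoc f g h := Subtype.ext (by ext N; simp)
  add_comp f f' g := Subtype.ext (by ext N; simp)
  comp_add f g g' := Subtype.ext (by ext N; simp)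
  smul_comp c f g := Subtype.ext (by ext N; simp)
  comp_smul c f g := Subtype.ext (by ext N; simp)
  of_comp f g := Subtype.ext (by ext N; simp)
  of_add f g := Subtype.ext (by ext N; simp [M.actR_add])
  of_smul c f := Subtype.ext (by ext N; simp [M.actR_smul])
  act_of b X Y f := Subtype.ext (by ext N; simp)
  act_comp b X Y Z f g := Subtype.ext (by ext N; simp)
  act_add b X Y f g := Subtype.ext (by ext N; simp)
  act_smul b X Y c f := Subtype.ext (by ext N; simp)
  act_exchange f X Y g := Subtype.ext (by
    ext N
    -- The remaining axioms are instances of naturality of the family: along `N ◁ f` here, and along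
    -- the associator and the right unitor below.
    have := g.2 ⟨N.obj ⊗ _, hI _ _ N.2⟩ ⟨N.obj ⊗ _, hI _ _ N.2⟩ (N.obj ◁ f)
    rw [whiskerLeft_actionHomLeft, whiskerLeft_actionHomLeft] at this
    simp only [Category.assoc]
    rw [Iso.inv_comp_eq]
    simpa using this =≫ (αₗ _ _ _).hom)
  act_tensor b b' X Y f := Subtype.ext (by
    ext N
    have := f.2 ⟨(N.obj ⊗ b) ⊗ b', hI _ _ (hI _ _ N.2)⟩ ⟨N.obj ⊗ (b ⊗ b'), hI _ _ N.2⟩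
      (α_ _ _ _).hom
    have h : (α_ N.obj b b').inv ⊵ₗ X ≫ (α_ N.obj b b').hom ⊵ₗ X = 𝟙 _ := by
      rw [← comp_actionHomLeft, Iso.inv_hom_id, id_actionHomLeft]
    have h' := (α_ N.obj b b').inv ⊵ₗ X ≫= associator_actionHom N.obj b b' X
    rw [reassoc_of% h] at h'
    simp only [Category.assoc]
    rw [← associator_actionHom, reassoc_of% this, Iso.inv_comp_eq, reassoc_of% h']
    simp only [Iso.hom_inv_id_assoc]
    rw [reassoc_of% h])
  act_unit f := Subtype.ext (by
    ext N
    have := f.2 ⟨N.obj ⊗ 𝟙_ B, hI _ _ N.2⟩ N (ρ_ _).hom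
    rw [rightUnitor_actionHom, rightUnitor_actionHom] at this
    simp only [Category.assoc]
    rw [Iso.inv_comp_eq]
    simpa using this)

variable {M}

/-- The evaluation at `X` and at `Y`, followed by `Φ`, are isomorphic if `Φ X ≅ Φ Y`. -/
def evalIso {E : Type w'} [Category.{v'} E] [MonoidalCategory E] [Preadditive E]
    [Linear k E] [MonoidalPreadditive E] [MonoidalLinear k E] {M : Birep.{u, v, w} k E}
    {R : Birep.{u, v'', w''} k E} (Φ : StrongTrans M R) {X Y : M.carrier}
    (e : Φ.functor.obj X ≅ Φ.functor.obj Y) :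
    StrongTrans.comp (evalTrans k M X) Φ ≅ StrongTrans.comp (evalTrans k M Y) Φ :=
  StrongTrans.mkIso (NatIso.ofComponents (fun b : E => Φ.conjIso b e)
      (fun {b b'} f => (Φ.conj_exchange f e.hom).symm))
    (fun b (c : E) => by
      change (μₗ Φ.functor b _ ≫ Φ.functor.map (αₗ b c X).inv) ≫ Φ.conj (b ⊗ c) e.hom =
        b ⊴ₗ Φ.conj c e.hom ≫ μₗ Φ.functor b _ ≫ Φ.functor.map (αₗ b c Y).inv
      rw [← Category.assoc, ← StrongTrans.mu_conj, Category.assoc, Category.assoc]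
      congr 1
      exact ((Iso.inv_comp_eq (Φ.functor.mapIso (αₗ b c X))).2 ((Category.assoc _ _ _).symm.trans
        ((Iso.eq_comp_inv (Φ.functor.mapIso (αₗ b c Y))).2
          (Φ.conj_tensor b c e.hom)).symm).symm))

end Ideal

/-! ### The universal property of the birepresentation associated to a partition -/

section UniversalProperty

open MonoidalLeftAction Functor.LaxLeftLinear Functor.OplaxLeftLinear Functor.LeftLinear

variable {k : Type u} [Field k] {n : ℕ} {P : StarPartition n}

/-- The cones over the pairs `Θ_{i^m_l}, Θ_{i^m_{l+1}}`. -/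
abbrev StarCone (P : StarPartition n) (R : Birep.{u, u + 1, u + 1} k (StarBicat k n)) :=
  IsoCone (fun s : P.Step => Theta k (P.src s).succ) (fun s => Theta k (P.tgt s).succ) R

/-- The compatibility of a cone with the modifications `s_{j,l}` on the ideal `N`. -/
def StarCone.Compatible {R : Birep.{u, u + 1, u + 1} k (StarBicat k n)} (T : StarCone P R) :
    Prop :=
  ∀ (s : P.Step) (N : (birepN k n).carrier),
    (Modification.nat (T.iso s).hom).app ((Gamma k n).functor.obj N) =
      T.trans.functor.map ((Modification.nat (sIso k (P.src s) (P.tgt s)).hom).app N)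

namespace CWRData

variable (D : CWRData k P)

/-- The composition with `Ω^R` and with the universal cone. -/
def restrict (R : Birep.{u, u + 1, u + 1} k (StarBicat k n)) :
    StrongTrans D.CWR R ⥤ StarCone P R :=
  equifiesFunctor _ _ D.isCoequifier.choose R ⋙ ObjectProperty.ι _ ⋙ D.cone.postcompFunctor R

/-- The two universal properties provide equivalences, and between them stands the inclusion of a
full subcategory. Thus `restrict` is fully faithful, and by `exists_desc` its essential image
contains all compatible cones. -/
instance (R : Birep.{u, u + 1, u + 1} k (StarBicat k n)) : (D.restrict R).Full :=
  have := D.isCoequifier.choose_spec R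
  have := D.isCoisoinserter R
  inferInstanceAs (_ ⋙ _ ⋙ _).Full

instance (R : Birep.{u, u + 1, u + 1} k (StarBicat k n)) : (D.restrict R).Faithful :=
  have := D.isCoequifier.choose_spec R
  have := D.isCoisoinserter R
  inferInstanceAs (_ ⋙ _ ⋙ _).Faithful

/-- The cone with values in `C^WR`. -/
def totalCone : StarCone P D.CWR := D.cone.postcomp D.ΩR

theorem totalCone_iso_hom_app (s : P.Step) (b : (birepP k n).carrier) :
    (Modification.nat (D.totalCone.iso s).hom).app b =
      D.ΩR.functor.map ((Modification.nat (D.cone.iso s).hom).app b) :=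
  IsoCone.postcomp_iso_hom_app D.cone D.ΩR s b

theorem restrict_iso_hom_app {R : Birep.{u, u + 1, u + 1} k (StarBicat k n)}
    (H : StrongTrans D.CWR R) (s : P.Step) (b : (birepP k n).carrier) :
    (Modification.nat (((D.restrict R).obj H).iso s).hom).app b =
      H.functor.map ((Modification.nat (D.totalCone.iso s).hom).app b) := by
  rw [totalCone_iso_hom_app]
  exact IsoCone.postcomp_iso_hom_app D.cone (StrongTrans.comp D.ΩR H) s b

/-- The functor `restrict` is given by composition with `Ω`. -/
def restrictTrans {R : Birep.{u, u + 1, u + 1} k (StarBicat k n)} (H : StrongTrans D.CWR R) :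
    ((D.restrict R).obj H).trans ≅ StrongTrans.comp D.totalCone.trans H :=
  (StrongTrans.assoc D.cone.trans D.ΩR H).symm

/-- This is the equation imposed by the coequifier; the associators in it have identity components.
-/
theorem compatible_totalCone : StarCone.Compatible D.totalCone := fun s N => by
  rw [totalCone_iso_hom_app]
  have := congrArg (fun γ => (Modification.nat γ).app N) (D.isCoequifier.choose s)
  refine this.trans ?_
  refine congrArg D.ΩR.functor.map ?_
  exact (Category.id_comp _).trans (Category.comp_id _)

/-- Compatible cones factor over `C^WR`. -/
theorem exists_desc {R : Birep.{u, u + 1, u + 1} k (StarBicat k n)} (T : StarCone P R)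
    (hT : T.Compatible) : ∃ H : StrongTrans D.CWR R, Nonempty ((D.restrict R).obj H ≅ T) := by
  have h₁ := D.isCoisoinserter R
  have h₂ := D.isCoequifier.choose_spec R
  obtain ⟨H₁, ⟨e⟩⟩ := h₁.essSurj.mem_essImage T
  -- Compatibility is transported from `T` to `H₁`: the components of `e` intertwine the two cones
  -- and are invertible, so they can be cancelled.
  have hH : equifies (fun s => StrongTrans.whiskerLeft (Gamma k n) (D.cone.iso s).hom)
      (fun s => (StrongTrans.assoc _ _ _).inv ≫
        StrongTrans.whiskerRight (sIso k (P.src s) (P.tgt s)).hom D.cone.trans ≫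
          (StrongTrans.assoc _ _ _).hom) R H₁ := fun s => by
    ext N
    have h := e.hom.comm_app s ((Gamma k n).functor.obj N)
    rw [hT] at h
    have h' := (Modification.nat e.hom.mod).naturality
      ((Modification.nat (sIso k (P.src s) (P.tgt s)).hom).app N)
    have h'' := (cancel_mono ((IsoCone.natIso e).hom.app _)).1 (h.trans h'.symm)
    refine (IsoCone.postcomp_iso_hom_app D.cone H₁ s _).symm.trans
      (h''.trans (congrArg H₁.functor.map ?_))
    exact ((Category.id_comp _).trans (Category.comp_id _)).symm
  obtain ⟨H, ⟨e'⟩⟩ := h₂.essSurj.mem_essImage ⟨H₁, hH⟩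
  exact ⟨H, ⟨(ObjectProperty.ι _ ⋙ D.cone.postcompFunctor R).mapIso e' ≪≫ e⟩⟩

/-- If there is a compatible cone whose underlying functor is faithful, then so is `Ω`. -/
theorem faithful_of_cone {R : Birep.{u, u + 1, u + 1} k (StarBicat k n)} (T : StarCone P R)
    (hT : T.Compatible) (h : T.trans.functor.Faithful) : D.Ω.functor.Faithful := by
  obtain ⟨H, ⟨e⟩⟩ := D.exists_desc T hT
  have : (D.Ω.functor ⋙ H.functor).Faithful :=
    Functor.Faithful.of_iso (IsoCone.natIso e).symm
  exact Functor.Faithful.of_comp D.Ω.functor H.functor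

theorem compatible_generatedCone :
    StarCone.Compatible (P := P) D.totalCone.generatedCone := fun s N =>
  Subtype.ext (D.compatible_totalCone s N)

/-- All morphisms of `C^WR` between objects in the image of `Ω` are generated by the morphisms of
`C` and by the universal cone, and `Ω` is essentially surjective. -/
theorem generated_and_essSurj :
    (∀ {X Y : (birepC k n).carrier} (f : D.Ω.functor.obj X ⟶ D.Ω.functor.obj Y),
      D.totalCone.Generated f) ∧ ∀ Z : D.CWR.carrier, ∃ X, Nonempty (D.Ω.functor.obj X ≅ Z) := by
  -- Factor the cone of generated morphisms as `H`. The composite of `H` with the inclusion `I`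
  -- restricts to the universal cone, as the identity does, so the two are isomorphic.
  obtain ⟨H, ⟨e⟩⟩ := D.exists_desc D.totalCone.generatedCone D.compatible_generatedCone
  let I := D.totalCone.generatedIncl
  let ε := IsoCone.natIso e
  let θ' : ((D.restrict _).obj (StrongTrans.comp H I)).trans ≅
      ((D.restrict _).obj (StrongTrans.id D.CWR)).trans :=
    D.restrictTrans _ ≪≫ (StrongTrans.assoc _ _ _).symm ≪≫
      StrongTrans.whiskerRightIso ((D.restrictTrans H).symm ≪≫ IsoCone.transIso e) I ≪≫
        D.totalCone.inclGeneratedIncl ≪≫ (StrongTrans.compId _).symm ≪≫ (D.restrictTrans _).symm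
  have hθ' (X : (birepC k n).carrier) : (Modification.nat θ'.hom).app X =
      I.functor.map (ε.hom.app X) := by
    refine (Category.id_comp _).trans ((Category.id_comp _).trans ?_)
    refine (congrArg (fun f => _ ≫ f) ((Category.id_comp _).trans (Category.id_comp _))).trans ?_
    exact (Category.comp_id _).trans (congrArg I.functor.map (Category.id_comp _))
  let θ : (D.restrict _).obj (StrongTrans.comp H I) ≅
      (D.restrict _).obj (StrongTrans.id D.CWR) :=
    IsoCone.mkIso θ' (fun s => by
      ext b
      have h := congrArg I.functor.map (IsoCone.Hom.comm_app e.hom s b)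
      rw [I.functor.map_comp, I.functor.map_comp, restrict_iso_hom_app] at h
      refine (congrArg (fun f => (Modification.nat (((D.restrict _).obj (StrongTrans.comp H I)).iso
        s).hom).app b ≫ f) (hθ' _)).trans (Eq.trans ?_ (congrArg (fun f => f ≫
        (Modification.nat (((D.restrict _).obj (StrongTrans.id D.CWR)).iso s).hom).app b)
          (hθ' _)).symm)
      rw [restrict_iso_hom_app, restrict_iso_hom_app]
      exact h)
  -- Full faithfulness of `restrict` turns the isomorphism of cones `θ` into an isomorphism between
  -- `H` followed by `I` and the identity. By `hη`, its components at images of `Ω` are themselves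
  -- generated.
  let η := (D.restrict _).preimageIso θ
  have hη (X : (birepC k n).carrier) : (Modification.nat η.hom).app (D.Ω.functor.obj X) =
      I.functor.map (ε.hom.app X) :=
    (congrArg (fun γ => (Modification.nat (IsoCone.Hom.mod γ)).app X)
      ((D.restrict D.CWR).map_preimage θ.hom)).trans (hθ' X)
  refine ⟨fun {X Y} f => ?_, fun Z => ⟨(H.functor.obj Z).base, ⟨?_⟩⟩⟩
  · have h := (Modification.nat η.hom).naturality f
    -- Naturality of `η` at `f` writes `f` as a composite of morphisms in the image of `I`.
    have h' : f = I.functor.map (ε.inv.app X ≫ H.functor.map f ≫ ε.hom.app Y) := by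
      refine Eq.trans ?_ ((I.functor.map_comp _ _).trans (congrArg
        (fun g => I.functor.map (ε.inv.app X) ≫ g) (I.functor.map_comp _ _))).symm
      refine (I.functor.mapIso (ε.app X)).eq_inv_comp.2 ?_
      exact (congrArg (fun g => g ≫ f) (hη X)).symm.trans
        (h.symm.trans (congrArg (fun g => I.functor.map (H.functor.map f) ≫ g) (hη Y)))
    rw [h']
    exact (ε.inv.app X ≫ H.functor.map f ≫ ε.hom.app Y).2
  · exact (StrongTrans.modEval Z).mapIso η

end CWRData

end UniversalProperty

/-! ### Faithfulness -/

section Multiplication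

variable (k : Type u) [Field k] {A : Type u} [Ring A] [Algebra k A]

/-- The bimodule homomorphism `A e ⊗_k f A ⟶ A` given by the multiplication. -/
def mulBim (e f : A) : projBim k e f ⟶ Bim.unit k A where
  lin :=
    { outerLift k A (U := leftIdeal e) (V := rightIdeal f) (P := A)
        (AddMonoidHom.mk' (fun u => AddMonoidHom.mk' (fun v => u.1 * v.1)
          (fun x y => by simp [mul_add])) (fun x y => by ext; simp [add_mul]))
        (fun c u v => by simp) with
      map_smul' := fun a t => by
        induction t using outer_induction with
        | h0 => simp
        | ha s t hs ht => simp_all [mul_add]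
        | ht u v => exact mul_assoc a u.1 v.1 }
  map_op a t := by
    induction t using outer_induction with
    | h0 => simp
    | ha s t hs ht => simp_all
    | ht u v => exact (mul_assoc u.1 v.1 a.unop).symm

theorem mulBim_pure (e f : A) (u : leftIdeal e) (v : rightIdeal f) :
    Bim.Hom.lin (mulBim k e f) (pureTensor k A u v) = u.1 * v.1 := rfl

end Multiplication

/-! ### The compatible cone of natural families over the ideal N -/

section Faithful

open MonoidalLeftAction StarAlg Functor.LaxLeftLinear Functor.OplaxLeftLinear Functor.LeftLinear

variable (k : Type u) [Field k] (n : ℕ)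

/-- The objects of the ideal `N` of `B`. -/
def idealN : ObjectProperty (StarBicat k n) := fun b => inAdd (genN k n) b.1

/-- In each variable the additive closure reduces the claim to generators, where it is the unit law
or the decomposition of a tensor product of two bimodules `A e ⊗ f A`. -/
theorem idealN_tensor (N b : StarBicat k n) (hN : idealN k n N) : idealN k n (N ⊗ b) := by
  refine inAdd_map (tensorRight b.1) (fun X hX => ?_) hN
  refine inAdd_map (tensorLeft X) (fun Y hY => ?_) b.2
  obtain rfl | ⟨j, rfl⟩ := hY
  · exact inAdd_of_iso (ρ_ X).symm (inAdd_of hX)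
  · exact genB_act_genN k n _ _ (Or.inr hX) ⟨j, rfl⟩

variable {n}

/-- The extension of `C` by natural families over the ideal `N`. -/
abbrev familiesN : Extension (birepC k n) :=
  idealExtension (birepC k n) (idealN k n) (idealN_tensor k n)

/-- The components of the modification `s_{j,l}`. -/
def sApp (j l : Fin n) (N : (idealN k n).FullSubcategory) :
    N.obj ⊙ₗ projObj k j.succ ≅ N.obj ⊙ₗ projObj k l.succ :=
  (StrongTrans.modEval (M := birepN k n) (N := birepC k n) ⟨N.obj.obj, N.2⟩).mapIso (sIso k j l)

theorem sApp_naturality (j l : Fin n) {N N' : (idealN k n).FullSubcategory}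
    (f : N.obj ⟶ N'.obj) : (sApp k j l N).hom ≫ f ⊵ₗ projObj k l.succ =
      f ⊵ₗ projObj k j.succ ≫ (sApp k j l N').hom :=
  ((Modification.nat (sIso k j l).hom).naturality (X := ⟨N.obj.obj, N.2⟩)
    (Y := ⟨N'.obj.obj, N'.2⟩) (ObjectProperty.homMk f.hom)).symm

theorem sApp_inv_naturality (j l : Fin n) {N N' : (idealN k n).FullSubcategory}
    (f : N.obj ⟶ N'.obj) : (sApp k j l N).inv ≫ f ⊵ₗ projObj k j.succ =
      f ⊵ₗ projObj k l.succ ≫ (sApp k j l N').inv := by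
  rw [Iso.inv_comp_eq, ← Category.assoc, sApp_naturality, Category.assoc, Iso.hom_inv_id,
    Category.comp_id]

/-- The modification axiom for `s_{j,l}`: its component at `b ⊗ N` is `b` applied to its component
at `N`. It makes the cone `familiesCone` compatible. -/
theorem sApp_tensor (j l : Fin n) (b : StarBicat k n) (N : (birepN k n).carrier) :
    (sApp k j l ⟨b ⊗ (Gamma k n).functor.obj N, StableUnder.prop_act b.2 N.2⟩).hom =
      (αₗ b ((Gamma k n).functor.obj N) (projObj k j.succ)).hom ≫
        b ⊴ₗ (sApp k j l ⟨(Gamma k n).functor.obj N, N.2⟩).hom ≫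
          (αₗ b ((Gamma k n).functor.obj N) (projObj k l.succ)).inv := by
  have h := Modification.comm (sIso k j l).hom b N
  have h₁ := mu_Gamma_Theta b N j.succ
  have h₂ := mu_Gamma_Theta b N l.succ
  rw [StrongTrans.mu] at h₁ h₂
  rw [h₁, h₂] at h
  exact (Iso.inv_comp_eq _).1 h

/-- The modification `s_{j,l}` as an isomorphism given by a natural family. -/
def sFamily (j l : Fin n) : (familiesN k).incl.functor.obj (projObj k j.succ) ≅
    (familiesN k).incl.functor.obj (projObj k l.succ) where
  hom := ⟨fun N => (sApp k j l N).hom, fun _ _ f => sApp_naturality k j l f⟩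
  inv := ⟨fun N => (sApp k j l N).inv, fun _ _ f => sApp_inv_naturality k j l f⟩
  hom_inv_id := Subtype.ext (funext fun N => by
    change (sApp k j l N).hom ≫ (sApp k j l N).inv = N.obj ⊴ₗ 𝟙 _
    rw [Iso.hom_inv_id, actionHomRight_id])
  inv_hom_id := Subtype.ext (funext fun N => by
    change (sApp k j l N).inv ≫ (sApp k j l N).hom = N.obj ⊴ₗ 𝟙 _
    rw [Iso.inv_hom_id, actionHomRight_id])

/-- The cone given by the modifications `s_{j,l}`. -/
def familiesCone (P : StarPartition n) : StarCone P (familiesN k).birep where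
  trans := (familiesN k).incl
  iso s := evalIso (familiesN k).incl (sFamily k (P.src s) (P.tgt s))

/-- At an object `N` of the ideal, the component of the cone is `N` acting on the family `s`, that
is, the family whose member at `N'` is `s` at `N' ⊗ N` up to associators. By `sApp_tensor` this
member is `N'` acting on `s` at `N`, which is the image of `s` at `N`. -/
theorem compatible_familiesCone (P : StarPartition n) :
    StarCone.Compatible (familiesCone k P) := fun s N => by
  refine (Category.id_comp _).trans ((Category.comp_id _).trans (Subtype.ext (funext fun N' => ?_)))
  change (αₗ N'.obj ((Gamma k n).functor.obj N) _).inv ≫ (sApp k (P.src s) (P.tgt s)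
    ⟨N'.obj ⊗ (Gamma k n).functor.obj N, _⟩).hom ≫ (αₗ N'.obj ((Gamma k n).functor.obj N) _).hom =
      N'.obj ⊴ₗ (sApp k (P.src s) (P.tgt s) ⟨(Gamma k n).functor.obj N, N.2⟩).hom
  rw [sApp_tensor]
  simp

variable {k}

/-- Left multiplication by `e_0` reveals the coefficients of `e_0`, `c` and the `b_i`. Left
multiplication by `b_i` turns the coefficient of `e_i` into that of `b_i` and, since `b_i a_i = c`,
the coefficient of `a_i` into that of `c`. -/
theorem eq_zero_of_rightIdeal_mul {x : StarAlg k n}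
    (h : ∀ v : rightIdeal (idem k n 0), v.1 * x = 0) : x = 0 := by
  have h₁ := h elemE
  have h₂ (j : Fin n) := h (elemB j)
  simp only [elemE, elemB] at h₁ h₂
  ext i
  · simpa [idem] using congrArg StarAlg.e₀ h₁
  · simpa [idem] using congrArg StarAlg.c h₁
  · simpa [arrowB] using congrArg (fun y => StarAlg.b y i) (h₂ i)
  · simpa [arrowB, Pi.single_apply] using congrArg StarAlg.c (h₂ i)
  · simpa [idem] using congrArg (fun y => StarAlg.b y i) h₁

/-- A projective module is a retract of a finite direct sum of copies of `A`, so the claim can be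
checked on coordinates. -/
theorem IsProj.eq_zero {Y : ModuleCat.{u} (StarAlg k n)} (hY : IsProj (StarAlg k n) Y) {y : Y}
    (h : ∀ v : rightIdeal (idem k n 0), v.1 • y = 0) : y = 0 := by
  obtain ⟨ι, _, Z, p, q, hZ, hpq⟩ := (isProj_iff_inAdd Y).1 hY
  obtain rfl : Z = fun _ => ModuleCat.of _ _ := funext hZ
  have h₁ (i : ι) : (p i).hom y = 0 := eq_zero_of_rightIdeal_mul fun v => by
    have := (map_smul (p i).hom v.1 y).symm
    rwa [h, map_zero] at this
  have := congrArg (fun f : Y ⟶ Y => f.hom y) hpq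
  simpa [h₁] using this.symm

/-- The member at `A e_0 ⊗ e_0 A` of the family of `f` sends `(e_0 ⊗ v) ⊗ x` to `(e_0 ⊗ v) ⊗ f x`,
and multiplying out gives `v f(x)`. So the family determines `v f(x)` for all `v ∈ e_0 A`, hence
`f(x)`. -/
instance : (familiesN k (n := n)).incl.functor.Faithful where
  map_injective {X Y f g} h := by
    ext x
    rw [← sub_eq_zero]
    refine IsProj.eq_zero Y.2 fun v => ?_
    let N : (idealN k n).FullSubcategory :=
      ⟨⟨projBim k (idem k n 0) (idem k n 0), inAdd_of (Or.inr ⟨0, rfl⟩)⟩, inAdd_of ⟨0, rfl⟩⟩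
    let m := pureTensor k (StarAlg k n) (⟨idem k n 0, idem_mul_idem 0⟩ : leftIdeal (idem k n 0)) v
    have h₁ : N.obj ⊴ₗ f = N.obj ⊴ₗ g := congrFun (congrArg Subtype.val h) N
    have h₂ : NTensor.tmul (StarAlg k n) m (f.hom.hom x) =
        NTensor.tmul (StarAlg k n) m (g.hom.hom x) :=
      congrArg (fun φ => φ.hom.hom (NTensor.tmul (StarAlg k n) m x)) h₁
    have h₃ := congrArg (fun t => NTensor.leftUnit Y.obj ((actMap (mulBim k (idem k n 0)
      (idem k n 0)) (𝟙 Y.obj)).hom t)) h₂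
    have hv : idem k n 0 * v.1 = v.1 := v.2
    have h₄ (y : Y.obj) : NTensor.leftUnit Y.obj ((actMap (mulBim k (idem k n 0)
      (idem k n 0)) (𝟙 Y.obj)).hom (NTensor.tmul (StarAlg k n) m y)) = v.1 • y := by
      rw [actMap_tmul, mulBim_pure]
      exact (NTensor.leftUnit_tmul _ _).trans (by rw [hv]; rfl)
    rw [smul_sub, sub_eq_zero, ← h₄, ← h₄]
    exact h₃

theorem CWRData.faithful {P : StarPartition n} (D : CWRData k P) : D.Ω.functor.Faithful :=
  D.faithful_of_cone (familiesCone k P) (compatible_familiesCone k P)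
    (inferInstanceAs (familiesN k (n := n)).incl.functor.Faithful)

end Faithful

/-! ### Morphisms between the indecomposable projective modules -/

section Projectives

open MonoidalLeftAction StarAlg

variable {k : Type u} [Field k] {n : ℕ}

variable (k n) in
/-- The generator `e_i` of `A e_i`. -/
def gen (i : Fin (n + 1)) : leftIdeal (idem k n i) := ⟨idem k n i, idem_mul_idem i⟩

/-- The right multiplication by an element of `A e_j`, as a morphism `A e_i ⟶ A e_j`. -/
def rmulHom (i : Fin (n + 1)) {j : Fin (n + 1)} (y : leftIdeal (idem k n j)) :
    projObj k i ⟶ projObj k j :=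
  ObjectProperty.homMk (ModuleCat.ofHom
    ((LinearMap.toSpanSingleton (StarAlg k n) (leftIdeal (idem k n j)) y).comp
      (leftIdeal (idem k n i)).subtype))

theorem proj_hom_apply {i : Fin (n + 1)} {Y : (birepC k n).carrier} (f : projObj k i ⟶ Y)
    (x : leftIdeal (idem k n i)) : f.hom.hom x = x.1 • f.hom.hom (gen k n i) := by
  refine (congrArg f.hom.hom (Subtype.ext x.2.symm)).trans (?_ : f.hom.hom (x.1 • gen k n i) = _)
  exact map_smul f.hom.hom x.1 (gen k n i)

theorem proj_hom_ext {i : Fin (n + 1)} {Y : (birepC k n).carrier} {f g : projObj k i ⟶ Y}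
    (h : f.hom.hom (gen k n i) = g.hom.hom (gen k n i)) : f = g := by
  ext x
  exact (proj_hom_apply f x).trans ((congrArg _ h).trans (proj_hom_apply g x).symm)

theorem idem_smul_hom_gen {i : Fin (n + 1)} {Y : (birepC k n).carrier} (f : projObj k i ⟶ Y) :
    idem k n i • f.hom.hom (gen k n i) = f.hom.hom (gen k n i) :=
  (proj_hom_apply f (gen k n i)).symm

variable (k) in
/-- The elements `a_j` of `A e_0`. -/
def leftA (j : Fin n) : leftIdeal (idem k n 0) :=
  ⟨arrowA k j, by change arrowA k j * idem k n 0 = _; ext <;> simp [idem, arrowA]⟩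

variable (k n) in
/-- The element `c` of `A e_0`. -/
def leftC : leftIdeal (idem k n 0) :=
  ⟨loop k n, by change loop k n * idem k n 0 = _; ext <;> simp [idem, loop]⟩

variable (k) in
/-- The elements `b_j` of `A e_j`. -/
def leftB (j : Fin n) : leftIdeal (idem k n j.succ) :=
  ⟨arrowB k j, by
    change arrowB k j * idem k n j.succ = _
    ext <;> simp [idem, arrowB, Pi.single_apply]⟩

variable (k n) in
/-- The element `c` of `e_0 A`. -/
def elemC : rightIdeal (idem k n 0) :=
  ⟨loop k n, by change idem k n 0 * loop k n = _; ext <;> simp [idem, loop]⟩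

variable (k) in
/-- The right multiplication by `a_j`. -/
def homA (j : Fin n) : projObj k j.succ ⟶ projObj k (0 : Fin (n + 1)) := rmulHom _ (leftA k j)

variable (k) in
/-- The right multiplication by `b_j`. -/
def homB (j : Fin n) : projObj k (0 : Fin (n + 1)) ⟶ projObj k j.succ := rmulHom _ (leftB k j)

/-- The image of `e_i` under a morphism `A e_i ⟶ A e_j`. -/
def evalGen {i j : Fin (n + 1)} (f : projObj k i ⟶ projObj k j) : StarAlg k n :=
  (f.hom.hom (gen k n i) : leftIdeal (idem k n j)).1

theorem evalGen_ext {i j : Fin (n + 1)} {f g : projObj k i ⟶ projObj k j}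
    (h : evalGen f = evalGen g) : f = g :=
  proj_hom_ext (Subtype.ext h)

theorem evalGen_smul {i j : Fin (n + 1)} (c : k) (f : projObj k i ⟶ projObj k j) :
    evalGen (c • f) = c • evalGen f :=
  algebraMap_smul (StarAlg k n) c (evalGen f)

theorem evalGen_zero {i j : Fin (n + 1)} : evalGen (0 : projObj k i ⟶ projObj k j) = 0 := rfl

theorem evalGen_id {i : Fin (n + 1)} : evalGen (𝟙 (projObj k i)) = idem k n i := rfl

theorem evalGen_rmulHom (i : Fin (n + 1)) {j : Fin (n + 1)} (y : leftIdeal (idem k n j)) :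
    evalGen (rmulHom i y) = idem k n i * y.1 := rfl

theorem evalGen_mul_idem {i j : Fin (n + 1)} (f : projObj k i ⟶ projObj k j) :
    evalGen f * idem k n j = evalGen f :=
  (f.hom.hom (gen k n i) : leftIdeal (idem k n j)).2

theorem idem_mul_evalGen {i j : Fin (n + 1)} (f : projObj k i ⟶ projObj k j) :
    idem k n i * evalGen f = evalGen f :=
  congrArg Subtype.val (idem_smul_hom_gen f)

/-- Morphisms `A e_i ⟶ A e_j` correspond to elements of `e_i A e_j`. Between distinct leaves this
space is zero because `a_i b_j = 0`. It is spanned by `e_i`, `b_i` and `a_i` in the three lemmas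
that follow, the first of which uses that the `2`-cycles at the leaves have been killed. -/
theorem hom_succ_succ {i j : Fin n} (h : i ≠ j) (f : projObj k i.succ ⟶ projObj k j.succ) :
    f = 0 := by
  apply evalGen_ext
  rw [evalGen_zero, ← idem_mul_evalGen, ← evalGen_mul_idem]
  ext l <;> simp [idem, Pi.single_apply]
  grind

theorem hom_succ_self {i : Fin n} (f : projObj k i.succ ⟶ projObj k i.succ) :
    ∃ c : k, f = c • 𝟙 _ := by
  refine ⟨(evalGen f).e i, evalGen_ext ?_⟩
  rw [evalGen_smul, evalGen_id]
  conv_lhs => rw [← idem_mul_evalGen, ← evalGen_mul_idem]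
  ext l <;> simp [idem, Pi.single_apply]
  grind

theorem hom_zero_succ {i : Fin n} (f : projObj k (0 : Fin (n + 1)) ⟶ projObj k i.succ) :
    ∃ c : k, f = c • homB k i := by
  refine ⟨(evalGen f).b i, evalGen_ext ?_⟩
  rw [evalGen_smul, homB, evalGen_rmulHom, leftB]
  conv_lhs => rw [← idem_mul_evalGen, ← evalGen_mul_idem]
  ext l <;> simp [idem, arrowB, Pi.single_apply]
  grind

theorem hom_succ_zero {i : Fin n} (f : projObj k i.succ ⟶ projObj k (0 : Fin (n + 1))) :
    ∃ c : k, f = c • homA k i := by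
  refine ⟨(evalGen f).a i, evalGen_ext ?_⟩
  rw [evalGen_smul, homA, evalGen_rmulHom, leftA]
  conv_lhs => rw [← idem_mul_evalGen, ← evalGen_mul_idem]
  ext l <;> simp [idem, arrowA, Pi.single_apply]
  grind

end Projectives

/-! ### The central element of the bimodule A e_0 ⊗ e_0 A -/

section CentralElement

open MonoidalLeftAction StarAlg

variable (k : Type u) [Field k] (n : ℕ)

/-- The bimodule `A e_0 ⊗_k e_0 A`. -/
abbrev bimN₀ : Bim k (StarAlg k n) := projBim k (idem k n 0) (idem k n 0)

/-- The central element `e_0 ⊗ c + c ⊗ e_0 + ∑ a_i ⊗ b_i` of the bimodule `A e_0 ⊗_k e_0 A`. -/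
def centralElem : (bimN₀ k n).carrier :=
  pureTensor k (StarAlg k n) (gen k n 0) (elemC k n) + pureTensor k (StarAlg k n) (leftC k n) elemE +
    ∑ i, pureTensor k (StarAlg k n) (leftA k i) (elemB i)

theorem sum_pure {A U V : Type u} [Ring A] [Algebra k A] [AddCommGroup U] [Module A U] [Module k U]
    [IsScalarTower k A U] [AddCommGroup V] [Module Aᵐᵒᵖ V] [Module k V] [IsScalarTower k Aᵐᵒᵖ V]
    {ι : Type*} (s : Finset ι) (u : ι → U) (v : V) :
    pureTensor k A (∑ i ∈ s, u i) v = ∑ i ∈ s, pureTensor k A (u i) v :=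
  TensorProduct.sum_tmul s u v

theorem sum_smul_arrowA (y : Fin n → k) :
    ∑ i, y i • arrowA k i = (⟨0, 0, 0, y, 0⟩ : StarAlg k n) := by
  let φ : (Fin n → k) →+ StarAlg k n :=
    AddMonoidHom.mk' (fun y => ⟨0, 0, 0, y, 0⟩) (fun y z => by ext <;> simp)
  have h (i : Fin n) : y i • arrowA k i = φ (Pi.single i (y i)) := by
    ext j <;> simp [φ, arrowA, Pi.single_apply]
  simp only [h]
  rw [← map_sum, Finset.univ_sum_single]
  rfl

theorem sum_smul_arrowB (y : Fin n → k) :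
    ∑ i, y i • arrowB k i = (⟨0, 0, 0, 0, y⟩ : StarAlg k n) := by
  let φ : (Fin n → k) →+ StarAlg k n :=
    AddMonoidHom.mk' (fun y => ⟨0, 0, 0, 0, y⟩) (fun y z => by ext <;> simp)
  have h (i : Fin n) : y i • arrowB k i = φ (Pi.single i (y i)) := by
    ext j <;> simp [φ, arrowB, Pi.single_apply]
  simp only [h]
  rw [← map_sum, Finset.univ_sum_single]
  rfl

/-- This and the next lemmas give the left action on the basis `e_0, c, a_i` of `A e_0` and the
right action on the basis `c, e_0, b_i` of `e_0 A`. The bases are dual for the pairing sending `(v,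
u)` to the coefficient of `c` in `v u`, so the matrices are transposes of each other. -/
theorem smul_gen_zero (x : StarAlg k n) :
    x • gen k n 0 = x.e₀ • gen k n 0 + x.c • leftC k n + ∑ i, x.a i • leftA k i := by
  apply Subtype.ext
  change x * idem k n 0 = x.e₀ • idem k n 0 + x.c • loop k n +
    ((∑ i, x.a i • leftA k i : leftIdeal (idem k n 0)) : StarAlg k n)
  rw [AddSubmonoidClass.coe_finsetSum]
  change x * idem k n 0 = x.e₀ • idem k n 0 + x.c • loop k n + ∑ i, x.a i • arrowA k i
  rw [sum_smul_arrowA]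
  ext <;> simp [idem, loop]

theorem smul_leftC (x : StarAlg k n) : x • leftC k n = x.e₀ • leftC k n := by
  apply Subtype.ext
  change x * loop k n = x.e₀ • loop k n
  ext <;> simp [loop]

theorem smul_leftA (x : StarAlg k n) (i : Fin n) :
    x • leftA k i = x.e i • leftA k i + x.b i • leftC k n := by
  apply Subtype.ext
  change x * arrowA k i = x.e i • arrowA k i + x.b i • loop k n
  ext j <;> simp [loop, arrowA, Pi.single_apply]
  grind

theorem op_smul_elemE (x : StarAlg k n) :
    op x • (elemE : rightIdeal (idem k n 0)) =
      x.e₀ • elemE + x.c • elemC k n + ∑ i, x.b i • elemB i := by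
  apply Subtype.ext
  change idem k n 0 * x = x.e₀ • idem k n 0 + x.c • loop k n +
    ((∑ i, x.b i • elemB i : rightIdeal (idem k n 0)) : StarAlg k n)
  rw [AddSubmonoidClass.coe_finsetSum]
  change idem k n 0 * x = x.e₀ • idem k n 0 + x.c • loop k n + ∑ i, x.b i • arrowB k i
  rw [sum_smul_arrowB]
  ext <;> simp [idem, loop]

theorem op_smul_elemC (x : StarAlg k n) : op x • elemC k n = x.e₀ • elemC k n := by
  apply Subtype.ext
  change loop k n * x = x.e₀ • loop k n
  ext <;> simp [loop]

theorem op_smul_elemB (x : StarAlg k n) (i : Fin n) :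
    op x • (elemB i : rightIdeal (idem k n 0)) = x.e i • elemB i + x.a i • elemC k n := by
  apply Subtype.ext
  change arrowB k i * x = x.e i • arrowB k i + x.a i • loop k n
  ext j <;> simp [loop, arrowB, Pi.single_apply]
  grind

/-- The element is the Casimir element of the pairing of `e_0 A` with `A e_0` by the coefficient of
`c` in the product. Centrality expresses that the pairing is balanced over `A`, and is checked here
on the dual bases. -/
theorem smul_centralElem (x : StarAlg k n) : op x • centralElem k n = x • centralElem k n := by
  simp only [centralElem, smul_add, Finset.smul_sum, op_smul_pure, smul_pure]
  rw [smul_gen_zero, smul_leftC, op_smul_elemE, op_smul_elemC]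
  simp only [smul_leftA, op_smul_elemB, add_pure, pure_add, pure_smul, sum_pure, pure_sum,
    Finset.sum_add_distrib]
  abel

/-- The bimodule homomorphism `A ⟶ A e_0 ⊗_k e_0 A` given by the central element. -/
def centralBim : Bim.unit k (StarAlg k n) ⟶ bimN₀ k n where
  lin := LinearMap.toSpanSingleton _ _ (centralElem k n)
  map_op x y := by
    change (y * x.unop) • centralElem k n = x • y • centralElem k n
    rw [mul_smul, ← smul_centralElem, smul_comm]
    rfl

end CentralElement

/-! ### Relations between the modification `s_{j,l}` and the arrows -/

section Relations

open MonoidalLeftAction StarAlg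

variable (k : Type u) [Field k] (n : ℕ)

/-- The bimodule `A e_0 ⊗_k e_0 A` as an object of `N`. -/
def objN₀ : (birepN k n).carrier := ⟨bimN₀ k n, inAdd_of ⟨0, rfl⟩⟩

/-- The bimodule `A e_0 ⊗_k e_0 A` as an object of `P`. -/
abbrev objB₀ : StarBicat k n := (Gamma k n).functor.obj (objN₀ k n)

/-- The multiplication `A e_0 ⊗_k e_0 A ⟶ A`. -/
def mulB : objB₀ k n ⟶ 𝟙_ (StarBicat k n) := ObjectProperty.homMk (mulBim k _ _)

/-- The homomorphism `A ⟶ A e_0 ⊗_k e_0 A` given by the central element. -/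
def centralB : 𝟙_ (StarBicat k n) ⟶ objB₀ k n := ObjectProperty.homMk (centralBim k n)

variable {n}

/-- The map `m ↦ m ⊗ x`. -/
def tmulGen {A : Type u} [Ring A] [Algebra k A] (M : Bim k A) {X : Type u} [AddCommGroup X]
    [Module A X] (x : X) : M.carrier →ₗ[A] NTensor A M.carrier X :=
  NTensor.tmulRight M.carrier x

theorem mulRightMap_sApp (j l : Fin n) (N : (idealN k n).FullSubcategory) {Y : Type u}
    [AddCommGroup Y] [Module (StarAlg k n) Y] (φ : N.obj.obj.carrier →ₗ[StarAlg k n] Y)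
    (t : NTensor (StarAlg k n) N.obj.obj.carrier (leftIdeal (idem k n j.succ))) :
    φ (mulRightMap N.obj.obj (idem k n l.succ) (arrowA k l) ((sApp k j l N).hom.hom.hom t)) =
      φ (mulRightMap N.obj.obj (idem k n j.succ) (arrowA k j) t) :=
  congrArg φ (mulRightMap_sEquiv j l N.2 t)

/-- The map `A e_0 ⟶ (A e_0 ⊗_k e_0 A) ⊗_A A e_j`, `u ↦ (u ⊗ b_j) ⊗ e_j`. -/
def inclB (j : Fin n) : projObj k (0 : Fin (n + 1)) ⟶ objB₀ k n ⊙ₗ projObj k j.succ :=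
  ObjectProperty.homMk (ModuleCat.ofHom
    ((tmulGen k (bimN₀ k n) (gen k n j.succ)).comp
      (outerIncl k (leftIdeal (idem k n 0)) (elemB j))))

/-- The map `(A e_0 ⊗_k e_0 A) ⊗_A A e_j ⟶ A e_0`, `(u ⊗ v) ⊗ x ↦ φ(v x a_j) u`, where `φ` is the
coefficient of `c`. -/
def projA (j : Fin n) : objB₀ k n ⊙ₗ projObj k j.succ ⟶ projObj k (0 : Fin (n + 1)) :=
  ObjectProperty.homMk (ModuleCat.ofHom
    ((outerProj (leftIdeal (idem k n 0)) coefC).comp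
      (mulRightMap (bimN₀ k n) (idem k n j.succ) (arrowA k j))))

/-- The isomorphism `s_{j,l}` is characterised by intertwining the right multiplications by `a_j`
and `a_l`. These send `(u ⊗ b_j) ⊗ e_j` and `(u ⊗ b_l) ⊗ e_l` to the same element `u ⊗ c`, since
`b_j a_j = c = b_l a_l`. -/
theorem inclB_sApp (j l : Fin n) :
    inclB k j ≫ (sApp k j l ⟨objB₀ k n, (objN₀ k n).2⟩).hom = inclB k l := by
  ext u
  apply (goodRight_of_mem (objN₀ k n).2 l).1
  refine (mulRightMap_sEquiv j l (objN₀ k n).2 _).trans ?_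
  have h (i : Fin n) (u : leftIdeal (idem k n 0)) :
      mulRightMap (bimN₀ k n) _ (arrowA k i) (NTensor.tmul (StarAlg k n)
        (pureTensor k _ u (elemB i)) (gen k n i.succ)) = pureTensor k _ u (elemC k n) := by
    rw [mulRightMap_tmul, op_smul_pure]
    congr 1
    apply Subtype.ext
    change arrowB k i * (idem k n i.succ * arrowA k i) = loop k n
    ext <;> simp [arrowB, arrowA, idem, loop, Pi.single_apply]
  exact (h j u).trans (h l u).symm

/-- The map `projA` factors through right multiplication by `a_j`, which `s_{j,l}` intertwines with
right multiplication by `a_l` by construction. -/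
theorem sApp_projA (j l : Fin n) :
    (sApp k j l ⟨objB₀ k n, (objN₀ k n).2⟩).hom ≫ projA k l = projA k j := by
  refine ObjectProperty.hom_ext _ (ModuleCat.hom_ext (LinearMap.ext fun t => ?_))
  exact mulRightMap_sApp k j l ⟨objB₀ k n, (objN₀ k n).2⟩
    (outerProj (leftIdeal (idem k n 0)) coefC) t

/-- On generators: `e_0 ↦ (e_0 ⊗ b_j) ⊗ e_j ↦ b_j`. This factors right multiplication by `b_j`
through an object on which the cone is known. -/
theorem inclB_mulB (j : Fin n) :
    inclB k j ≫ mulB k n ⊵ₗ projObj k j.succ ≫ (λₗ (projObj k j.succ)).hom = homB k j := by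
  apply evalGen_ext
  change (idem k n 0 * arrowB k j) * idem k n j.succ = idem k n 0 * arrowB k j
  ext <;> simp [arrowB, idem, Pi.single_apply]

-- The coefficient of `c` vanishes on `e_0` and on the `b_i`, so only the summand `e_0 ⊗ c`
-- contributes.
variable (n) in
theorem outerProj_centralElem :
    outerProj (leftIdeal (idem k n 0)) coefC (centralElem k n) = gen k n 0 := by
  have h (v : rightIdeal (idem k n 0)) (x : leftIdeal (idem k n 0)) :
      outerProj (leftIdeal (idem k n 0)) coefC (pureTensor k (StarAlg k n) x v) =
        coefC v • x := rfl
  have h₁ : outerProj (leftIdeal (idem k n 0)) coefC (pureTensor k (StarAlg k n) (gen k n 0)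
      (elemC k n)) = gen k n 0 := (h _ _).trans (one_smul k (gen k n 0))
  have h₂ : outerProj (leftIdeal (idem k n 0)) coefC (pureTensor k (StarAlg k n) (leftC k n)
      elemE) = 0 := (h _ _).trans (zero_smul k (leftC k n))
  have h₃ (i : Fin n) : outerProj (leftIdeal (idem k n 0)) coefC (pureTensor k (StarAlg k n)
      (leftA k i) (elemB i)) = 0 := (h _ _).trans (zero_smul k (leftA k i))
  rw [centralElem, map_add, map_add, map_sum, h₁, h₂, add_zero,
    Finset.sum_eq_zero fun i _ => h₃ i, add_zero]

variable (n) in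
theorem outerProj_op_smul_centralElem (x : StarAlg k n) :
    outerProj (leftIdeal (idem k n 0)) coefC (op x • (1 : StarAlg k n) • centralElem k n) =
      x • gen k n 0 := by
  rw [one_smul, smul_centralElem, map_smul, outerProj_centralElem]

/-- The generator `e_j` is sent to the central element multiplied on the right by `a_j`. By
centrality the factor `a_j` moves to the left, and contraction of the central element leaves `a_j
e_0 = a_j`. This is the counterpart of `inclB_mulB` for `a_j`. -/
theorem centralB_projA (j : Fin n) :
    (λₗ (projObj k j.succ)).inv ≫ centralB k n ⊵ₗ projObj k j.succ ≫ projA k j = homA k j := by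
  apply proj_hom_ext
  change outerProj (leftIdeal (idem k n 0)) coefC
    (op (idem k n j.succ * arrowA k j) • (1 : StarAlg k n) • centralElem k n) =
      idem k n j.succ • leftA k j
  have h : idem k n j.succ * arrowA k j = arrowA k j := by
    ext <;> simp [arrowA, idem, Pi.single_apply]
  rw [h, outerProj_op_smul_centralElem]
  apply Subtype.ext
  change arrowA k j * idem k n 0 = idem k n j.succ * arrowA k j
  rw [h]
  exact (leftA k j).2

end Relations

/-! ### Relations in the universal birepresentation -/

section UniversalRelations

open MonoidalLeftAction StarAlg

variable {k : Type u} [Field k] {n : ℕ} {P : StarPartition n} (D : CWRData k P)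

namespace CWRData

/-- The components of the universal cone. -/
def x (s : P.Step) (b : StarBicat k n) :
    D.Ω.functor.obj (b ⊙ₗ projObj k (P.src s).succ) ≅
      D.Ω.functor.obj (b ⊙ₗ projObj k (P.tgt s).succ) :=
  (StrongTrans.modEval (M := birepP k n) (N := D.CWR) b).mapIso (D.totalCone.iso s)

theorem x_naturality (s : P.Step) {b b' : StarBicat k n} (f : b ⟶ b') :
    D.Ω.functor.map (f ⊵ₗ projObj k (P.src s).succ) ≫ (D.x s b').hom =
      (D.x s b).hom ≫ D.Ω.functor.map (f ⊵ₗ projObj k (P.tgt s).succ) :=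
  (Modification.nat (D.totalCone.iso s).hom).naturality f

theorem x_Gamma (s : P.Step) (N : (birepN k n).carrier) :
    (D.x s ((Gamma k n).functor.obj N)).hom =
      D.Ω.functor.map (sApp k (P.src s) (P.tgt s) ⟨(Gamma k n).functor.obj N, N.2⟩).hom :=
  D.compatible_totalCone s N

/-- The isomorphisms between the images of the indecomposable projective modules in a block. -/
def xUnit (s : P.Step) : D.Ω.functor.obj (projObj k (P.src s).succ) ≅
    D.Ω.functor.obj (projObj k (P.tgt s).succ) :=
  D.Ω.functor.mapIso (λₗ _).symm ≪≫ D.x s (𝟙_ _) ≪≫ D.Ω.functor.mapIso (λₗ _)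

/-- Naturality of the cone along the multiplication `A e_0 ⊗ e_0 A ⟶ A` relates its component at the
unit to its component on `N`, which is `Ω(s)`; and `s` fixes the inclusion through which right
multiplication by `b` factors. -/
theorem map_homB_xUnit (s : P.Step) :
    D.Ω.functor.map (homB k (P.src s)) ≫ (D.xUnit s).hom = D.Ω.functor.map (homB k (P.tgt s)) := by
  have h := D.x_naturality s (mulB k n)
  rw [x_Gamma] at h
  rw [← inclB_mulB, ← inclB_mulB, ← inclB_sApp k (P.src s) (P.tgt s)]
  simp only [xUnit, Functor.map_comp, Category.assoc, Iso.trans_hom, Functor.mapIso_hom,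
    Iso.symm_hom, Iso.map_hom_inv_id_assoc]
  rw [reassoc_of% h]

/-- The dual argument: naturality along `A ⟶ A e_0 ⊗ e_0 A`, and compatibility of `s` with the
projections through which right multiplication by `a` factors. -/
theorem xUnit_map_homA (s : P.Step) :
    (D.xUnit s).hom ≫ D.Ω.functor.map (homA k (P.tgt s)) = D.Ω.functor.map (homA k (P.src s)) := by
  have h := D.x_naturality s (centralB k n)
  rw [x_Gamma] at h
  rw [← centralB_projA, ← centralB_projA, ← sApp_projA k (P.src s) (P.tgt s)]
  simp only [xUnit, Functor.map_comp, Category.assoc, Iso.trans_hom, Functor.mapIso_hom,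
    Iso.symm_hom, Iso.map_hom_inv_id_assoc]
  rw [reassoc_of% h]

end CWRData

end UniversalRelations

/-! ### Decompositions into indecomposable projective modules -/

section Decomposition

open StarAlg

theorem sum_comp_eq_id {E : Type w} [Category.{v} E] [Preadditive E] {Q : ObjectProperty E}
    {ι : Type} [Fintype ι] {X : Q.FullSubcategory} {Y : ι → Q.FullSubcategory}
    (p : ∀ i, X ⟶ Y i) (q : ∀ i, Y i ⟶ X) (h : ∑ i, (p i).hom ≫ (q i).hom = 𝟙 X.obj) :
    ∑ i, p i ≫ q i = 𝟙 X := by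
  apply Q.ι.map_injective
  rw [Functor.map_sum, CategoryTheory.Functor.map_id]
  exact h

variable {k : Type u} [Field k] {n : ℕ}

theorem sum_idem : ∑ i, idem k n i = 1 := by
  have h : ∑ i : Fin n, idem k n i.succ = (⟨0, 0, 1, 0, 0⟩ : StarAlg k n) := by
    let φ : (Fin n → k) →+ StarAlg k n :=
      AddMonoidHom.mk' (fun y => ⟨0, 0, y, 0, 0⟩) (fun y z => by ext <;> simp)
    have h (i : Fin n) : idem k n i.succ = φ (Pi.single i ((1 : Fin n → k) i)) := rfl
    simp only [h]
    rw [← map_sum, Finset.univ_sum_single]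
    rfl
  rw [Fin.sum_univ_succ, h]
  ext <;> simp [idem]

/-- Right multiplication by `e_i`, as a map from `A` to `A e_i`. -/
def toLeftIdeal (i : Fin (n + 1)) : StarAlg k n →ₗ[StarAlg k n] leftIdeal (idem k n i) :=
  LinearMap.toSpanSingleton (StarAlg k n) (leftIdeal (idem k n i)) (gen k n i)

theorem regular_inAdd :
    inAdd (fun Y => ∃ i, Y = (projObj k i).obj) (ModuleCat.of (StarAlg k n) (StarAlg k n)) := by
  refine ⟨Fin (n + 1), inferInstance, fun i => (projObj k i).obj,
    fun i => ModuleCat.ofHom (toLeftIdeal i),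
    fun i => ModuleCat.ofHom (leftIdeal (idem k n i)).subtype, fun i => ⟨i, rfl⟩, ?_⟩
  refine ModuleCat.hom_ext (LinearMap.ext fun x => ?_)
  rw [ModuleCat.hom_sum, LinearMap.sum_apply]
  change ∑ i, x * idem k n i = x
  rw [← Finset.mul_sum, sum_idem, mul_one]

theorem inAdd_projObj (Z : (birepC k n).carrier) : inAdd (fun Y => ∃ i, Y = projObj k i) Z := by
  obtain ⟨ι, _, Y, p, q, hY, h⟩ :=
    inAdd_trans (fun _ h => by rw [h]; exact regular_inAdd) ((isProj_iff_inAdd Z.obj).1 Z.2)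
  choose i hi using hY
  obtain rfl : Y = fun j => (projObj k (i j)).obj := funext hi
  refine ⟨ι, inferInstance, fun j => projObj k (i j), fun j => ObjectProperty.homMk (p j),
    fun j => ObjectProperty.homMk (q j), fun j => ⟨i j, rfl⟩, ?_⟩
  exact sum_comp_eq_id (fun j => ObjectProperty.homMk (p j)) (fun j => ObjectProperty.homMk (q j)) h

end Decomposition

/-! ### Morphisms between the images of the indecomposable projective modules -/

namespace StarPartition

variable {n : ℕ} (P : StarPartition n)

/-- The vertices `0` and `i^m_l`. -/
abbrev Vertex : Type := Option (Σ m : Fin P.r, Fin (P.len m))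

variable {P}

/-- The vertices as elements of `{0, …, n}`. -/
def Vertex.toFin : P.Vertex → Fin (n + 1)
  | none => 0
  | some x => (P.enum x).succ

theorem Vertex.toFin_bijective : Function.Bijective (Vertex.toFin (P := P)) := by
  refine ⟨?_, fun i => ?_⟩
  · rintro (_ | x) (_ | y) h
    · rfl
    · exact absurd h.symm (Fin.succ_ne_zero _)
    · exact absurd h (Fin.succ_ne_zero _)
    · exact congrArg some (P.enum.injective (Fin.succ_injective _ h))
  · refine Fin.cases ⟨none, rfl⟩ (fun i => ⟨some (P.enum.symm i), ?_⟩) i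
    simp [Vertex.toFin]

/-- The first element of the block of a vertex. -/
def Vertex.first : P.Vertex → P.Vertex
  | none => none
  | some x => some ⟨x.1, ⟨0, P.len_pos x.1⟩⟩

end StarPartition

/-! ### Fullness of Ω up to the isomorphisms within blocks -/

section Fullness

open MonoidalLeftAction StarAlg StarPartition

variable {k : Type u} [Field k] {n : ℕ} {P : StarPartition n}

variable (k) in
/-- The indecomposable projective module of a vertex. -/
abbrev projVertex (v : P.Vertex) : (birepC k n).carrier := projObj k v.toFin

namespace CWRData

variable (D : CWRData k P)

instance : D.Ω.functor.Additive := D.Ω.additive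

instance : D.Ω.functor.Linear k := D.Ω.linear

/-- The isomorphism from the image of the first indecomposable projective module of a block. -/
def blockIsoAux (m : Fin P.r) : ∀ (l : ℕ) (h : l < P.len m),
    D.Ω.functor.obj (projObj k (P.enum ⟨m, ⟨0, P.len_pos m⟩⟩).succ) ≅
      D.Ω.functor.obj (projObj k (P.enum ⟨m, ⟨l, h⟩⟩).succ)
  | 0, _ => Iso.refl _
  | l + 1, h => blockIsoAux m l (by omega) ≪≫ D.xUnit ⟨m, ⟨l, by omega⟩⟩

/-- Induction along the chain of isomorphisms `xUnit`, each of which respects the arrows. -/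
theorem map_homB_blockIsoAux (m : Fin P.r) : ∀ (l : ℕ) (h : l < P.len m),
    D.Ω.functor.map (homB k (P.enum ⟨m, ⟨0, P.len_pos m⟩⟩)) ≫ (D.blockIsoAux m l h).hom =
      D.Ω.functor.map (homB k (P.enum ⟨m, ⟨l, h⟩⟩))
  | 0, _ => Category.comp_id _
  | l + 1, h => by
    refine (Category.assoc _ _ _).symm.trans ?_
    refine (congrArg (fun f => f ≫ (D.xUnit ⟨m, ⟨l, by omega⟩⟩).hom)
      (map_homB_blockIsoAux m l (by omega))).trans ?_
    exact D.map_homB_xUnit ⟨m, ⟨l, by omega⟩⟩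

theorem blockIsoAux_map_homA (m : Fin P.r) : ∀ (l : ℕ) (h : l < P.len m),
    (D.blockIsoAux m l h).hom ≫ D.Ω.functor.map (homA k (P.enum ⟨m, ⟨l, h⟩⟩)) =
      D.Ω.functor.map (homA k (P.enum ⟨m, ⟨0, P.len_pos m⟩⟩))
  | 0, _ => Category.id_comp _
  | l + 1, h => by
    refine (Category.assoc _ _ _).trans ?_
    refine (congrArg (fun f => (D.blockIsoAux m l (by omega)).hom ≫ f)
      (D.xUnit_map_homA ⟨m, ⟨l, by omega⟩⟩)).trans ?_
    exact blockIsoAux_map_homA m l (by omega)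

/-- The isomorphism from the image of the first indecomposable projective module of the block of a
vertex. -/
def blockIso : ∀ v : P.Vertex, D.Ω.functor.obj (projVertex k v.first) ≅
    D.Ω.functor.obj (projVertex k v)
  | none => Iso.refl _
  | some ⟨m, l⟩ => D.blockIsoAux m l.1 l.2

/-- The morphisms which are images of morphisms of `C`, up to the isomorphisms `blockIso`. -/
def Lifts {v v' : P.Vertex}
    (f : D.Ω.functor.obj (projVertex k v) ⟶ D.Ω.functor.obj (projVertex k v')) : Prop :=
  ∃ g : projVertex k v.first ⟶ projVertex k v'.first,
    f = (D.blockIso v).inv ≫ D.Ω.functor.map g ≫ (D.blockIso v').hom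

variable {D}

theorem Lifts.comp {v v' v'' : P.Vertex}
    {f : D.Ω.functor.obj (projVertex k v) ⟶ D.Ω.functor.obj (projVertex k v')}
    {g : D.Ω.functor.obj (projVertex k v') ⟶ D.Ω.functor.obj (projVertex k v'')}
    (hf : D.Lifts f) (hg : D.Lifts g) : D.Lifts (f ≫ g) := by
  obtain ⟨f', rfl⟩ := hf
  obtain ⟨g', rfl⟩ := hg
  exact ⟨f' ≫ g', by simp⟩

theorem Lifts.add {v v' : P.Vertex}
    {f g : D.Ω.functor.obj (projVertex k v) ⟶ D.Ω.functor.obj (projVertex k v')}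
    (hf : D.Lifts f) (hg : D.Lifts g) : D.Lifts (f + g) := by
  obtain ⟨f', rfl⟩ := hf
  obtain ⟨g', rfl⟩ := hg
  exact ⟨f' + g', by simp [Functor.map_add]⟩

theorem Lifts.smul (c : k) {v v' : P.Vertex}
    {f : D.Ω.functor.obj (projVertex k v) ⟶ D.Ω.functor.obj (projVertex k v')}
    (hf : D.Lifts f) : D.Lifts (c • f) := by
  obtain ⟨f', rfl⟩ := hf
  exact ⟨c • f', by simp [Functor.map_smul]⟩

theorem Lifts.map_smul (c : k) {v v' : P.Vertex} {f : projVertex k v ⟶ projVertex k v'}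
    (hf : D.Lifts (D.Ω.functor.map f)) : D.Lifts (D.Ω.functor.map (c • f)) := by
  rw [Functor.map_smul]
  exact hf.smul c

variable (D)

theorem lifts_zero (v v' : P.Vertex) : D.Lifts (0 : D.Ω.functor.obj (projVertex k v) ⟶
    D.Ω.functor.obj (projVertex k v')) :=
  ⟨0, by simp⟩

theorem lifts_sum {ι : Type} (s : Finset ι) {v v' : P.Vertex}
    (f : ι → (D.Ω.functor.obj (projVertex k v) ⟶ D.Ω.functor.obj (projVertex k v')))
    (h : ∀ i, D.Lifts (f i)) : D.Lifts (∑ i ∈ s, f i) :=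
  Finset.sum_induction f D.Lifts (fun _ _ => .add) (D.lifts_zero v v') fun i _ => h i

theorem lifts_id (v : P.Vertex) : D.Lifts (𝟙 (D.Ω.functor.obj (projVertex k v))) :=
  ⟨𝟙 _, by simp⟩

theorem lifts_map_id (v : P.Vertex) : D.Lifts (D.Ω.functor.map (𝟙 (projVertex k v))) := by
  rw [CategoryTheory.Functor.map_id]
  exact D.lifts_id v

theorem lifts_map_zero (v v' : P.Vertex) :
    D.Lifts (D.Ω.functor.map (0 : projVertex k v ⟶ projVertex k v')) := by
  rw [Functor.map_zero]
  exact D.lifts_zero v v'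

/-- Unless both vertices are `0`, where `blockIso` is the identity, the morphism is a multiple of a
single arrow or of an identity, or zero. The isomorphisms `blockIso` carry an arrow of a leaf to the
arrow of the first leaf of its block. -/
theorem lifts_map : ∀ {v v' : P.Vertex} (f : projVertex k v ⟶ projVertex k v'),
    D.Lifts (D.Ω.functor.map f)
  | none, none, f => ⟨f, ((Category.id_comp _).trans (Category.comp_id _)).symm⟩
  | none, some ⟨m, l⟩, f => by
    obtain ⟨c, rfl⟩ := hom_zero_succ f
    exact Lifts.map_smul (v := none) (v' := some ⟨m, l⟩) c ⟨homB k _, ((Category.id_comp _).trans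
      (D.map_homB_blockIsoAux m l.1 l.2)).symm⟩
  | some ⟨m, l⟩, none, f => by
    obtain ⟨c, rfl⟩ := hom_succ_zero f
    refine Lifts.map_smul (v := some ⟨m, l⟩) (v' := none) c ⟨homA k _, ?_⟩
    exact ((D.blockIsoAux m l.1 l.2).eq_inv_comp).2
      ((D.blockIsoAux_map_homA m l.1 l.2).trans (Category.comp_id _).symm)
  | some x, some y, f => by
    by_cases h : x = y
    · subst h
      obtain ⟨c, rfl⟩ := hom_succ_self f
      exact Lifts.map_smul (v := some x) (v' := some x) c (D.lifts_map_id (some x))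
    · obtain rfl := hom_succ_succ (fun h' => h (P.enum.injective h')) f
      exact D.lifts_map_zero (some x) (some y)

/-- The isomorphism between the images of the indecomposable projective modules of two elements of
the same block. -/
def blockIso₂ (m : Fin P.r) (l l' : Fin (P.len m)) :
    D.Ω.functor.obj (projVertex k (some ⟨m, l⟩ : P.Vertex)) ≅
      D.Ω.functor.obj (projVertex k (some ⟨m, l'⟩ : P.Vertex)) :=
  (D.blockIsoAux m l.1 l.2).symm ≪≫ D.blockIsoAux m l'.1 l'.2

theorem lifts_blockIso₂ (m : Fin P.r) (l l' : Fin (P.len m)) :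
    D.Lifts (v := some ⟨m, l⟩) (v' := some ⟨m, l'⟩) (D.blockIso₂ m l l').hom := by
  refine ⟨𝟙 (projVertex k (Vertex.first (some ⟨m, l⟩))), ?_⟩
  have h : D.Ω.functor.map (𝟙 (projVertex k (Vertex.first (some ⟨m, l⟩ : P.Vertex)))) = 𝟙 _ :=
    D.Ω.functor.map_id _
  have h' := (congrArg (fun f => f ≫ (D.blockIso (some ⟨m, l'⟩)).hom) h).trans
    (Category.id_comp (D.blockIso (some ⟨m, l'⟩)).hom)
  exact (congrArg (fun f => (D.blockIso (some ⟨m, l⟩)).inv ≫ f) h').symm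

theorem xUnit_eq_blockIso₂ (s : P.Step) : D.xUnit s =
    D.blockIso₂ s.1 ⟨s.2.1, by have := s.2.2; omega⟩ ⟨s.2.1 + 1, by have := s.2.2; omega⟩ := by
  ext
  exact ((Iso.inv_hom_id_assoc (D.blockIsoAux s.1 s.2.1 (by have := s.2.2; omega)) _)).symm

/-- The morphisms `f` whose compositions with the images of morphisms from and to indecomposable
projective modules are images of morphisms of `C`, up to the isomorphisms `blockIso`. -/
def Controlled {X Y : (birepC k n).carrier} (f : D.Ω.functor.obj X ⟶ D.Ω.functor.obj Y) : Prop :=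
  ∀ (v v' : P.Vertex) (p : projVertex k v ⟶ X) (q : Y ⟶ projVertex k v'),
    D.Lifts (D.Ω.functor.map p ≫ f ≫ D.Ω.functor.map q)

variable {D}

theorem controlled_map {X Y : (birepC k n).carrier} (f : X ⟶ Y) :
    D.Controlled (D.Ω.functor.map f) := fun v v' p q => by
  rw [← Functor.map_comp, ← Functor.map_comp]
  exact D.lifts_map _

theorem Controlled.add {X Y : (birepC k n).carrier} {f g : D.Ω.functor.obj X ⟶ D.Ω.functor.obj Y}
    (hf : D.Controlled f) (hg : D.Controlled g) : D.Controlled (f + g) := fun v v' p q => by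
  rw [Preadditive.add_comp, Preadditive.comp_add]
  exact (hf v v' p q).add (hg v v' p q)

theorem Controlled.smul (c : k) {X Y : (birepC k n).carrier}
    {f : D.Ω.functor.obj X ⟶ D.Ω.functor.obj Y} (hf : D.Controlled f) :
    D.Controlled (c • f) := fun v v' p q => by
  rw [Linear.smul_comp, Linear.comp_smul]
  exact (hf v v' p q).smul c

theorem controlled_zero {X Y : (birepC k n).carrier} :
    D.Controlled (0 : D.Ω.functor.obj X ⟶ D.Ω.functor.obj Y) := fun v v' p q => by
  rw [Limits.zero_comp, Limits.comp_zero]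
  exact D.lifts_zero v v'

theorem controlled_sum {ι : Type} (s : Finset ι) {X Y : (birepC k n).carrier}
    (f : ι → (D.Ω.functor.obj X ⟶ D.Ω.functor.obj Y)) (h : ∀ i, D.Controlled (f i)) :
    D.Controlled (∑ i ∈ s, f i) :=
  Finset.sum_induction f D.Controlled (fun _ _ => .add) controlled_zero fun i _ => h i

theorem exists_vertex_decomposition (Z : (birepC k n).carrier) :
    ∃ (ι : Type) (_ : Fintype ι) (v : ι → P.Vertex) (p : ∀ i, Z ⟶ projVertex k (v i))
      (q : ∀ i, projVertex k (v i) ⟶ Z), ∑ i, p i ≫ q i = 𝟙 Z := by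
  obtain ⟨ι, _, Y, p, q, hY, h⟩ := inAdd_projObj Z
  choose i hi using hY
  choose v hv using fun j => (Vertex.toFin_bijective (P := P)).2 (i j)
  obtain rfl : Y = fun j => projVertex k (v j) := funext fun j => by rw [hi, ← hv]
  exact ⟨ι, inferInstance, v, p, q, h⟩

/-- Insert at the middle object `Y` a decomposition of its identity through indecomposable
projectives; each summand is then a composite of two lifting morphisms. -/
theorem Controlled.comp {X Y Z : (birepC k n).carrier}
    {f : D.Ω.functor.obj X ⟶ D.Ω.functor.obj Y} {g : D.Ω.functor.obj Y ⟶ D.Ω.functor.obj Z}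
    (hf : D.Controlled f) (hg : D.Controlled g) : D.Controlled (f ≫ g) := fun v v' p q => by
  obtain ⟨ι, _, w, p', q', h⟩ := exists_vertex_decomposition (P := P) Y
  have h' : ∑ i, D.Ω.functor.map (p' i) ≫ D.Ω.functor.map (q' i) = 𝟙 _ := by
    rw [← CategoryTheory.Functor.map_id, ← h, Functor.map_sum]
    simp only [Functor.map_comp]
  have : D.Ω.functor.map p ≫ (f ≫ g) ≫ D.Ω.functor.map q =
      ∑ i, (D.Ω.functor.map p ≫ f ≫ D.Ω.functor.map (p' i)) ≫
        (D.Ω.functor.map (q' i) ≫ g ≫ D.Ω.functor.map q) := by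
    conv_lhs => rw [← Category.id_comp g, ← h', Preadditive.sum_comp, Preadditive.comp_sum,
      Preadditive.sum_comp, Preadditive.comp_sum]
    simp only [Category.assoc]
  rw [this]
  exact D.lifts_sum _ _ fun i => (hf v _ p (p' i)).comp (hg _ v' (q' i) q)

theorem controlled_of_lifts {v v' : P.Vertex}
    {f : D.Ω.functor.obj (projVertex k v) ⟶ D.Ω.functor.obj (projVertex k v')}
    (hf : D.Lifts f) : D.Controlled f := fun _ _ p q =>
  (D.lifts_map p).comp (hf.comp (D.lifts_map q))

theorem Controlled.lifts {v v' : P.Vertex}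
    {f : D.Ω.functor.obj (projVertex k v) ⟶ D.Ω.functor.obj (projVertex k v')}
    (hf : D.Controlled f) : D.Lifts f := by
  have := hf v v' (𝟙 _) (𝟙 _)
  rwa [CategoryTheory.Functor.map_id, CategoryTheory.Functor.map_id, Category.comp_id, Category.id_comp] at this

variable (D)

/-- The component at the unit in terms of `xUnit`. -/
theorem x_unit (s : P.Step) : D.x s (𝟙_ _) =
    D.Ω.functor.mapIso (λₗ _) ≪≫ D.xUnit s ≪≫ D.Ω.functor.mapIso (λₗ _).symm := by
  ext
  simp [xUnit]

theorem controlled_blockIso₂ (m : Fin P.r) (l l' : Fin (P.len m)) :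
    D.Controlled (D.blockIso₂ m l l').hom :=
  controlled_of_lifts (v := some ⟨m, l⟩) (v' := some ⟨m, l'⟩) (D.lifts_blockIso₂ m l l')

theorem controlled_xUnit (s : P.Step) : D.Controlled (D.xUnit s).hom ∧
    D.Controlled (D.xUnit s).inv := by
  rw [xUnit_eq_blockIso₂]
  exact ⟨D.controlled_blockIso₂ _ _ _, D.controlled_blockIso₂ s.1 ⟨s.2.1 + 1, _⟩ ⟨s.2.1, _⟩⟩

/-- At the unit bimodule the component is `xUnit` up to unitors, an isomorphism inside a block. At a
bimodule in `N` it is the image under `Ω` of a component of `s`, by the relation imposed by the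
coequifier. -/
theorem controlled_x_generator (s : P.Step) (b : StarBicat k n) (hb : genB k n b.1) :
    D.Controlled (D.x s b).hom ∧ D.Controlled (D.x s b).inv := by
  obtain ⟨b, hb'⟩ := b
  obtain rfl | hb := hb
  · change D.Controlled (D.x s (𝟙_ _)).hom ∧ D.Controlled (D.x s (𝟙_ _)).inv
    rw [x_unit]
    obtain ⟨h₁, h₂⟩ := D.controlled_xUnit s
    exact ⟨(controlled_map _).comp (h₁.comp (controlled_map _)),
      ((controlled_map _).comp h₂).comp (controlled_map _)⟩
  · have h := D.x_Gamma s ⟨b, inAdd_of hb⟩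
    change (D.x s ⟨b, hb'⟩).hom = (D.Ω.functor.mapIso (sApp k (P.src s) (P.tgt s)
      ⟨⟨b, hb'⟩, inAdd_of hb⟩)).hom at h
    rw [Iso.ext h]
    exact ⟨controlled_map _, controlled_map _⟩

theorem x_inv_naturality (s : P.Step) {b b' : StarBicat k n} (f : b ⟶ b') :
    D.Ω.functor.map (f ⊵ₗ projObj k (P.tgt s).succ) ≫ (D.x s b').inv =
      (D.x s b).inv ≫ D.Ω.functor.map (f ⊵ₗ projObj k (P.src s).succ) := by
  rw [Iso.comp_inv_eq, Category.assoc, x_naturality, Iso.inv_hom_id_assoc]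

/-- A bimodule `b` is a retract of a finite sum of generators. Naturality in `b` writes the
component at `b` as a sum of components at generators composed with images of morphisms of `C`. -/
theorem controlled_x (s : P.Step) (b : StarBicat k n) :
    D.Controlled (D.x s b).hom ∧ D.Controlled (D.x s b).inv := by
  obtain ⟨ι, _, Y, p, q, hY, h⟩ := b.2
  let Z (i : ι) : StarBicat k n := ⟨Y i, inAdd_of (hY i)⟩
  let p' (i : ι) : b ⟶ Z i := ObjectProperty.homMk (p i)
  let q' (i : ι) : Z i ⟶ b := ObjectProperty.homMk (q i)
  have h' : ∑ i, p' i ≫ q' i = 𝟙 b := sum_comp_eq_id p' q' h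
  -- The functor `b ↦ Ω(b ⊙ X)` is additive, so it preserves the decomposition of the identity of
  -- `b`.
  have h'' (X : (birepC k n).carrier) : ∑ i, D.Ω.functor.map (p' i ⊵ₗ X) ≫
      D.Ω.functor.map (q' i ⊵ₗ X) = 𝟙 (D.Ω.functor.obj (b ⊙ₗ X)) := by
    let F := (evalTrans k (birepC k n) X).functor ⋙ D.Ω.functor
    have : (evalTrans k (birepC k n) X).functor.Additive := (evalTrans k (birepC k n) X).additive
    have h₁ := congrArg F.map h'
    rw [Functor.map_sum, CategoryTheory.Functor.map_id] at h₁
    refine Eq.trans (Finset.sum_congr rfl fun i _ => ?_) h₁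
    exact (F.map_comp (p' i) (q' i)).symm
  constructor
  · have : (D.x s b).hom = ∑ i, D.Ω.functor.map (p' i ⊵ₗ projObj k (P.src s).succ) ≫
        (D.x s (Z i)).hom ≫ D.Ω.functor.map (q' i ⊵ₗ projObj k (P.tgt s).succ) := by
      refine (Category.id_comp _).symm.trans ((congrArg (fun f => f ≫ (D.x s b).hom)
        (h'' _).symm).trans ((Preadditive.sum_comp _ _ _).trans (Finset.sum_congr rfl fun i _ => ?_)))
      rw [Category.assoc, x_naturality]
    rw [this]
    exact controlled_sum _ _ fun i => (controlled_map _).comp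
      ((D.controlled_x_generator s (Z i) (hY i)).1.comp (controlled_map _))
  · have : (D.x s b).inv = ∑ i, D.Ω.functor.map (p' i ⊵ₗ projObj k (P.tgt s).succ) ≫
        (D.x s (Z i)).inv ≫ D.Ω.functor.map (q' i ⊵ₗ projObj k (P.src s).succ) := by
      refine (Category.id_comp _).symm.trans ((congrArg (fun f => f ≫ (D.x s b).inv)
        (h'' _).symm).trans ((Preadditive.sum_comp _ _ _).trans (Finset.sum_congr rfl fun i _ => ?_)))
      rw [Category.assoc, x_inv_naturality]
    rw [this]
    exact controlled_sum _ _ fun i => (controlled_map _).comp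
      ((D.controlled_x_generator s (Z i) (hY i)).2.comp (controlled_map _))

theorem controlled_of_generated {X Y : (birepC k n).carrier}
    {f : D.totalCone.trans.functor.obj X ⟶ D.totalCone.trans.functor.obj Y}
    (h : D.totalCone.Generated f) : D.Controlled f := by
  induction h with
  | of f => exact controlled_map f
  | hom s b => exact (D.controlled_x s b).1
  | inv s b => exact (D.controlled_x s b).2
  | comp _ _ hf hg => exact hf.comp hg
  | add _ _ hf hg => exact hf.add hg
  | smul c _ hf => exact hf.smul c

/-- Up to the isomorphisms `blockIso`, every morphism between the images of indecomposable
projective modules is the image of a morphism of `C`. -/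
theorem lifts {v v' : P.Vertex}
    (f : D.Ω.functor.obj (projVertex k v) ⟶ D.Ω.functor.obj (projVertex k v')) : D.Lifts f :=
  (D.controlled_of_generated (D.generated_and_essSurj.1 f)).lifts

instance : D.Ω.functor.Faithful := D.faithful

theorem exists_map_eq_smul {v v' : P.Vertex} (c : k)
    {g : projVertex k v.first ⟶ projVertex k v'.first} {g' : projVertex k v ⟶ projVertex k v'}
    (h : (D.blockIso v).inv ≫ D.Ω.functor.map g ≫ (D.blockIso v').hom = D.Ω.functor.map g') :
    D.Ω.functor.map (c • g') =
      (D.blockIso v).inv ≫ D.Ω.functor.map (c • g) ≫ (D.blockIso v').hom := by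
  rw [Functor.map_smul, Functor.map_smul, Linear.smul_comp, Linear.comp_smul, h]

/-- A lift is a morphism between the first vertices of the two blocks. When the vertices are equal
or lie in different blocks, it is matched by the isomorphisms `blockIso` with the corresponding
arrow, identity or zero between the given vertices. The excluded case is that of distinct leaves of
one block: there the lift may be an identity, which has no counterpart in `C`. -/
theorem exists_map_eq : ∀ {v v' : P.Vertex} (_ : v.first = v'.first → v = v')
    (f : D.Ω.functor.obj (projVertex k v) ⟶ D.Ω.functor.obj (projVertex k v')),
      ∃ g, D.Ω.functor.map g = f
  | none, none, _, f => by
    obtain ⟨g, rfl⟩ := D.lifts f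
    exact ⟨g, ((Category.id_comp _).trans (Category.comp_id _)).symm⟩
  | none, some ⟨m, l⟩, _, f => by
    obtain ⟨g, rfl⟩ := D.lifts f
    obtain ⟨c, rfl⟩ := hom_zero_succ g
    exact ⟨_, D.exists_map_eq_smul (v := none) (v' := some ⟨m, l⟩) c (g' := homB k _)
      ((Category.id_comp _).trans (D.map_homB_blockIsoAux m l.1 l.2))⟩
  | some ⟨m, l⟩, none, _, f => by
    obtain ⟨g, rfl⟩ := D.lifts f
    obtain ⟨c, rfl⟩ := hom_succ_zero g
    exact ⟨_, D.exists_map_eq_smul (v := some ⟨m, l⟩) (v' := none) c (g' := homA k _)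
      (((D.blockIsoAux m l.1 l.2).inv_comp_eq).2
        ((Category.comp_id _).trans (D.blockIsoAux_map_homA m l.1 l.2).symm))⟩
  | some x, some y, h, f => by
    obtain ⟨g, rfl⟩ := D.lifts f
    by_cases hxy : Vertex.first (some x) = Vertex.first (some y)
    · obtain rfl := Option.some.inj (h hxy)
      obtain ⟨c, rfl⟩ := hom_succ_self g
      refine ⟨_, D.exists_map_eq_smul (v := some x) (v' := some x) c
        (g := 𝟙 (projVertex k (Vertex.first (some x)))) (g' := 𝟙 (projVertex k (some x))) ?_⟩
      rw [CategoryTheory.Functor.map_id, CategoryTheory.Functor.map_id, Category.id_comp,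
        Iso.inv_hom_id]
    · obtain rfl := hom_succ_succ (fun h' => hxy (congrArg some (P.enum.injective h'))) g
      refine ⟨0, ?_⟩
      rw [Functor.map_zero]
      refine ((congrArg (fun f => (D.blockIso (some x)).inv ≫ f ≫ (D.blockIso (some y)).hom)
        (D.Ω.functor.map_zero _ _)).trans ?_).symm
      exact (congrArg _ Limits.zero_comp).trans Limits.comp_zero

/-- The images of the indecomposable projective modules of two elements of a block are
isomorphic. -/
theorem nonempty_iso_of_first_eq {v v' : P.Vertex} (h : v.first = v'.first) :
    Nonempty (D.Ω.functor.obj (projVertex k v) ≅ D.Ω.functor.obj (projVertex k v')) :=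
  ⟨(D.blockIso v).symm ≪≫ eqToIso (by rw [h]) ≪≫ D.blockIso v'⟩

variable (k) in
theorem hom_eq_zero_of_first_eq : ∀ {v v' : P.Vertex} (_ : v ≠ v') (_ : v.first = v'.first)
    (f : projVertex k v ⟶ projVertex k v'), f = 0
  | none, none, h, _, _ => absurd rfl h
  | none, some _, _, h, _ => absurd h (by simp [Vertex.first])
  | some _, none, _, h, _ => absurd h (by simp [Vertex.first])
  | some _, some _, h, _, f =>
    hom_succ_succ (fun h' => h (congrArg some (P.enum.injective h'))) f

end CWRData

end Fullness

/-! ### Indecomposable projective modules -/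

section Indecomposables

open StarAlg StarPartition

/-- An indecomposable module is isomorphic to each of its nonzero retracts. -/
theorem bijective_of_retract {R : Type u} [Ring R] {X Y : ModuleCat.{u} R} (hX : Indecomposable X)
    (hY : Nontrivial Y) (i : Y ⟶ X) (p : X ⟶ Y) (h : i ≫ p = 𝟙 Y) : Function.Bijective p.hom := by
  have h' : p.hom.comp i.hom = LinearMap.id := congrArg ModuleCat.Hom.hom h
  have hs : Function.Surjective p.hom := fun y => ⟨i.hom y, DFunLike.congr_fun h' y⟩
  refine ⟨LinearMap.ker_eq_bot.1 ?_, hs⟩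
  -- The section `i` splits `X` as the direct sum of `ker p` and `Y`. Since `Y` is nonzero,
  -- indecomposability forces `ker p = 0`.
  have e := lequivProdOfRightSplitExact (j := (LinearMap.ker p.hom).subtype) (g := p.hom)
    (f := i.hom) (Submodule.injective_subtype _) (by simp) h'
  obtain h₁ | h₁ := hX.2 (ModuleCat.of R (LinearMap.ker p.hom)) Y
    (e.toModuleIso.symm ≪≫ (ModuleCat.biprodIsoProd (ModuleCat.of R (LinearMap.ker p.hom)) Y).symm)
  · rw [ModuleCat.isZero_iff_subsingleton] at h₁
    exact (Submodule.subsingleton_iff_eq_bot).1 h₁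
  · rw [ModuleCat.isZero_iff_subsingleton] at h₁
    exact absurd h₁ (not_subsingleton _)

variable {k : Type u} [Field k] {n : ℕ}

instance nontrivial_projObj (i : Fin (n + 1)) : Nontrivial (projObj k i).obj := by
  refine ⟨gen k n i, (0 : leftIdeal (idem k n i)), fun h => ?_⟩
  have h' : idem k n i = 0 := congrArg Subtype.val h
  refine Fin.cases (fun h' => ?_) (fun i h' => ?_) i h'
  · simpa [idem] using congrArg StarAlg.e₀ h'
  · simpa [idem] using congrArg (fun x => StarAlg.e x i) h'

/-- The elements of the radical of `A`. -/
def IsRad (y : StarAlg k n) : Prop := y.e₀ = 0 ∧ y.e = 0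

theorem evalGen_comp {i j l : Fin (n + 1)} (f : projObj k i ⟶ projObj k j)
    (g : projObj k j ⟶ projObj k l) : evalGen (f ≫ g) = evalGen f * evalGen g :=
  congrArg Subtype.val (proj_hom_apply g (f.hom.hom (gen k n i) : leftIdeal (idem k n j)))

/-- A morphism outside the radical must connect a vertex to itself. At a leaf it is a nonzero
scalar; at `0` it lies in `e_0 A e_0`, the dual numbers in `c`, and has nonzero constant term. -/
theorem exists_inverse_of_not_isRad {i j : Fin (n + 1)} (f : projObj k i ⟶ projObj k j)
    (hf : ¬ IsRad (evalGen f)) : ∃ g, f ≫ g = 𝟙 (projObj k i) := by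
  revert f
  refine Fin.cases (Fin.cases ?_ ?_ j) (fun i => Fin.cases ?_ (fun j => ?_) j) i
  · intro f hf
    have h : idem k n 0 * evalGen f * idem k n 0 = evalGen f := by
      rw [idem_mul_evalGen, evalGen_mul_idem]
    have he : (evalGen f).e = 0 := by rw [← h]; ext l; simp [idem]
    have ha : (evalGen f).a = 0 := by rw [← h]; ext l; simp [idem]
    have hb : (evalGen f).b = 0 := by rw [← h]; ext l; simp [idem]
    have h₀ : (evalGen f).e₀ ≠ 0 := fun h₀ => hf ⟨h₀, he⟩
    -- As `c² = 0`, the inverse of `λ e_0 + μ c` is `λ⁻¹ e_0 - λ⁻² μ c`.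
    refine ⟨rmulHom 0 ((evalGen f).e₀⁻¹ • gen k n 0 -
      ((evalGen f).e₀⁻¹ * (evalGen f).e₀⁻¹ * (evalGen f).c) • leftC k n), evalGen_ext ?_⟩
    rw [evalGen_comp, evalGen_id, evalGen_rmulHom]
    change evalGen f * (idem k n 0 * ((evalGen f).e₀⁻¹ • idem k n 0 -
      ((evalGen f).e₀⁻¹ * (evalGen f).e₀⁻¹ * (evalGen f).c) • loop k n)) = idem k n 0
    rw [sub_eq_add_neg]
    ext l
    · simp [idem, loop, h₀]
    · simp [idem, loop, hb]
      field_simp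
      ring
    all_goals simp [idem, loop, he, ha, hb]
  · intro j f hf
    obtain ⟨c, rfl⟩ := hom_zero_succ f
    refine absurd ?_ hf
    rw [evalGen_smul, homB, evalGen_rmulHom, leftB]
    exact ⟨by simp [arrowB], by ext; simp [arrowB]⟩
  · intro f hf
    obtain ⟨c, rfl⟩ := hom_succ_zero f
    refine absurd ?_ hf
    rw [evalGen_smul, homA, evalGen_rmulHom, leftA]
    exact ⟨by simp [arrowA], by ext; simp [arrowA]⟩
  · intro f hf
    by_cases h : i = j
    · subst h
      obtain ⟨c, rfl⟩ := hom_succ_self f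
      have hc : c ≠ 0 := by
        rintro rfl
        rw [zero_smul] at hf
        exact hf ⟨rfl, rfl⟩
      refine ⟨c⁻¹ • 𝟙 _, ?_⟩
      rw [Linear.smul_comp, Category.id_comp, smul_smul, mul_inv_cancel₀ hc, one_smul]
    · obtain rfl := hom_succ_succ h f
      exact absurd ⟨rfl, rfl⟩ hf

theorem IsRad.mul (x : StarAlg k n) {y : StarAlg k n} (hy : IsRad y) : IsRad (x * y) :=
  ⟨by simp [hy.1], by ext i; simp [hy.2]⟩

/-- The longest nonzero products of arrows are the `b_i a_i = c`, of length two. -/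
theorem IsRad.mul_mul {x y z : StarAlg k n} (hx : IsRad x) (hy : IsRad y) (hz : IsRad z) :
    x * y * z = 0 := by
  ext i <;> simp [hx.1, hx.2, hy.1, hy.2, hz.1, hz.2]

/-- An indecomposable projective module is isomorphic to one of the modules `A e_i`. -/
theorem exists_iso_projObj {X : (birepC k n).carrier} (hX : Indecomposable X.obj) :
    ∃ i, Nonempty (X ≅ projObj k i) := by
  obtain ⟨ι, _, Y, p, q, hY, h⟩ := inAdd_projObj X
  choose v hv using hY
  obtain rfl : Y = fun i => projObj k (v i) := funext hv
  -- The morphisms `q i ≫ p j` form an idempotent matrix representing `X`. If all entries are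
  -- radical, the matrix equals its own cube and vanishes, so `X = 0`. Otherwise some entry is a
  -- split monomorphism, which makes the corresponding `A e_i` a retract of `X`.
  by_cases hr : ∀ i j, IsRad (evalGen (q i ≫ p j))
  · exfalso
    refine hX.1 ?_
    rw [ModuleCat.isZero_iff_subsingleton]
    have hx (x : X.obj) : ∑ i, (q i).hom.hom ((p i).hom.hom x) = x := by
      have := congrArg (fun f => (IsProj (StarAlg k n)).ι.map f) h
      rw [Functor.map_sum] at this
      have := congrArg (fun f => ModuleCat.Hom.hom f x) this
      simpa using this
    let c (j : ι) (x : X.obj) : StarAlg k n :=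
      ((p j).hom.hom x : leftIdeal (idem k n (v j))).1
    have hc (j : ι) (x : X.obj) : c j x = ∑ i, c i x * evalGen (q i ≫ p j) := by
      have h₁ : (p j).hom.hom x = ∑ i, (p j).hom.hom ((q i).hom.hom ((p i).hom.hom x)) := by
        rw [← map_sum, hx]
      have h₂ := congrArg (fun y : leftIdeal (idem k n (v j)) => y.1) h₁
      refine h₂.trans ((AddSubmonoidClass.coe_finsetSum _ _).trans
        (Finset.sum_congr rfl fun i _ => ?_))
      exact congrArg Subtype.val (proj_hom_apply (q i ≫ p j)
        ((p i).hom.hom x : leftIdeal (idem k n (v i))))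
    -- Three applications of `hc` express each coordinate as a sum of terms ending in a product of
    -- three radical elements.
    have h0 (j : ι) (x : X.obj) : c j x = 0 := by
      rw [hc]
      refine Finset.sum_eq_zero fun i _ => ?_
      rw [hc, Finset.sum_mul]
      refine Finset.sum_eq_zero fun l _ => ?_
      rw [hc, Finset.sum_mul, Finset.sum_mul]
      exact Finset.sum_eq_zero fun m _ => IsRad.mul_mul (.mul _ (hr _ _)) (hr _ _) (hr _ _)
    refine subsingleton_of_forall_eq 0 fun x => ?_
    rw [← hx x]
    refine Finset.sum_eq_zero fun i _ => ?_
    have : (p i).hom.hom x = 0 := Subtype.ext (h0 i x)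
    rw [this, map_zero]
  · push Not at hr
    obtain ⟨i, j, hij⟩ := hr
    obtain ⟨g, hg⟩ := exists_inverse_of_not_isRad _ hij
    have hb := bijective_of_retract hX (nontrivial_projObj (v i)) (q i).hom (p j ≫ g).hom (by
      rw [Category.assoc] at hg
      exact congrArg (fun f => f.hom) hg)
    exact ⟨v i, ⟨(IsProj (StarAlg k n)).isoMk (LinearEquiv.ofBijective _ hb).toModuleIso⟩⟩

theorem id_ne_zero_of_indecomposable {X : (birepC k n).carrier} (hX : Indecomposable X.obj) :
    𝟙 X ≠ 0 := fun h =>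
  hX.1 ((Limits.IsZero.iff_id_eq_zero _).2 (congrArg (fun f => (IsProj (StarAlg k n)).ι.map f) h))

variable {P : StarPartition n} (D : CWRData k P)

theorem CWRData.surjective_map {X Y : (birepC k n).carrier} {v v' : P.Vertex}
    (e : X ≅ projVertex k v) (e' : Y ≅ projVertex k v') (h : v.first = v'.first → v = v')
    (f : D.Ω.functor.obj X ⟶ D.Ω.functor.obj Y) : ∃ g, D.Ω.functor.map g = f := by
  obtain ⟨g, hg⟩ := D.exists_map_eq h (D.Ω.functor.map e.inv ≫ f ≫ D.Ω.functor.map e'.hom)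
  refine ⟨e.hom ≫ g ≫ e'.inv, ?_⟩
  rw [Functor.map_comp, Functor.map_comp, hg]
  simp

/-- Replace `X` and `Y` by `A e_i` and `A e_j`. If `i` and `j` are not distinct leaves of one block,
`Ω` is bijective on morphisms in both directions, so an isomorphism of the images lifts to one
between `X` and `Y`. If they are, `Hom(X, Y)` is zero whereas the images are isomorphic and nonzero.
-/
theorem CWRData.bijective_map_iff {X Y : (birepC k n).carrier} (hX : Indecomposable X.obj)
    (hY : Indecomposable Y.obj) :
    Function.Bijective (fun f : X ⟶ Y => D.Ω.functor.map f) ↔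
      ¬ (¬ Nonempty (X ≅ Y) ∧ Nonempty (D.Ω.functor.obj X ≅ D.Ω.functor.obj Y)) := by
  obtain ⟨i, ⟨e⟩⟩ := exists_iso_projObj hX
  obtain ⟨i', ⟨e'⟩⟩ := exists_iso_projObj hY
  obtain ⟨v, rfl⟩ := (Vertex.toFin_bijective (P := P)).2 i
  obtain ⟨v', rfl⟩ := (Vertex.toFin_bijective (P := P)).2 i'
  by_cases h : v.first = v'.first → v = v'
  · refine iff_of_true ⟨D.Ω.functor.map_injective, D.surjective_map e e' h⟩ fun ⟨h₁, ⟨i⟩⟩ => h₁ ?_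
    obtain ⟨g, hg⟩ := D.surjective_map e e' h i.hom
    obtain ⟨g', hg'⟩ := D.surjective_map e' e (fun h' => (h h'.symm).symm) i.inv
    refine ⟨⟨g, g', D.Ω.functor.map_injective ?_, D.Ω.functor.map_injective ?_⟩⟩
    · rw [Functor.map_comp, hg, hg', Iso.hom_inv_id, CategoryTheory.Functor.map_id]
    · rw [Functor.map_comp, hg, hg', Iso.inv_hom_id, CategoryTheory.Functor.map_id]
  · push Not at h
    obtain ⟨h₁, h₂⟩ := h
    have h0 (f : X ⟶ Y) : f = 0 := by
      have := CWRData.hom_eq_zero_of_first_eq k h₂ h₁ (e.inv ≫ f ≫ e'.hom)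
      rwa [Iso.inv_comp_eq, Limits.comp_zero, ← Iso.eq_comp_inv, Limits.zero_comp] at this
    obtain ⟨i⟩ := D.nonempty_iso_of_first_eq h₁
    let i' : D.Ω.functor.obj X ≅ D.Ω.functor.obj Y :=
      D.Ω.functor.mapIso e ≪≫ i ≪≫ D.Ω.functor.mapIso e'.symm
    refine iff_of_false (fun hb => ?_) (not_not.2 ⟨fun ⟨j⟩ => ?_, ⟨i'⟩⟩)
    -- Surjectivity would make the isomorphism `i'` the image of zero, so `Ω(X)` and, by
    -- faithfulness, `X` would be zero.
    · obtain ⟨f, hf⟩ := hb.2 i'.hom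
      refine id_ne_zero_of_indecomposable hX (D.Ω.functor.map_injective ?_)
      change D.Ω.functor.map f = i'.hom at hf
      rw [CategoryTheory.Functor.map_id, ← i'.hom_inv_id, ← hf, h0 f, Functor.map_zero,
        Functor.map_zero, Limits.zero_comp]
    · refine id_ne_zero_of_indecomposable hX ?_
      rw [← j.hom_inv_id, h0 j.hom, Limits.zero_comp]

end Indecomposables

/-! ### Equivalences of additive closures -/

section Generators

universe v₁ w₁ v₂ w₂

variable {C : Type w₁} [Category.{v₁} C] [Preadditive C] {E : Type w₂} [Category.{v₂} E]
  [Preadditive E]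

/-- Idempotent matrices of morphisms between objects in `S` split. -/
def SplitsIdempotents (S : ObjectProperty C) : Prop :=
  ∀ (ι : Type) [Fintype ι] (Y : ι → C) (_ : ∀ i, S (Y i)) (e : ∀ i j, Y i ⟶ Y j)
    (_ : ∀ i j, ∑ l, e i l ≫ e l j = e i j),
      ∃ (X : C) (p : ∀ i, X ⟶ Y i) (q : ∀ i, Y i ⟶ X),
        ∑ i, p i ≫ q i = 𝟙 X ∧ ∀ i j, q i ≫ p j = e i j

theorem eq_sum_of_decompositions {X Y : C} {ι κ : Type} [Fintype ι] [Fintype κ] {A : ι → C}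
    {B : κ → C} {p : ∀ i, X ⟶ A i} {q : ∀ i, A i ⟶ X} (h : ∑ i, p i ≫ q i = 𝟙 X)
    {p' : ∀ i, Y ⟶ B i} {q' : ∀ i, B i ⟶ Y} (h' : ∑ i, p' i ≫ q' i = 𝟙 Y) (f : X ⟶ Y) :
    f = ∑ i, ∑ j, p i ≫ (q i ≫ f ≫ p' j) ≫ q' j := by
  conv_lhs => rw [← Category.id_comp f, ← Category.comp_id f, ← h, ← h']
  simp only [Preadditive.sum_comp, Preadditive.comp_sum, Category.assoc]
  rw [Finset.sum_comm]

variable (F : C ⥤ E) [F.Additive] {S : ObjectProperty C}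

/-- Decompose source and target, lift the entries of the resulting matrix, and reassemble them. -/
theorem full_of_generators (hS : ∀ X, inAdd S X)
    (hF : ∀ X Y, S X → S Y → Function.Surjective (F.map : (X ⟶ Y) → _)) : F.Full where
  map_surjective {X Y} f := by
    obtain ⟨ι, _, A, p, q, hA, h⟩ := hS X
    obtain ⟨κ, _, B, p', q', hB, h'⟩ := hS Y
    choose g hg using fun i j => hF _ _ (hA i) (hB j) (F.map (q i) ≫ f ≫ F.map (p' j))
    refine ⟨∑ i, ∑ j, p i ≫ g i j ≫ q' j, ?_⟩
    have h₁ : ∑ i, F.map (p i) ≫ F.map (q i) = 𝟙 (F.obj X) := by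
      rw [← F.map_id, ← h, F.map_sum]
      simp
    have h₂ : ∑ i, F.map (p' i) ≫ F.map (q' i) = 𝟙 (F.obj Y) := by
      rw [← F.map_id, ← h', F.map_sum]
      simp
    rw [eq_sum_of_decompositions h₁ h₂ f]
    simp only [F.map_sum, F.map_comp, hg]

theorem faithful_of_generators (hS : ∀ X, inAdd S X)
    (hF : ∀ X Y, S X → S Y → Function.Injective (F.map : (X ⟶ Y) → _)) : F.Faithful where
  map_injective {X Y} f g hfg := by
    obtain ⟨ι, _, A, p, q, hA, h⟩ := hS X
    obtain ⟨κ, _, B, p', q', hB, h'⟩ := hS Y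
    rw [eq_sum_of_decompositions h h' f, eq_sum_of_decompositions h h' g]
    refine Finset.sum_congr rfl fun i _ => Finset.sum_congr rfl fun j _ => ?_
    rw [hF _ _ (hA i) (hB j) (a₁ := q i ≫ f ≫ p' j) (a₂ := q i ≫ g ≫ p' j) (by simp [hfg])]

/-- An object `Z` is a retract of a sum of images `F(Y i)`, hence is given by an idempotent matrix.
Its entries lift by fullness on generators, the lifted matrix is idempotent by faithfulness, and the
image of its splitting is isomorphic to `Z`. Using matrices in place of endomorphisms avoids
assuming biproducts in either category. -/
theorem essSurj_of_generators [F.Faithful]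
    (hF : ∀ X Y, S X → S Y → Function.Surjective (F.map : (X ⟶ Y) → _))
    (hE : ∀ Z, inAdd (fun W => ∃ X, S X ∧ Nonempty (F.obj X ≅ W)) Z)
    (hC : SplitsIdempotents S) : F.EssSurj where
  mem_essImage Z := by
    obtain ⟨ι, _, W, p, q, hW, h⟩ := hE Z
    choose Y hY σ using hW
    replace σ i := (σ i).some
    choose e he using fun i j => hF _ _ (hY i) (hY j) ((σ i).hom ≫ q i ≫ p j ≫ (σ j).inv)
    obtain ⟨X, p', q', h₁, h₂⟩ := hC ι Y hY e (fun i j => F.map_injective (by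
      rw [F.map_sum]
      simp only [F.map_comp, he, Category.assoc, Iso.inv_hom_id_assoc]
      have := congrArg (fun f => (σ i).hom ≫ q i ≫ f ≫ p j ≫ (σ j).inv) h
      simpa [Preadditive.sum_comp, Preadditive.comp_sum] using this))
    have h₃ : ∑ i, F.map (p' i) ≫ F.map (q' i) = 𝟙 (F.obj X) := by
      rw [← F.map_id, ← h₁, F.map_sum]
      simp
    refine ⟨X, ⟨⟨∑ i, F.map (p' i) ≫ (σ i).hom ≫ q i, ∑ i, p i ≫ (σ i).inv ≫ F.map (q' i),
      ?_, ?_⟩⟩⟩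
    · rw [eq_sum_of_decompositions h₃ h₃ (𝟙 _)]
      rw [Preadditive.sum_comp]
      refine Finset.sum_congr rfl fun i _ => ?_
      rw [Preadditive.comp_sum]
      refine Finset.sum_congr rfl fun j _ => ?_
      have := he i j
      rw [← h₂, F.map_comp] at this
      rw [Category.id_comp, this]
      simp
    · rw [eq_sum_of_decompositions h h (𝟙 _)]
      rw [Preadditive.sum_comp]
      refine Finset.sum_congr rfl fun i _ => ?_
      rw [Preadditive.comp_sum]
      refine Finset.sum_congr rfl fun j _ => ?_
      have := he i j
      rw [← h₂, F.map_comp] at this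
      simp only [Category.assoc]
      rw [reassoc_of% this]
      simp

end Generators

/-! ### Splitting of idempotents in categories of projective modules -/

section Splitting

/-- Idempotent matrices of module homomorphisms split. -/
theorem exists_splitting {R : Type u} [Ring R] {ι : Type} [Fintype ι] (Y : ι → ModuleCat.{u} R)
    (e : ∀ i j, Y i ⟶ Y j) (he : ∀ i j, ∑ l, e i l ≫ e l j = e i j) :
    ∃ (X : ModuleCat.{u} R) (p : ∀ i, X ⟶ Y i) (q : ∀ i, Y i ⟶ X),
      ∑ i, p i ≫ q i = 𝟙 X ∧ ∀ i j, q i ≫ p j = e i j := by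
  classical
  -- The matrix becomes an idempotent endomorphism `T` of the product, and its range is the
  -- splitting.
  let T : (∀ i, Y i) →ₗ[R] ∀ i, Y i :=
    LinearMap.pi fun j => ∑ i, (e i j).hom.comp (LinearMap.proj i)
  have hT (y : ∀ i, Y i) (j : ι) : T y j = ∑ i, (e i j).hom (y i) := by simp [T]
  have hT' (i j : ι) (y : Y i) : T (Pi.single i y) j = (e i j).hom y := by
    rw [hT, Finset.sum_eq_single i]
    · simp
    · intro l _ hl
      simp [hl]
    · simp
  have hTT (y : ∀ i, Y i) : T (T y) = T y := by
    ext j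
    rw [hT, hT]
    simp only [hT, map_sum]
    rw [Finset.sum_comm]
    refine Finset.sum_congr rfl fun i _ => ?_
    have := congrArg (fun f => ModuleCat.Hom.hom f (y i)) (he i j)
    simpa [ModuleCat.hom_sum] using this
  refine ⟨ModuleCat.of R (LinearMap.range T),
    fun i => ModuleCat.ofHom ((LinearMap.proj i).comp (LinearMap.range T).subtype),
    fun i => ModuleCat.ofHom (T.rangeRestrict.comp (LinearMap.single R (fun i => Y i) i)), ?_, ?_⟩
  · refine ModuleCat.hom_ext (LinearMap.ext fun x => ?_)
    rw [ModuleCat.hom_sum, LinearMap.sum_apply]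
    obtain ⟨_, y, rfl⟩ := x
    apply Subtype.ext
    rw [AddSubmonoidClass.coe_finsetSum]
    change ∑ i, T (Pi.single i (T y i)) = T y
    rw [← map_sum, Finset.univ_sum_single, hTT]
  · intro i j
    refine ModuleCat.hom_ext (LinearMap.ext fun y => ?_)
    exact hT' i j y

variable {k : Type u} [Field k] {n : ℕ}

/-- The indecomposable projective modules of the elements of `U`, as objects of
`add {A e_i | i ∈ U}`. -/
def addGen (U : Set (Fin (n + 1))) : ObjectProperty (addProj k U).FullSubcategory :=
  fun X => ∃ i ∈ U, X.obj = projObj k i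

theorem inAdd_addGen (U : Set (Fin (n + 1))) (X : (addProj k U).FullSubcategory) :
    inAdd (addGen U) X := by
  obtain ⟨ι, _, Y, p, q, hY, h⟩ := X.2
  exact ⟨ι, inferInstance, fun i => ⟨Y i, inAdd_of (hY i)⟩, fun i => ObjectProperty.homMk (p i),
    fun i => ObjectProperty.homMk (q i), hY, sum_comp_eq_id _ _ h⟩

/-- Split the matrix among modules. The splitting is a retract of a sum of the given projectives,
hence is projective, and the same retraction shows that it lies in the additive closure. -/
theorem splitsIdempotents_addGen (U : Set (Fin (n + 1))) :
    SplitsIdempotents (addGen (k := k) U) := fun ι _ Y hY e he => by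
  obtain ⟨X, p, q, h₁, h₂⟩ := exists_splitting (fun i => (Y i).obj.obj)
    (fun i j => (e i j).hom.hom) (fun i j => by
      have := congrArg (fun f => ((addProj k U).ι ⋙ (IsProj (StarAlg k n)).ι).map f) (he i j)
      rw [Functor.map_sum] at this
      exact this)
  have hX : IsProj (StarAlg k n) X := (isProj_iff_inAdd X).2
    (inAdd_trans (S := fun Z => ∃ i, Z = (Y i).obj.obj)
      (fun Z ⟨i, hi⟩ => by rw [hi]; exact (isProj_iff_inAdd _).1 (Y i).obj.2)
      ⟨ι, inferInstance, _, p, q, fun i => ⟨i, rfl⟩, h₁⟩)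
  let X' : (birepC k n).carrier := ⟨X, hX⟩
  have h₁' : ∑ i, (ObjectProperty.homMk (p i) : X' ⟶ (Y i).obj) ≫ ObjectProperty.homMk (q i) =
    𝟙 X' := sum_comp_eq_id _ _ h₁
  refine ⟨⟨X', ι, inferInstance, _, _, _, hY, h₁'⟩,
    fun i => ObjectProperty.homMk (ObjectProperty.homMk (p i)),
    fun i => ObjectProperty.homMk (ObjectProperty.homMk (q i)), sum_comp_eq_id _ _ h₁', ?_⟩
  intro i j
  exact ObjectProperty.hom_ext _ (ObjectProperty.hom_ext _ (h₂ i j))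

end Splitting

/-! ### Restriction of Ω to a transversal -/

section Transversal

variable {k : Type u} [Field k] {n : ℕ} {P : StarPartition n} (D : CWRData k P)

open StarPartition

theorem exists_mem_transversal {U : Set (Fin (n + 1))} (hU : P.IsTransversal U) :
    ∀ v : P.Vertex, ∃ v' : P.Vertex, v'.toFin ∈ U ∧ v'.first = v.first
  | none => ⟨none, hU.1, rfl⟩
  | some ⟨m, l⟩ => by
    obtain ⟨l', hl', -⟩ := hU.2 m
    exact ⟨some ⟨m, l'⟩, hl', rfl⟩

theorem eq_of_mem_transversal {U : Set (Fin (n + 1))} (hU : P.IsTransversal U) :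
    ∀ {v v' : P.Vertex} (_ : v.toFin ∈ U) (_ : v'.toFin ∈ U) (_ : v.first = v'.first), v = v'
  | none, none, _, _, _ => rfl
  | none, some _, _, _, h => absurd h (by simp [Vertex.first])
  | some _, none, _, _, h => absurd h (by simp [Vertex.first])
  | some ⟨m, l⟩, some ⟨m', l'⟩, h, h', h'' => by
    obtain rfl : m = m' := congrArg Sigma.fst (Option.some.inj h'')
    rw [(hU.2 m).unique h h']

/-- The restriction of `Ω` to `add {A e_i | i ∈ U}` is an equivalence. -/
theorem CWRData.isEquivalence_of_isTransversal {U : Set (Fin (n + 1))} (hU : P.IsTransversal U) :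
    ((addProj k U).ι ⋙ D.Ω.functor).IsEquivalence := by
  have hF : ∀ X Y, addGen U X → addGen U Y →
      Function.Surjective (((addProj k U).ι ⋙ D.Ω.functor).map : (X ⟶ Y) → _) := by
    rintro ⟨_, _⟩ ⟨_, _⟩ ⟨i, hi, rfl⟩ ⟨j, hj, rfl⟩ f
    obtain ⟨v, rfl⟩ := (Vertex.toFin_bijective (P := P)).2 i
    obtain ⟨v', rfl⟩ := (Vertex.toFin_bijective (P := P)).2 j
    obtain ⟨g, hg⟩ := D.exists_map_eq (eq_of_mem_transversal hU hi hj) f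
    exact ⟨ObjectProperty.homMk g, hg⟩
  have := full_of_generators ((addProj k U).ι ⋙ D.Ω.functor) (inAdd_addGen U) hF
  have := essSurj_of_generators ((addProj k U).ι ⋙ D.Ω.functor) hF (fun Z => ?_)
    (splitsIdempotents_addGen U)
  · exact {}
  -- Every object is the image of a sum of indecomposable projectives up to retracts, and each of
  -- these has the same image as the one at the representative of its block in `U`.
  · obtain ⟨X, ⟨e⟩⟩ := D.generated_and_essSurj.2 Z
    refine inAdd_of_iso e (inAdd_map D.Ω.functor (fun Y hY => inAdd_of ?_) (inAdd_projObj X))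
    obtain ⟨i, rfl⟩ := hY
    obtain ⟨v, rfl⟩ := (Vertex.toFin_bijective (P := P)).2 i
    obtain ⟨v', h, h'⟩ := exists_mem_transversal hU v
    exact ⟨⟨projVertex k v', inAdd_of ⟨_, h, rfl⟩⟩, ⟨_, h, rfl⟩, D.nonempty_iso_of_first_eq h'⟩

end Transversal

/-! ### Corner subalgebras -/

section Corner

variable {k : Type u} [Field k] {A B : Type u} [Ring A] [Algebra k A] [Ring B] [Algebra k B]

/-- The part `φ(1) X` of a module `X`, for a homomorphism `φ` which need not preserve `1`. -/
def cornerPart (φ : B →ₙₐ[k] A) (X : Type u) [AddCommGroup X] [Module A X] : AddSubgroup X where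
  carrier := {x | φ 1 • x = x}
  add_mem' {x y} hx hy := (smul_add _ x y).trans (congrArg₂ _ hx hy)
  zero_mem' := smul_zero _
  neg_mem' {x} hx := (smul_neg _ x).trans (congrArg _ hx)

variable (φ : B →ₙₐ[k] A)

/-- The element `φ(1)` acts as the identity on `φ(1) X`, so a homomorphism that does not preserve
units still gives a unital action there. -/
instance (X : Type u) [AddCommGroup X] [Module A X] : Module B (cornerPart φ X) where
  smul b x := ⟨φ b • x.1, by
    change φ 1 • φ b • x.1 = _
    rw [smul_smul, ← map_mul, one_mul]⟩
  one_smul x := Subtype.ext x.2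
  mul_smul a b x := Subtype.ext (by
    change φ (a * b) • x.1 = φ a • φ b • x.1
    rw [map_mul, mul_smul])
  smul_zero b := Subtype.ext (smul_zero _)
  smul_add b x y := Subtype.ext (smul_add _ _ _)
  add_smul a b x := Subtype.ext (by
    change φ (a + b) • x.1 = φ a • x.1 + φ b • x.1
    rw [map_add, add_smul])
  zero_smul x := Subtype.ext (by
    change φ 0 • x.1 = 0
    rw [map_zero, zero_smul])

/-- The restriction of a homomorphism to the corner parts. -/
def cornerMap {X Y : Type u} [AddCommGroup X] [Module A X] [AddCommGroup Y] [Module A Y]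
    (f : X →ₗ[A] Y) : cornerPart φ X →ₗ[B] cornerPart φ Y where
  toFun x := ⟨f x.1, (map_smul f _ _).symm.trans (congrArg f x.2)⟩
  map_add' _ _ := Subtype.ext (map_add f _ _)
  map_smul' _ _ := Subtype.ext (map_smul f _ _)

/-- The functor `X ↦ φ(1) X`. -/
def cornerFunctor : ModuleCat.{u} A ⥤ ModuleCat.{u} B where
  obj X := ModuleCat.of B (cornerPart φ X)
  map f := ModuleCat.ofHom (cornerMap φ f.hom)

instance : (cornerFunctor φ).Additive where

instance : (cornerFunctor φ).Linear k where
  map_smul {X Y} f r := by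
    refine ModuleCat.hom_ext (LinearMap.ext fun x => Subtype.ext ?_)
    have h : φ (algebraMap k B r) = algebraMap k A r * φ 1 := by
      rw [Algebra.algebraMap_eq_smul_one, map_smul, Algebra.smul_def]
    change algebraMap k A r • f.hom x.1 = φ (algebraMap k B r) • f.hom x.1
    rw [h, mul_smul]
    exact congrArg (algebraMap k A r • ·) ((congrArg f.hom x.2).symm.trans (map_smul f.hom _ _))

end Corner

/-! ### A smaller star algebra as a corner of a larger one -/

section StarCorner

open StarAlg

variable {k : Type u} [Field k] {n r : ℕ} {u : Fin r → Fin n} (hu : Function.Injective u)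

variable (k) in
/-- The inclusion of star algebras defined by an injection between the sets of leaves. -/
def starInclusion : StarAlg k r →ₙₐ[k] StarAlg k n where
  toFun x := ⟨x.e₀, x.c, Function.extend u x.e 0, Function.extend u x.a 0,
    Function.extend u x.b 0⟩
  map_smul' c x := by
    ext j <;> try rfl
    all_goals
      by_cases hj : ∃ i, u i = j
      · obtain ⟨i, rfl⟩ := hj
        simp [hu.extend_apply]
      · simp [Function.extend_apply' _ _ _ hj]
  map_zero' := by
    ext j <;> try rfl
    all_goals
      by_cases hj : ∃ i, u i = j
      · obtain ⟨i, rfl⟩ := hj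
        simp [hu.extend_apply]
      · simp [Function.extend_apply' _ _ _ hj]
  map_add' x y := by
    ext j <;> try rfl
    all_goals
      by_cases hj : ∃ i, u i = j
      · obtain ⟨i, rfl⟩ := hj
        simp [hu.extend_apply]
      · simp [Function.extend_apply' _ _ _ hj]
  map_mul' x y := by
    ext j
    · rfl
    · refine congrArg (x.e₀ * y.c + x.c * y.e₀ + ·) (Fintype.sum_of_injective u hu _ _ ?_ ?_)
      · intro j hj
        simp [Function.extend_apply' _ _ _ hj]
      · intro i
        simp [hu.extend_apply]
    all_goals
      by_cases hj : ∃ i, u i = j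
      · obtain ⟨i, rfl⟩ := hj
        simp [hu.extend_apply]
      · simp [Function.extend_apply' _ _ _ hj]

variable (u) in
/-- The restriction of coefficients to a star with fewer leaves. -/
def starRestrict (y : StarAlg k n) : StarAlg k r := ⟨y.e₀, y.c, y.e ∘ u, y.a ∘ u, y.b ∘ u⟩

theorem starRestrict_inclusion (x : StarAlg k r) : starRestrict u (starInclusion k hu x) = x := by
  ext <;> simp [starRestrict, starInclusion, hu.extend_apply]

theorem starInclusion_injective : Function.Injective (starInclusion k hu) :=
  Function.LeftInverse.injective (starRestrict_inclusion hu)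

/-- With `e = φ(1)`, this identifies the image of the inclusion `φ` with the corner `e A e`, and
`starRestrict` with the compression `y ↦ e y e`. -/
theorem starInclusion_restrict (y : StarAlg k n) :
    starInclusion k hu (starRestrict u y) = starInclusion k hu 1 * y * starInclusion k hu 1 := by
  ext j
  · simp [starInclusion, starRestrict]
  · simp only [starInclusion, starRestrict]
    have : Function.extend u ((1 : StarAlg k r).a) 0 = 0 := by
      ext j
      by_cases hj : ∃ i, u i = j
      · obtain ⟨i, rfl⟩ := hj
        simp [hu.extend_apply]
      · simp [Function.extend_apply' _ _ _ hj]
    have : Function.extend u ((1 : StarAlg k r).b) 0 = 0 := by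
      ext j
      by_cases hj : ∃ i, u i = j
      · obtain ⟨i, rfl⟩ := hj
        simp [hu.extend_apply]
      · simp [Function.extend_apply' _ _ _ hj]
    simp [*]
  all_goals
    by_cases hj : ∃ i, u i = j
    · obtain ⟨i, rfl⟩ := hj
      simp [starInclusion, starRestrict, hu.extend_apply]
    · simp [starInclusion, starRestrict, Function.extend_apply' _ _ _ hj]

variable (u) in
/-- The map on vertices defined by a map on leaves. -/
def starVertex : Fin (r + 1) → Fin (n + 1) := Fin.cases 0 fun m => (u m).succ

theorem starInclusion_idem (m : Fin (r + 1)) :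
    starInclusion k hu (idem k r m) = idem k n (starVertex u m) := by
  refine Fin.cases ?_ (fun m => ?_) m
  · ext j <;> try rfl
    all_goals
      by_cases hj : ∃ i, u i = j
      · obtain ⟨i, rfl⟩ := hj
        simp [starVertex, starInclusion, idem, hu.extend_apply]
      · simp [starVertex, starInclusion, idem, Function.extend_apply' _ _ _ hj]
  · ext j <;> try rfl
    all_goals
      by_cases hj : ∃ i, u i = j
      · obtain ⟨i, rfl⟩ := hj
        simp [starVertex, starInclusion, idem, hu.extend_apply, Pi.single_apply, hu.eq_iff]
      · have : j ≠ u m := fun h => hj ⟨m, h.symm⟩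
        simp [starVertex, starInclusion, idem, Function.extend_apply' _ _ _ hj, this]

theorem starInclusion_one_mul_idem (m : Fin (r + 1)) :
    starInclusion k hu 1 * idem k n (starVertex u m) = idem k n (starVertex u m) := by
  rw [← starInclusion_idem hu, ← map_mul, one_mul]

theorem idem_mul_starInclusion_one (m : Fin (r + 1)) :
    idem k n (starVertex u m) * starInclusion k hu 1 = idem k n (starVertex u m) := by
  rw [← starInclusion_idem hu, ← map_mul, mul_one]

/-- The generator of `A e_i`, as an element of the corner part. -/
def cornerGen (m : Fin (r + 1)) :
    cornerPart (starInclusion k hu) (leftIdeal (idem k n (starVertex u m))) :=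
  ⟨gen k n _, Subtype.ext (starInclusion_one_mul_idem hu m)⟩

/-- With `e = φ(1)`, an element of `e A e_i` for a vertex `i` of the smaller star lies in `e A e`,
because `e_i e = e_i`. -/
theorem starInclusion_restrict_of_mem {m : Fin (r + 1)}
    (x : cornerPart (starInclusion k hu) (leftIdeal (idem k n (starVertex u m)))) :
    starInclusion k hu (starRestrict u x.1.1) = x.1.1 := by
  have h₁ : starInclusion k hu 1 * x.1.1 = x.1.1 := congrArg Subtype.val x.2
  have h₂ : x.1.1 * idem k n (starVertex u m) = x.1.1 := x.1.2
  rw [starInclusion_restrict, h₁, ← h₂, mul_assoc, idem_mul_starInclusion_one]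

theorem starRestrict_smul_cornerGen {m : Fin (r + 1)}
    (x : cornerPart (starInclusion k hu) (leftIdeal (idem k n (starVertex u m)))) :
    starRestrict u x.1.1 • cornerGen hu m = x := by
  refine Subtype.ext (Subtype.ext ?_)
  change starInclusion k hu (starRestrict u x.1.1) * idem k n (starVertex u m) = x.1.1
  rw [starInclusion_restrict_of_mem]
  exact x.1.2

/-- The coefficients of an element of a corner part, as a linear map. -/
def cornerCoeff (m : Fin (r + 1)) :
    cornerPart (starInclusion k hu) (leftIdeal (idem k n (starVertex u m))) →ₗ[StarAlg k r]
      StarAlg k r where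
  toFun x := starRestrict u x.1.1
  map_add' _ _ := rfl
  map_smul' b x := starInclusion_injective (k := k) hu (by
    rw [RingHom.id_apply, smul_eq_mul, map_mul, starInclusion_restrict_of_mem,
      starInclusion_restrict_of_mem]
    rfl)

/-- The module `e A e_i` is cyclic over the corner, generated by `e_i`, and taking coefficients is a
section of the resulting surjection. -/
theorem corner_proj_inAdd (m : Fin (r + 1)) :
    inAdd (fun Y => Y = ModuleCat.of (StarAlg k r) (StarAlg k r))
      ((cornerFunctor (starInclusion k hu)).obj (projObj k (starVertex u m)).obj) := by
  refine ⟨Unit, inferInstance, fun _ => ModuleCat.of (StarAlg k r) (StarAlg k r),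
    fun _ => ModuleCat.ofHom (cornerCoeff hu m),
    fun _ => ModuleCat.ofHom (LinearMap.toSpanSingleton (StarAlg k r) _ (cornerGen hu m)),
    fun _ => rfl, ?_⟩
  refine ModuleCat.hom_ext (LinearMap.ext fun x => ?_)
  rw [ModuleCat.hom_sum, LinearMap.sum_apply, Fintype.sum_unique]
  exact starRestrict_smul_cornerGen hu x

/-- Under the identification of `A_r` with the corner, this is the decomposition of `A_r` by its
vertex idempotents. -/
theorem regular_inAdd_corner :
    inAdd (fun Y => ∃ m, Y = (cornerFunctor (starInclusion k hu)).obj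
      (projObj k (starVertex u m)).obj) (ModuleCat.of (StarAlg k r) (StarAlg k r)) := by
  refine ⟨Fin (r + 1), inferInstance, _,
    fun m => ModuleCat.ofHom (LinearMap.toSpanSingleton (StarAlg k r) _ (cornerGen hu m)),
    fun m => ModuleCat.ofHom (cornerCoeff hu m), fun m => ⟨m, rfl⟩, ?_⟩
  refine ModuleCat.hom_ext (LinearMap.ext fun x => ?_)
  rw [ModuleCat.hom_sum, LinearMap.sum_apply]
  have h (m : Fin (r + 1)) : starRestrict u (x • cornerGen hu m).1.1 = x * idem k r m := by
    change starRestrict u (starInclusion k hu x * idem k n (starVertex u m)) = _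
    rw [← starInclusion_idem hu, ← map_mul, starRestrict_inclusion]
  change ∑ m, starRestrict u (x • cornerGen hu m).1.1 = x
  simp only [h]
  rw [← Finset.mul_sum, sum_idem, mul_one]

/-- The corner functor on `add {A e_i | i ∈ U}`, where `U` is the image of the smaller star. -/
def starCorner : (addProj k (Set.range (starVertex u))).FullSubcategory ⥤
    (IsProj (StarAlg k r)).FullSubcategory :=
  (IsProj (StarAlg k r)).lift
    ((addProj k (Set.range (starVertex u))).ι ⋙ (IsProj (StarAlg k n)).ι ⋙
      cornerFunctor (starInclusion k hu)) (fun X => (isProj_iff_inAdd _).2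
        (inAdd_map ((IsProj (StarAlg k n)).ι ⋙ cornerFunctor (starInclusion k hu))
          (fun Y hY => by
            obtain ⟨_, ⟨m, rfl⟩, rfl⟩ := hY
            exact corner_proj_inAdd hu m) X.2))

instance : (starCorner (k := k) hu).Additive where

instance : (starCorner (k := k) hu).Linear k where
  map_smul f c := ObjectProperty.hom_ext _
    ((cornerFunctor (starInclusion k hu)).map_smul c f.hom.hom)

/-- On both sides a morphism is determined by the image of the generator `e_i`. Conversely, the
image of `e_i` under a morphism over the corner defines a right multiplication over `A_n`, and this
extends the given morphism. -/
theorem starCorner_bijective {m m' : Fin (r + 1)}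
    (X Y : (addProj k (Set.range (starVertex u))).FullSubcategory)
    (hX : X.obj = projObj k (starVertex u m)) (hY : Y.obj = projObj k (starVertex u m')) :
    Function.Bijective ((starCorner hu).map : (X ⟶ Y) → _) := by
  obtain ⟨_, h⟩ := X
  obtain ⟨_, h'⟩ := Y
  dsimp only at hX hY
  subst hX hY
  constructor
  · intro f g hfg
    refine ObjectProperty.hom_ext _ (proj_hom_ext ?_)
    exact congrArg Subtype.val (congrArg (fun φ => φ.hom.hom (cornerGen hu m)) hfg)
  · intro f
    refine ⟨ObjectProperty.homMk (rmulHom _ (f.hom.hom (cornerGen hu m)).1), ?_⟩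
    refine ObjectProperty.hom_ext _ (ModuleCat.hom_ext (LinearMap.ext fun x => ?_))
    have h₁ : f.hom.hom x = starRestrict u x.1.1 • f.hom.hom (cornerGen hu m) :=
      (congrArg f.hom.hom (starRestrict_smul_cornerGen hu x).symm).trans
        (map_smul f.hom.hom (starRestrict u x.1.1) (cornerGen hu m))
    refine Eq.trans (Subtype.ext ?_) h₁.symm
    exact (congrArg (· • (f.hom.hom (cornerGen hu m)).1)
      (starInclusion_restrict_of_mem hu x)).symm

/-- The functor is bijective on morphisms between the generators `A e_i`, the regular module of
`A_r` is a sum of their images, and idempotents split in the source. -/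
theorem starCorner_isEquivalence : (starCorner (k := k) hu).IsEquivalence := by
  have hb : ∀ X Y, addGen (Set.range (starVertex u)) X → addGen (Set.range (starVertex u)) Y →
      Function.Bijective ((starCorner (k := k) hu).map : (X ⟶ Y) → _) := by
    rintro X Y ⟨_, ⟨m, rfl⟩, hX⟩ ⟨_, ⟨m', rfl⟩, hY⟩
    exact starCorner_bijective hu X Y hX hY
  have := full_of_generators (starCorner (k := k) hu) (inAdd_addGen _)
    fun X Y hX hY => (hb X Y hX hY).2
  have := faithful_of_generators (starCorner (k := k) hu) (inAdd_addGen _)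
    fun X Y hX hY => (hb X Y hX hY).1
  have := essSurj_of_generators (starCorner (k := k) hu) (fun X Y hX hY => (hb X Y hX hY).2)
    (fun Z => ?_) (splitsIdempotents_addGen _)
  · exact {}
  · obtain ⟨ι, _, W, p, q, hW, h⟩ :=
      inAdd_trans (fun _ h => by rw [h]; exact regular_inAdd_corner hu)
        ((isProj_iff_inAdd Z.obj).1 Z.2)
    choose m hm using hW
    obtain rfl : W = _ := funext hm
    let V (m : Fin (r + 1)) : (addProj k (Set.range (starVertex u))).FullSubcategory :=
      ⟨projObj k (starVertex u m), inAdd_of ⟨_, ⟨m, rfl⟩, rfl⟩⟩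
    refine ⟨ι, inferInstance, fun i => (starCorner hu).obj (V (m i)),
      fun i => ObjectProperty.homMk (p i), fun i => ObjectProperty.homMk (q i),
      fun i => ⟨V (m i), ⟨_, ⟨m i, rfl⟩, rfl⟩, ⟨Iso.refl _⟩⟩, sum_comp_eq_id _ _ h⟩

end StarCorner

/-! ### Identification of the underlying category with A_r-proj -/

section Finitary

variable {k : Type u} [Field k] {n : ℕ} {P : StarPartition n} (D : CWRData k P)

namespace StarPartition

variable (P)

/-- The first elements of the blocks other than `{0}`. -/
def firstLeaf (m : Fin P.r) : Fin n := P.enum ⟨m, ⟨0, P.len_pos m⟩⟩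

theorem firstLeaf_injective : Function.Injective P.firstLeaf := fun _ _ h =>
  congrArg Sigma.fst (P.enum.injective h)

theorem isTransversal_firstLeaf : P.IsTransversal (Set.range (starVertex P.firstLeaf)) := by
  refine ⟨⟨0, rfl⟩, fun m => ⟨⟨0, P.len_pos m⟩, ⟨m.succ, rfl⟩, ?_⟩⟩
  rintro l ⟨m', h⟩
  refine Fin.cases (fun h => absurd h (Fin.succ_ne_zero _).symm) (fun m' h => ?_) m' h
  have := P.enum.injective (Fin.succ_injective _ h)
  cases this
  rfl

end StarPartition

/-- The underlying category of the quotient is linearly equivalent to `A_r-proj`. -/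
theorem CWRData.linearlyEquivalent :
    LinearlyEquivalent k D.CWR.carrier (IsProj (StarAlg k P.r)).FullSubcategory := by
  let F := (addProj k (Set.range (starVertex P.firstLeaf))).ι ⋙ D.Ω.functor
  have : F.IsEquivalence := D.isEquivalence_of_isTransversal P.isTransversal_firstLeaf
  have : F.Linear k := ⟨fun f c => D.Ω.functor.map_smul c f.hom⟩
  have : F.Additive := ⟨fun {_ _ f g} => D.Ω.functor.map_add (f := f.hom) (g := g.hom)⟩
  have := starCorner_isEquivalence (k := k) P.firstLeaf_injective
  have : F.asEquivalence.functor.Additive := ‹F.Additive›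
  have : F.asEquivalence.functor.Linear k := ‹F.Linear k›
  have : F.asEquivalence.inverse.Additive := inferInstance
  have : F.asEquivalence.inverse.Linear k := inferInstance
  -- Both equivalences start from the additive closure of the transversal of first leaves together
  -- with `0`: one leads to the quotient birepresentation, the other to `A_r-proj`.
  exact ⟨F.asEquivalence.inverse ⋙ starCorner P.firstLeaf_injective, inferInstance, inferInstance,
    inferInstance⟩

theorem CWRData.isFinitary : IsFinitary D.CWR :=
  ⟨StarAlg k P.r, inferInstance, inferInstance, inferInstance, D.linearlyEquivalent⟩

end Finitary

end StarRep

end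

theorem mainTheorem4 (k : Type u) [Field k] [IsAlgClosed k] [CharZero k] (n : ℕ) (hn : 0 < n)
    (P : StarRep.StarPartition n) :
    Nonempty (StarRep.CWRData k P) ∧ ∀ D : StarRep.CWRData k P,
      StarRep.IsFinitary D.CWR ∧
      StarRep.LinearlyEquivalent k D.CWR.carrier
        (StarRep.IsProj (StarRep.StarAlg k P.r)).FullSubcategory ∧
      D.Ω.functor.Faithful ∧
      (∀ X Y : (StarRep.birepC k n).carrier, Indecomposable X.obj → Indecomposable Y.obj →
        (Function.Bijective (fun f : X ⟶ Y => D.Ω.functor.map f) ↔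
          ¬ (¬ Nonempty (X ≅ Y) ∧ Nonempty (D.Ω.functor.obj X ≅ D.Ω.functor.obj Y)))) ∧
      (∀ U : Set (Fin (n + 1)), P.IsTransversal U →
        ((StarRep.addProj k U).ι ⋙ D.Ω.functor).IsEquivalence) := by
  exact ⟨StarRep.nonempty_CWRData k P, fun D => ⟨D.isFinitary, D.linearlyEquivalent, D.faithful,
    fun _ _ hX hY => D.bijective_map_iff hX hY, fun _ hU => D.isEquivalence_of_isTransversal hU⟩⟩
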